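/- Let $n\ge 2$. Let $\mathcal K_{n,1}$ be the space of smooth embeddings $f:\mathbb R\to\mathbb R^n$ with $f(x)=(x,0,\dots,0)$ for $|x|\ge 1$, let $\mathrm{Emb}(S^1,S^n)$ be the space of smooth embeddings $S^1\to S^n$, and let $\mathrm{Emb}_*(S^1,S^n)$ be the subspace of those that preserve the base points, all with the $C^\infty$ topology. Regard $S^n$ as the one-point compactification of $\mathbb R^n$, by stereographic projection from its base point (and likewise $S^1$ as that of $\mathbb R$); adding the point at infinity, a long knot $f$ gives $\dot f\in\mathrm{Emb}_*(S^1,S^n)$. Let $SO(n-1)\subset SO(n)\subset SO(n+1)$ be the subgroups such that $SO(n)$ fixes the base point of $S^n$ and acts on $\mathbb R^n$ in the standard way, and $SO(n-1)$ consists of the rotations of $\mathbb R^n$ that fix the first (long) axis. For a group $G$ containing $SO(n-1)$, write $G\times_{SO(n-1)}\mathcal K_{n,1}$ for the quotient of $G\times\mathcal K_{n,1}$ by $(gh,f)\sim(g,h\cdot f)$, $h\in SO(n-1)$. 1. $SO(n-1)$ acts continuously on $\mathcal K_{n,1}$ by $h\cdot f=h\circ f$, and $[A,f]\mapsto A\circ\dot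 f$ gives well-defined continuous maps $\Theta_n$ in commutative diagrams $$\begin{array}{ccccc} SO(n)\times_{SO(n-1)}\mathcal K_{n,1}&\to& SO(n+1)\times_{SO(n-1)}\mathcal K_{n,1}&\to& SO(n+1)/SO(n)\\ \downarrow{\scriptstyle\Theta_n}&&\downarrow{\scriptstyle\Theta_n}&&\downarrow{\scriptstyle\cong}\\ \mathrm{Emb}_*(S^1,S^n)&\to&\mathrm{Emb}(S^1,S^n)&\to& S^n\end{array}$$ $$\begin{array}{ccccc} \mathcal K_{n,1}&\to& SO(n)\times_{SO(n-1)}\mathcal K_{n,1}&\to& SO(n)/SO(n-1)\\ \downarrow{\scriptstyle\kappa}&&\downarrow{\scriptstyle\Theta_n}&&\downarrow{\scriptstyle\cong}\\ F&\to&\mathrm{Emb}_*(S^1,S^n)&\to& S^{n-1}\end{array}$$ whose rows are locally trivial fibre bundles. Here $\mathrm{Emb}(S^1,S^n)\to S^n$ is evaluation at the base point, $\mathrm{Emb}_*(S^1,S^n)\to S^{n-1}$ takes the unit tangent direction at the base point, $F$ is the fibre of the latter over the direction of the long axis, $\kappa(f)=\dot f$, and the right-hand vertical maps are the homeomorphisms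 induced by the actions of $SO(n+1)$ on $S^n$ and of $SO(n)$ on $S^{n-1}$. Both maps $\Theta_n$ and the map $\kappa$ are homotopy equivalences. 2. The map $SO(n+1)\times_{SO(n-1)}\mathcal K_{n,1}\to SO(n+1)/SO(n-1)$ is a locally trivial fibre bundle with fibre $\mathcal K_{n,1}$. 3. $SO(n-1)\to SO(n)\to S^{n-1}$ is a locally trivial fibre bundle, and $\Theta_n:SO(n)\times_{SO(n-1)}\mathcal K_{n,1}\to\mathrm{Emb}_*(S^1,S^n)$ is a fibre homotopy equivalence over $S^{n-1}$. In particular, for $n=3$, the bundle $\mathcal K_{3,1}\to\mathrm{Emb}_*(S^1,S^3)\to S^2$ is, up to fibre homotopy equivalence, the bundle with fibre $\mathcal K_{3,1}$ induced from $SO(2)\to SO(3)\to S^2$ and the action of $SO(2)$ on $\mathcal K_{3,1}$ by rotation about the long axis. 4. There is a homeomorphism $\mathrm{Emb}(S^1,S^3)\cong S^3\times\mathrm{Emb}_*(S^1,S^3)$. 5. $\mathrm{Emb}_*(S^1,S^3)$ is homotopy equivalent to the union of two copies of $D^2\times\mathcal K_{3,1}$ glued along their boundaries $S^1\times\mathcal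 K_{3,1}$ by $(z,f)\mapsto(z,z^2\cdot f)$, where $S^1=SO(2)$ acts on $\mathcal K_{3,1}$ by rotation about the long axis. -/

import Mathlib

open scoped Manifold ContDiff Topology

noncomputable section

namespace KnotSpaces

/-- Euclidean space `ℝⁿ`. -/
abbrev E (n : ℕ) : Type := EuclideanSpace ℝ (Fin n)

/-- The unit sphere `Sⁿ ⊂ ℝⁿ⁺¹`, with its standard smooth structure. -/
abbrev Sph (n : ℕ) : Type := Metric.sphere (0 : E (n + 1)) 1

/-- The base point `e₀ = (1, 0, …, 0)` of `Sⁿ`. -/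
def pole (n : ℕ) : Sph n := ⟨EuclideanSpace.single 0 1, by simp⟩

/-! ### Rotation groups -/

/-- The rotation group `SO(n)`, with the subspace topology from the space of matrices. -/
abbrev SO (n : ℕ) : Type := Matrix.specialOrthogonalGroup (Fin n) ℝ

/-- The standard linear action of `SO(n)` on `ℝⁿ`. -/
def act {n : ℕ} (A : SO n) : E n →L[ℝ] E n := Matrix.toEuclideanCLM (𝕜 := ℝ) A.1

theorem act_one {n : ℕ} (v : E n) : act (1 : SO n) v = v := by
  simp [act]

theorem act_mul {n : ℕ} (A B : SO n) (v : E n) : act (A * B) v = act A (act B v) := by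
  simp [act]

theorem act_injective {n : ℕ} (A : SO n) : Function.Injective (act A) :=
  Function.LeftInverse.injective (g := act A⁻¹) fun v => by
    rw [← act_mul, inv_mul_cancel, act_one]

/-- The block matrix `diag(1, M)`. -/
def blockOne {n : ℕ} (M : Matrix (Fin n) (Fin n) ℝ) : Matrix (Fin (n + 1)) (Fin (n + 1)) ℝ :=
  Matrix.of fun i j =>
    Fin.cases (Fin.cases 1 (fun _ => 0) j) (fun i' => Fin.cases 0 (fun j' => M i' j') j) i

@[simp] theorem blockOne_zero_zero {n : ℕ} (M : Matrix (Fin n) (Fin n) ℝ) :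
    blockOne M 0 0 = 1 := rfl

@[simp] theorem blockOne_zero_succ {n : ℕ} (M : Matrix (Fin n) (Fin n) ℝ) (j : Fin n) :
    blockOne M 0 j.succ = 0 := rfl

@[simp] theorem blockOne_succ_zero {n : ℕ} (M : Matrix (Fin n) (Fin n) ℝ) (i : Fin n) :
    blockOne M i.succ 0 = 0 := rfl

@[simp] theorem blockOne_succ_succ {n : ℕ} (M : Matrix (Fin n) (Fin n) ℝ) (i j : Fin n) :
    blockOne M i.succ j.succ = M i j := rfl

theorem blockOne_one {n : ℕ} : blockOne (1 : Matrix (Fin n) (Fin n) ℝ) = 1 := by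
  ext i j
  refine Fin.cases ?_ (fun i => ?_) i <;> refine Fin.cases ?_ (fun j => ?_) j <;>
    simp [Matrix.one_apply, Fin.succ_ne_zero, (Fin.succ_ne_zero _).symm]

theorem blockOne_mul {n : ℕ} (M N : Matrix (Fin n) (Fin n) ℝ) :
    blockOne (M * N) = blockOne M * blockOne N := by
  ext i j
  refine Fin.cases ?_ (fun i => ?_) i <;> refine Fin.cases ?_ (fun j => ?_) j <;>
    simp [Matrix.mul_apply, Fin.sum_univ_succ]

theorem blockOne_star {n : ℕ} (M : Matrix (Fin n) (Fin n) ℝ) :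
    star (blockOne M) = blockOne (star M) := by
  ext i j
  refine Fin.cases ?_ (fun i => ?_) i <;> refine Fin.cases ?_ (fun j => ?_) j <;>
    simp [Matrix.star_apply]

theorem blockOne_det {n : ℕ} (M : Matrix (Fin n) (Fin n) ℝ) : (blockOne M).det = M.det := by
  rw [Matrix.det_succ_row_zero, Fin.sum_univ_succ]
  have h : (blockOne M).submatrix Fin.succ Fin.succ = M := by
    ext i j; simp
  simp [h]

theorem blockOne_mem {n : ℕ} (A : SO n) :
    blockOne A.1 ∈ Matrix.specialOrthogonalGroup (Fin (n + 1)) ℝ := by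
  have h := Matrix.mem_specialOrthogonalGroup_iff.1 A.2
  rw [Matrix.mem_specialOrthogonalGroup_iff, Matrix.mem_unitaryGroup_iff,
    blockOne_det, blockOne_star, ← blockOne_mul, Matrix.mem_unitaryGroup_iff.1 h.1, blockOne_one]
  exact ⟨rfl, h.2⟩

/-- The inclusion `SO(n) → SO(n+1)`, `A ↦ diag(1, A)`, onto the stabiliser of `e₀`. -/
def stab (n : ℕ) : SO n →* SO (n + 1) where
  toFun A := ⟨blockOne A.1, blockOne_mem A⟩
  map_one' := Subtype.ext blockOne_one
  map_mul' A B := Subtype.ext (blockOne_mul A.1 B.1)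

theorem act_stab_single {n : ℕ} (A : SO n) (x : ℝ) :
    act (stab n A) (EuclideanSpace.single 0 x) = EuclideanSpace.single 0 x := by
  ext i
  refine Fin.cases ?_ (fun i => ?_) i <;>
    simp [act, stab, Matrix.mulVec, dotProduct, Matrix.ofLp_toEuclideanCLM]

/-- The identification of the circle with `SO(2)`. -/
def circleRot (z : Circle) : SO 2 :=
  ⟨!![(z : ℂ).re, -(z : ℂ).im; (z : ℂ).im, (z : ℂ).re],
    Matrix.of_mem_specialOrthogonalGroup_fin_two_iff.2 ⟨rfl, rfl, by
      have h := z.normSq_coe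
      rw [Complex.normSq_apply] at h
      nlinarith [h]⟩⟩

/-! ### Spaces of smooth embeddings -/

/-- Smooth embeddings of finite-dimensional manifolds: smooth maps with injective differential at
every point which are homeomorphisms onto their image. -/
def IsSmoothEmb {V W H G M N : Type*} [NormedAddCommGroup V] [NormedSpace ℝ V]
    [NormedAddCommGroup W] [NormedSpace ℝ W] [TopologicalSpace H] [TopologicalSpace G]
    (I : ModelWithCorners ℝ V H) (J : ModelWithCorners ℝ W G)
    [TopologicalSpace M] [ChartedSpace H M] [TopologicalSpace N] [ChartedSpace G N]
    (f : M → N) : Prop :=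
  ContMDiff I J ∞ f ∧ (∀ x, Function.Injective (mfderiv I J f x)) ∧ Topology.IsEmbedding f

/-- The `C^∞` topology on a set `X` of smooth curves `ℝ → V` (given by `c : X → (ℝ → V)`):
uniform convergence of the derivatives of every order on compact sets. -/
abbrev smoothTopology {X V : Type*} [NormedAddCommGroup V] [NormedSpace ℝ V] (c : X → ℝ → V) :
    TopologicalSpace X :=
  ⨅ k : ℕ, TopologicalSpace.induced
    (fun x => UniformOnFun.ofFun {s : Set ℝ | IsCompact s} (iteratedDeriv k (c x))) inferInstance

/-- The space `K_{n,1}` of long knots in `ℝⁿ`. -/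
def LongKnot (n : ℕ) [NeZero n] : Type :=
  {f : ℝ → E n // IsSmoothEmb 𝓘(ℝ, ℝ) 𝓘(ℝ, E n) f ∧
    ∀ x : ℝ, 1 ≤ |x| → f x = EuclideanSpace.single 0 x}

instance (n : ℕ) [NeZero n] : TopologicalSpace (LongKnot n) := smoothTopology fun f => f.1

/-- The space `Emb(S¹, Sⁿ)` of smooth embeddings. Its `C^∞` topology is the topology of uniform
convergence of all angular derivatives of the embeddings, viewed as maps `S¹ → Sⁿ ⊂ ℝⁿ⁺¹`. -/
def Emb (n : ℕ) : Type := {f : Circle → Sph n // IsSmoothEmb (𝓡 1) (𝓡 n) f}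

instance (n : ℕ) : TopologicalSpace (Emb n) :=
  smoothTopology fun f t => (f.1 (Circle.exp t) : E (n + 1))

/-- The subspace `Emb_*(S¹, Sⁿ)` of pointed embeddings. -/
abbrev EmbPt (n : ℕ) : Type := {f : Emb n // f.1 1 = pole n}

/-- Evaluation at the base point `1 ∈ S¹`. -/
def ev (n : ℕ) (f : Emb n) : Sph n := f.1 1

/-- The tangent direction at the base point of a pointed embedding: the unit vector of
`T_{e₀}Sⁿ = ℝⁿ` in the direction of the derivative at `1 ∈ S¹`. -/
def tangentDir {n : ℕ} (f : EmbPt n) : E n :=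
  let v : E (n + 1) := deriv (fun t : ℝ => (f.1.1 (Circle.exp t) : E (n + 1))) 0
  let w : E n := WithLp.toLp 2 fun i => v i.succ
  ‖w‖⁻¹ • w

/-- The action of `SO(n-1)` on `K_{n,1}` (here `n = m + 1`) by rotations of `ℝⁿ` that fix the
long axis pointwise. -/
instance (m : ℕ) : MulAction (SO m) (LongKnot (m + 1)) where
  smul A f := ⟨fun x => act (stab m A) (f.1 x), by
    obtain ⟨f, ⟨hs, hd, he⟩, hf⟩ := f
    have hs' : ContDiff ℝ ∞ f := contMDiff_iff_contDiff.1 hs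
    refine ⟨⟨contMDiff_iff_contDiff.2 ((act (stab m A)).contDiff.comp hs'), fun x => ?_, ?_⟩,
      fun x hx => ?_⟩
    · have h1 : HasFDerivAt f (fderiv ℝ f x) x :=
        (hs'.differentiable (by simp) x).hasFDerivAt
      have h2 := ((act (stab m A)).hasFDerivAt (x := f x)).comp x h1
      have h3 := hd x
      rw [mfderiv_eq_fderiv] at h3 ⊢
      have h4 : fderiv ℝ (fun x => act (stab m A) (f x)) x
          = (act (stab m A)).comp (fderiv ℝ f x) := h2.fderiv
      rw [h4]
      exact (act_injective _).comp h3
    · refine (Function.LeftInverse.isEmbedding (f := act (stab m A)⁻¹) (fun v => ?_)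
        (act _).continuous (act _).continuous).comp he
      rw [← act_mul, inv_mul_cancel, act_one]
    · change act (stab m A) (f x) = _
      rw [hf x hx, act_stab_single]⟩
  one_smul f := Subtype.ext (funext fun x => by
    change act (stab m 1) (f.1 x) = _
    rw [map_one, act_one])
  mul_smul A B f := Subtype.ext (funext fun x => by
    change act (stab m (A * B)) (f.1 x) = act (stab m A) (act (stab m B) (f.1 x))
    rw [map_mul, act_mul])

/-- Inverse stereographic projection `ℝⁿ → Sⁿ \ {e₀}`, which identifies `Sⁿ` with the one-point
compactification of `ℝⁿ`, the point at infinity being `e₀`. -/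
def invStereo {n : ℕ} (y : E n) : E (n + 1) :=
  WithLp.toLp 2 (Fin.cons ((‖y‖ ^ 2 - 1) / (‖y‖ ^ 2 + 1)) fun i => 2 * y i / (‖y‖ ^ 2 + 1))

/-- The one-point compactification `S¹ → Sⁿ` of a long knot; `S¹ \ {1}` is identified with `ℝ` by
stereographic projection `z ↦ im z / (1 - re z)`. -/
def compactify {n : ℕ} [NeZero n] (f : LongKnot n) (z : Circle) : E (n + 1) :=
  open Classical in
  if z = 1 then pole n else invStereo (f.1 ((z : ℂ).im / (1 - (z : ℂ).re)))

/-! ### Balanced products `G ×_H X` -/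

/-- The relation `(g φ(h), x) ∼ (g, h • x)` on `G × X`. -/
def balancedSetoid {G H : Type*} [Group G] [Group H] (φ : H →* G) (X : Type*) [MulAction H X] :
    Setoid (G × X) where
  r a b := ∃ h : H, a.1 = b.1 * φ h ∧ b.2 = h • a.2
  iseqv :=
    { refl := fun a => ⟨1, by simp⟩
      symm := by
        rintro a b ⟨h, h1, h2⟩
        exact ⟨h⁻¹, by simp [h1], by simp [h2]⟩
      trans := by
        rintro a b c ⟨h, h1, h2⟩ ⟨k, k1, k2⟩
        exact ⟨k * h, by simp [h1, k1, mul_assoc], by simp [k2, h2, mul_smul]⟩ }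

/-- The balanced product `G ×_H X`, for `H` acting on `G` on the right through `φ : H → G`. -/
def Balanced {G H : Type*} [Group G] [Group H] (φ : H →* G) (X : Type*) [MulAction H X] : Type _ :=
  Quotient (balancedSetoid φ X)

instance {G H : Type*} [Group G] [Group H] (φ : H →* G) (X : Type*) [MulAction H X]
    [TopologicalSpace G] [TopologicalSpace X] : TopologicalSpace (Balanced φ X) :=
  inferInstanceAs (TopologicalSpace (Quotient (balancedSetoid φ X)))

namespace Balanced

variable {G G' H X : Type*} [Group G] [Group G'] [Group H] [MulAction H X]

/-- The class `[g, x]`. -/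
def mk (φ : H →* G) (g : G) (x : X) : Balanced φ X := Quotient.mk (balancedSetoid φ X) (g, x)

/-- The projection `G ×_H X → G / N`, `[g, x] ↦ g N`, for a subgroup `N` containing `φ(H)`. -/
def proj (φ : H →* G) (N : Subgroup G) (hN : φ.range ≤ N) : Balanced φ X → G ⧸ N :=
  Quotient.lift (fun a : G × X => (a.1 : G ⧸ N)) (by
    rintro a b ⟨h, h1, -⟩
    exact (QuotientGroup.eq.2 (by simpa [h1] using hN ⟨h, rfl⟩)).symm)

/-- The map `G ×_H X → G' ×_H X`, `[g, x] ↦ [ψ(g), x]`. -/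
def map (φ : H →* G) (ψ : G →* G') : Balanced φ X → Balanced (ψ.comp φ) X :=
  Quotient.map' (s₁ := balancedSetoid φ X) (s₂ := balancedSetoid (ψ.comp φ) X)
    (fun a : G × X => (ψ a.1, a.2)) (by
      rintro a b ⟨h, h1, h2⟩
      exact ⟨h, by simp [h1], h2⟩)

end Balanced

/-- `SO(n) ×_{SO(n-1)} K_{n,1}`, for `n = m + 1`. -/
abbrev SmallTotal (m : ℕ) : Type := Balanced (stab m) (LongKnot (m + 1))

/-- `SO(n+1) ×_{SO(n-1)} K_{n,1}`, for `n = m + 1`. -/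
abbrev BigTotal (m : ℕ) : Type := Balanced ((stab (m + 1)).comp (stab m)) (LongKnot (m + 1))

/-- The projection `SO(n) ×_{SO(n-1)} K_{n,1} → SO(n)/SO(n-1)`, for `n = m + 1`. -/
def smallProj (m : ℕ) : SmallTotal m → SO (m + 1) ⧸ (stab m).range :=
  Balanced.proj (stab m) _ le_rfl

/-- The projection `SO(n+1) ×_{SO(n-1)} K_{n,1} → SO(n+1)/SO(n)`, for `n = m + 1`. -/
def bigProj (m : ℕ) : BigTotal m → SO (m + 2) ⧸ (stab (m + 1)).range :=
  Balanced.proj ((stab (m + 1)).comp (stab m)) _ (by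
    rintro _ ⟨A, rfl⟩
    exact ⟨stab m A, rfl⟩)

/-- The projection `SO(n+1) ×_{SO(n-1)} K_{n,1} → SO(n+1)/SO(n-1)`, for `n = m + 1`. -/
def finerProj (m : ℕ) : BigTotal m → SO (m + 2) ⧸ ((stab (m + 1)).comp (stab m)).range :=
  Balanced.proj ((stab (m + 1)).comp (stab m)) _ le_rfl

/-- The map `SO(n) ×_{SO(n-1)} K_{n,1} → SO(n+1) ×_{SO(n-1)} K_{n,1}` induced by
`SO(n) ⊂ SO(n+1)`, for `n = m + 1`. -/
def smallToBig (m : ℕ) : SmallTotal m → BigTotal m := Balanced.map (stab m) (stab (m + 1))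

/-! ### Fibre bundles and homotopy equivalences -/

/-- `F --i--> T --p--> B` is a (locally trivial) fibre bundle with fibre `F`, where `i` is a
homeomorphism onto the fibre over `b₀`. -/
structure IsFibreBundle {F T B : Type*} [TopologicalSpace F] [TopologicalSpace T]
    [TopologicalSpace B] (i : F → T) (p : T → B) (b₀ : B) : Prop where
  locally_trivial : ∀ b : B, ∃ e : Bundle.Trivialization F p, b ∈ e.baseSet
  isEmbedding : Topology.IsEmbedding i
  range_eq : Set.range i = p ⁻¹' {b₀}

/-- A continuous map is a homotopy equivalence. -/
def IsHomotopyEquiv {X Y : Type*} [TopologicalSpace X] [TopologicalSpace Y] (f : C(X, Y)) : Prop :=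
  ∃ e : ContinuousMap.HomotopyEquiv X Y, e.toFun = f

/-- A map `f : X → Y` of spaces `p : X → B`, `q : Y → B` over `B` is a fibre homotopy equivalence:
it has a homotopy inverse over `B`, with homotopies over `B`. -/
def IsFibreHomotopyEquiv {X Y B : Type*} [TopologicalSpace X] [TopologicalSpace Y]
    (p : X → B) (q : Y → B) (f : C(X, Y)) : Prop :=
  (∀ x, q (f x) = p x) ∧ ∃ g : C(Y, X), (∀ y, p (g y) = q y) ∧
    (∃ h : ContinuousMap.Homotopy (g.comp f) (ContinuousMap.id X), ∀ t x, p (h (t, x)) = p x) ∧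
    (∃ h : ContinuousMap.Homotopy (f.comp g) (ContinuousMap.id Y), ∀ t y, q (h (t, y)) = q y)

/-! ### Two copies of `D² × K_{3,1}` glued along their boundary -/

/-- The closed unit disc in `ℂ`. -/
abbrev Disc : Type := Metric.closedBall (0 : ℂ) 1

/-- A point of the boundary circle as a point of the disc. -/
def bdry (z : Circle) : Disc := ⟨z, by rw [mem_closedBall_zero_iff, Circle.norm_coe]⟩

/-- The gluing `(z, f) ↦ (z, z² • f)` of the boundaries `S¹ × K_{3,1}` of two copies of
`D² × K_{3,1}`. -/
inductive GlueRel : (Disc × LongKnot 3) ⊕ (Disc × LongKnot 3) →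
    (Disc × LongKnot 3) ⊕ (Disc × LongKnot 3) → Prop
  | glue (z : Circle) (f : LongKnot 3) :
      GlueRel (Sum.inl (bdry z, f)) (Sum.inr (bdry z, circleRot (z ^ 2) • f))

/-- The union of two copies of `D² × K_{3,1}` along their boundary. -/
abbrev TwoDiscs : Type := Quot GlueRel

end KnotSpaces

end

/-!
Everything reduces to one `SO(n-1)`-equivariant statement: adding the point at infinity is an
equivariant homotopy equivalence `κ` from the long knots to the pointed knots that leave the base
point in the direction of the long axis (`isHomotopyEquiv_closureMap`).

*The core.* Stereographic projection turns a pointed knot with the right direction into a curve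
`x ↦ μ x e + u(x)` in `ℝⁿ`, where `e` is the long axis, `μ` the inverse of the speed at the base point
and `u` is, in terms of the angle on the circle, a smooth periodic function: the pole of the
stereographic coordinate is subtracted off, and Hadamard's lemma shows that the rest is smooth at
the base point (`smoothFamOn_pert`, `isModel_pert`). Such a curve is deformed to a long knot in two
stages. First it is shrunk by a homothety of `ℝⁿ` and reparametrised; after this `u` is small, and
varies slowly outside of `|x| ≤ 1 / 4`. Then `u` is cut off between `|x| = 1 / 2` and `|x| = 1`; the curve
stays an embedding, as it is unchanged where `|x| ≤ 1 / 2`, and elsewhere a graph over the axis up to a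
contraction (`IsModel.damped_one`). The scaling factor depends continuously on the knot through
a `C¹` norm of `u`, which is invariant under rotations about the axis, so the whole deformation is
continuous and equivariant, and it preserves the long knots (`deform`, `continuous_deform`,
`deform_smul`, `IsLong.deform`).

*Continuity.* A map to a space of curves with the `C^∞` topology is continuous exactly if all
derivatives of the curves are jointly continuous in the parameter and the time
(`continuous_smoothTopology_iff`). The families with this property, `SmoothFamOn`, are closed under all
the constructions that are used.

*Bundles.* The sphere is a homogeneous space of the rotation group with explicit local sections
`rotTo`. An equivariant map to a homogeneous space with local sections is a fibre bundle
(`isFibreBundle_of_equivariant`), which gives all bundles of the theorem. For the same reason the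
pointed knots with fixed direction are a slice for the rotation group both in the pointed knots and
in all knots, so that `κ` induces the (fibre) homotopy equivalences `G ×_H X → G ×_H Y = T`
(`isFibreHomotopyEquiv_of_equivariant`).

*Dimension three.* Left multiplication by unit quaternions is a global section of `SO(4) → S³`, which
splits the evaluation map (`splitEv`). The bundle `SO(3) → S²` has sections over the two closed
hemispheres which differ on the equator by `z ↦ z²` (`upper_bdry`), so the balanced product over `S²` is
two copies of `D² × K_{3,1}` glued by this clutching function (`discsHomeomorph`).
-/

noncomputable section
namespace KnotSpaces
open Set Filter

/-! ### Families of curves depending continuously on a parameter -/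

section Families

variable {Y Y' : Type*} [TopologicalSpace Y] [TopologicalSpace Y']
  {V W : Type} [NormedAddCommGroup V] [NormedSpace ℝ V] [NormedAddCommGroup W] [NormedSpace ℝ W]

/-- A family `g : Y → ℝ → V` of curves is `C^k` along the curves on `U ⊆ Y × ℝ`: its derivatives in
the real variable up to order `k` exist and are jointly continuous on `U`. -/
def IsFamOn : ℕ → (Y → ℝ → V) → Set (Y × ℝ) → Prop
  | 0, g, U => ContinuousOn (fun p : Y × ℝ => g p.1 p.2) U
  | k + 1, g, U => ContinuousOn (fun p : Y × ℝ => g p.1 p.2) U ∧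
      (∀ p ∈ U, DifferentiableAt ℝ (g p.1) p.2) ∧ IsFamOn k (fun y => deriv (g y)) U

/-- A family of curves all of whose derivatives along the curves are jointly continuous on `U`. -/
def SmoothFamOn (g : Y → ℝ → V) (U : Set (Y × ℝ)) : Prop := ∀ k, IsFamOn k g U

variable {g g' : Y → ℝ → V} {U U' : Set (Y × ℝ)} {k : ℕ}

theorem IsFamOn.continuousOn (h : IsFamOn k g U) : ContinuousOn (fun p : Y × ℝ => g p.1 p.2) U := by
  cases k with
  | zero => exact h
  | succ k => exact h.1

theorem IsFamOn.mono (h : IsFamOn k g U) (hU : U' ⊆ U) : IsFamOn k g U' := by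
  induction k generalizing g with
  | zero => exact ContinuousOn.mono h hU
  | succ k ih => exact ⟨h.1.mono hU, fun p hp => h.2.1 p (hU hp), ih h.2.2⟩

theorem IsFamOn.of_succ (h : IsFamOn (k + 1) g U) : IsFamOn k g U := by
  induction k generalizing g with
  | zero => exact h.1
  | succ k ih => exact ⟨h.1, h.2.1, ih h.2.2⟩

theorem eventually_slice (hU : IsOpen U) {p : Y × ℝ} (hp : p ∈ U) : ∀ᶠ t in 𝓝 p.2, (p.1, t) ∈ U :=
  (Continuous.prodMk_right p.1).continuousAt.eventually (hU.mem_nhds hp)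

theorem IsFamOn.congr (hU : IsOpen U) (h : IsFamOn k g U) (he : ∀ p ∈ U, g' p.1 p.2 = g p.1 p.2) :
    IsFamOn k g' U := by
  induction k generalizing g g' with
  | zero => exact ContinuousOn.congr h he
  | succ k ih =>
    have key : ∀ p ∈ U, g' p.1 =ᶠ[𝓝 p.2] g p.1 := fun p hp =>
      (eventually_slice hU hp).mono fun t ht => he _ ht
    exact ⟨h.1.congr he, fun p hp => (h.2.1 p hp).congr_of_eventuallyEq (key p hp),
      ih h.2.2 fun p hp => (key p hp).deriv_eq⟩

theorem IsFamOn.of_local (h : ∀ p ∈ U, ∃ U', IsOpen U' ∧ p ∈ U' ∧ IsFamOn k g U') :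
    IsFamOn k g U := by
  induction k generalizing g with
  | zero =>
    intro p hp
    obtain ⟨U', h1, h2, h3⟩ := h p hp
    exact (ContinuousOn.continuousAt h3 (h1.mem_nhds h2)).continuousWithinAt
  | succ k ih =>
    refine ⟨fun p hp => ?_, fun p hp => ?_, ih fun p hp => ?_⟩
    · obtain ⟨U', h1, h2, h3⟩ := h p hp
      exact (ContinuousOn.continuousAt h3.1 (h1.mem_nhds h2)).continuousWithinAt
    · obtain ⟨U', h1, h2, h3⟩ := h p hp
      exact h3.2.1 p h2
    · obtain ⟨U', h1, h2, h3⟩ := h p hp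
      exact ⟨U', h1, h2, h3.2.2⟩

theorem IsFamOn.succ_of_hasDerivAt (hU : IsOpen U)
    (hc : ContinuousOn (fun p : Y × ℝ => g p.1 p.2) U)
    (hd : ∀ p ∈ U, HasDerivAt (g p.1) (g' p.1 p.2) p.2) (h : IsFamOn k g' U) :
    IsFamOn (k + 1) g U :=
  ⟨hc, fun p hp => (hd p hp).differentiableAt, h.congr hU fun p hp => (hd p hp).deriv⟩

theorem IsFamOn.const (hU : IsOpen U) {c : Y → V} (hc : ContinuousOn (fun p : Y × ℝ => c p.1) U) :
    IsFamOn k (fun y _ => c y) U := by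
  induction k generalizing c with
  | zero => exact hc
  | succ k ih =>
    exact .succ_of_hasDerivAt hU hc (fun p _ => hasDerivAt_const _ _)
      (ih (c := fun _ => 0) continuousOn_const)

theorem IsFamOn.id (hU : IsOpen U) : IsFamOn k (fun (_ : Y) (t : ℝ) => t) U := by
  cases k with
  | zero => exact continuous_snd.continuousOn
  | succ k =>
    exact .succ_of_hasDerivAt hU continuous_snd.continuousOn (fun p _ => hasDerivAt_id _)
      (.const hU (c := fun _ => (1 : ℝ)) continuousOn_const)

theorem IsFamOn.prodMk (hU : IsOpen U) {h : Y → ℝ → W} (hg : IsFamOn k g U) (hh : IsFamOn k h U) :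
    IsFamOn k (fun y t => (g y t, h y t)) U := by
  induction k generalizing g h with
  | zero => exact ContinuousOn.prodMk hg hh
  | succ k ih =>
    exact .succ_of_hasDerivAt hU (hg.1.prodMk hh.1)
      (fun p hp => (hg.2.1 p hp).hasDerivAt.prodMk (hh.2.1 p hp).hasDerivAt) (ih hg.2.2 hh.2.2)

theorem IsFamOn.comp {V W : Type} [NormedAddCommGroup V] [NormedSpace ℝ V]
    [NormedAddCommGroup W] [NormedSpace ℝ W] {g : Y → ℝ → V} (hU : IsOpen U)
    (hg : IsFamOn k g U) {Φ : V → W} (hΦ : ∀ p ∈ U, ContDiffAt ℝ ∞ Φ (g p.1 p.2)) :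
    IsFamOn k (fun y t => Φ (g y t)) U := by
  induction k generalizing V W with
  | zero =>
    exact fun p hp => (hΦ p hp).continuousAt.comp_continuousWithinAt
      (f := fun p : Y × ℝ => g p.1 p.2) (hg p hp)
  | succ k ih =>
    refine .succ_of_hasDerivAt hU
      (fun p hp => (hΦ p hp).continuousAt.comp_continuousWithinAt
        (f := fun p : Y × ℝ => g p.1 p.2) (hg.1 p hp))
      (g' := fun y t => fderiv ℝ Φ (g y t) (deriv (g y) t)) (fun p hp => ?_) ?_
    · exact ((hΦ p hp).differentiableAt (by simp)).hasFDerivAt.comp_hasDerivAt _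
        (hg.2.1 p hp).hasDerivAt
    · exact ih (g := fun y t => (fderiv ℝ Φ (g y t), deriv (g y) t))
        (Φ := fun q : (V →L[ℝ] W) × V => q.1 q.2)
        (.prodMk hU (ih hg.of_succ fun p hp => (hΦ p hp).fderiv_right (by simp)) hg.2.2)
        fun p hp => isBoundedBilinearMap_apply.contDiff.contDiffAt

theorem IsFamOn.reparam {g : Y' → ℝ → V} {U' : Set (Y' × ℝ)} (hU : IsOpen U)
    (hg : IsFamOn k g U') {c : Y → Y'} {θ : Y → ℝ → ℝ}
    (hc : ContinuousOn (fun p : Y × ℝ => c p.1) U) (hθ : IsFamOn k θ U)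
    (hm : ∀ p ∈ U, (c p.1, θ p.1 p.2) ∈ U') :
    IsFamOn k (fun y t => g (c y) (θ y t)) U := by
  induction k generalizing g with
  | zero => exact ContinuousOn.comp hg (ContinuousOn.prodMk hc hθ) hm
  | succ k ih =>
    refine .succ_of_hasDerivAt hU (ContinuousOn.comp hg.1 (hc.prodMk hθ.1) hm)
      (g' := fun y t => deriv (θ y) t • deriv (g (c y)) (θ y t)) (fun p hp => ?_) ?_
    · exact (hg.2.1 (c p.1, θ p.1 p.2) (hm p hp)).hasDerivAt.scomp (h := θ p.1) p.2
        (hθ.2.1 p hp).hasDerivAt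
    · exact (IsFamOn.prodMk hU hθ.2.2 (ih hg.2.2 hθ.of_succ)).comp hU
        (Φ := fun q : ℝ × V => q.1 • q.2) fun p hp => contDiff_smul.contDiffAt

theorem SmoothFamOn.continuousOn (h : SmoothFamOn g U) :
    ContinuousOn (fun p : Y × ℝ => g p.1 p.2) U := (h 0).continuousOn

theorem SmoothFamOn.continuous (h : SmoothFamOn g univ) :
    Continuous (fun p : Y × ℝ => g p.1 p.2) := continuousOn_univ.1 h.continuousOn

theorem SmoothFamOn.mono (h : SmoothFamOn g U) (hU : U' ⊆ U) : SmoothFamOn g U' :=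
  fun k => (h k).mono hU

theorem SmoothFamOn.congr (hU : IsOpen U) (h : SmoothFamOn g U)
    (he : ∀ p ∈ U, g' p.1 p.2 = g p.1 p.2) : SmoothFamOn g' U := fun k => (h k).congr hU he

theorem SmoothFamOn.of_local (h : ∀ p ∈ U, ∃ U', IsOpen U' ∧ p ∈ U' ∧ SmoothFamOn g U') :
    SmoothFamOn g U := fun k => .of_local fun p hp => by
  obtain ⟨U', h1, h2, h3⟩ := h p hp
  exact ⟨U', h1, h2, h3 k⟩

theorem SmoothFamOn.deriv (h : SmoothFamOn g U) : SmoothFamOn (fun y => deriv (g y)) U :=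
  fun k => (h (k + 1)).2.2

theorem SmoothFamOn.differentiableAt (h : SmoothFamOn g U) {p : Y × ℝ} (hp : p ∈ U) :
    DifferentiableAt ℝ (g p.1) p.2 := (h 1).2.1 p hp

theorem SmoothFamOn.differentiable (h : SmoothFamOn g univ) (y : Y) : Differentiable ℝ (g y) :=
  fun t => h.differentiableAt (p := (y, t)) trivial

theorem SmoothFamOn.const (hU : IsOpen U) {c : Y → V} (hc : Continuous c) :
    SmoothFamOn (fun y _ => c y) U := fun _ => .const hU (hc.comp continuous_fst).continuousOn

theorem SmoothFamOn.id (hU : IsOpen U) : SmoothFamOn (fun (_ : Y) (t : ℝ) => t) U :=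
  fun _ => .id hU

theorem SmoothFamOn.prodMk (hU : IsOpen U) {h : Y → ℝ → W} (hg : SmoothFamOn g U)
    (hh : SmoothFamOn h U) : SmoothFamOn (fun y t => (g y t, h y t)) U :=
  fun k => (hg k).prodMk hU (hh k)

theorem SmoothFamOn.comp (hU : IsOpen U) (hg : SmoothFamOn g U) {Φ : V → W}
    (hΦ : ∀ p ∈ U, ContDiffAt ℝ ∞ Φ (g p.1 p.2)) : SmoothFamOn (fun y t => Φ (g y t)) U :=
  fun k => (hg k).comp hU hΦ

theorem SmoothFamOn.comp' (hU : IsOpen U) (hg : SmoothFamOn g U) {Φ : V → W}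
    (hΦ : ContDiff ℝ ∞ Φ) : SmoothFamOn (fun y t => Φ (g y t)) U :=
  hg.comp hU fun _ _ => hΦ.contDiffAt

theorem SmoothFamOn.reparam {g : Y' → ℝ → V} {U' : Set (Y' × ℝ)} (hU : IsOpen U)
    (hg : SmoothFamOn g U') {c : Y → Y'} {θ : Y → ℝ → ℝ} (hc : Continuous c)
    (hθ : SmoothFamOn θ U) (hm : ∀ p ∈ U, (c p.1, θ p.1 p.2) ∈ U') :
    SmoothFamOn (fun y t => g (c y) (θ y t)) U :=
  fun k => (hg k).reparam hU (hc.comp continuous_fst).continuousOn (hθ k) hm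

theorem SmoothFamOn.of_contDiff (hU : IsOpen U) {h : ℝ → V} (hh : ContDiff ℝ ∞ h) :
    SmoothFamOn (fun (_ : Y) t => h t) U := (SmoothFamOn.id hU).comp' hU hh

theorem SmoothFamOn.add (hU : IsOpen U) (hg : SmoothFamOn g U) (hg' : SmoothFamOn g' U) :
    SmoothFamOn (fun y t => g y t + g' y t) U :=
  (hg.prodMk hU hg').comp' hU (Φ := fun q : V × V => q.1 + q.2) contDiff_add

theorem SmoothFamOn.sub (hU : IsOpen U) (hg : SmoothFamOn g U) (hg' : SmoothFamOn g' U) :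
    SmoothFamOn (fun y t => g y t - g' y t) U :=
  (hg.prodMk hU hg').comp' hU (Φ := fun q : V × V => q.1 - q.2) (contDiff_fst.sub contDiff_snd)

theorem SmoothFamOn.smul (hU : IsOpen U) {a : Y → ℝ → ℝ} (ha : SmoothFamOn a U)
    (hg : SmoothFamOn g U) : SmoothFamOn (fun y t => a y t • g y t) U :=
  (ha.prodMk hU hg).comp' hU (Φ := fun q : ℝ × V => q.1 • q.2) contDiff_smul

theorem SmoothFamOn.mul (hU : IsOpen U) {a b : Y → ℝ → ℝ} (ha : SmoothFamOn a U)
    (hb : SmoothFamOn b U) : SmoothFamOn (fun y t => a y t * b y t) U := ha.smul hU hb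

theorem SmoothFamOn.inv (hU : IsOpen U) {a : Y → ℝ → ℝ} (ha : SmoothFamOn a U)
    (h0 : ∀ p ∈ U, a p.1 p.2 ≠ 0) : SmoothFamOn (fun y t => (a y t)⁻¹) U :=
  ha.comp hU fun p hp => contDiffAt_inv ℝ (h0 p hp)

theorem SmoothFamOn.div (hU : IsOpen U) {a b : Y → ℝ → ℝ} (ha : SmoothFamOn a U)
    (hb : SmoothFamOn b U) (h0 : ∀ p ∈ U, b p.1 p.2 ≠ 0) :
    SmoothFamOn (fun y t => a y t / b y t) U := by
  simpa only [div_eq_mul_inv] using ha.mul hU (hb.inv hU h0)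

theorem SmoothFamOn.contDiff (h : SmoothFamOn g univ) (y : Y) : ContDiff ℝ ∞ (g y) := by
  refine contDiff_infty.2 fun k => ?_
  have : IsFamOn k g univ := h k
  clear h
  induction k generalizing g with
  | zero =>
    exact contDiff_zero.2 ((continuousOn_univ.1 this).comp (Continuous.prodMk_right y))
  | succ k ih =>
    refine contDiff_succ_iff_deriv.2 ⟨fun t => this.2.1 (y, t) trivial, by simp, ih this.2.2⟩

theorem smoothFamOn_univ_iff : SmoothFamOn g univ ↔ (∀ y, ContDiff ℝ ∞ (g y)) ∧
    ∀ k, Continuous fun p : Y × ℝ => iteratedDeriv k (g p.1) p.2 := by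
  constructor
  · refine fun h => ⟨h.contDiff, fun k => ?_⟩
    induction k generalizing g with
    | zero => simpa using h.continuous
    | succ k ih => simpa only [iteratedDeriv_succ'] using ih h.deriv
  · rintro ⟨h1, h2⟩ k
    induction k generalizing g with
    | zero => exact (by simpa using h2 0 : Continuous _).continuousOn
    | succ k ih =>
      refine ⟨(by simpa using h2 0 : Continuous _).continuousOn,
        fun p _ => (h1 p.1).differentiable (by simp) p.2,
        ih (fun y => (contDiff_infty_iff_deriv.1 (h1 y)).2) fun j => ?_⟩
      simpa only [iteratedDeriv_succ'] using h2 (j + 1)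

/-- A map into a space of curves with the `C^∞` topology is continuous exactly when the family of
curves it describes is jointly smooth along the curves. -/
theorem continuous_smoothTopology_iff {X : Type*} {c : X → ℝ → V} (hc : ∀ x, ContDiff ℝ ∞ (c x))
    {F : Y → X} : @Continuous Y X _ (smoothTopology c) F ↔ SmoothFamOn (fun y => c (F y)) univ := by
  rw [smoothFamOn_univ_iff, continuous_iInf_rng]
  simp only [hc, implies_true, true_and]
  refine forall_congr' fun k => ?_
  rw [continuous_induced_rng]
  let G : Y → C(ℝ, V) := fun y =>
    ⟨iteratedDeriv k (c (F y)), (hc (F y)).continuous_iteratedDeriv k (by exact_mod_cast le_top)⟩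
  have h : Continuous G ↔ Continuous fun p : Y × ℝ => iteratedDeriv k (c (F p.1)) p.2 :=
    ⟨fun h => ContinuousMap.continuous_uncurry_of_continuous ⟨G, h⟩,
      fun h => ContinuousMap.continuous_of_continuous_uncurry G h⟩
  rw [← h, ContinuousMap.isUniformEmbedding_toUniformOnFunIsCompact.isInducing.continuous_iff]
  rfl

/-! ### Hadamard's lemma for families -/

open MeasureTheory in
theorem hasDerivAt_integral_smul_comp_mul [CompleteSpace V] {w : ℝ → ℝ} (hw : Continuous w)
    {f : ℝ → V} (hf : Differentiable ℝ f) (hf' : Continuous (deriv f)) (t : ℝ) :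
    HasDerivAt (fun t => ∫ τ in (0 : ℝ)..1, w τ • f (τ * t))
      (∫ τ in (0 : ℝ)..1, (w τ * τ) • deriv f (τ * t)) t := by
  obtain ⟨M, hM⟩ := (isCompact_closedBall (0 : ℝ) (|t| + 1)).exists_bound_of_continuousOn
    hf'.continuousOn
  obtain ⟨N, hN⟩ := (isCompact_Icc (a := (0 : ℝ)) (b := 1)).exists_bound_of_continuousOn
    hw.continuousOn
  refine (intervalIntegral.hasDerivAt_integral_of_dominated_loc_of_deriv_le
    (F := fun t τ => w τ • f (τ * t)) (F' := fun t τ => (w τ * τ) • deriv f (τ * t))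
    (bound := fun _ => N * M) (s := Metric.ball t 1) (Metric.ball_mem_nhds t one_pos)
    (.of_forall fun s => ?_) ?_ ?_ ?_ ?_ ?_).2
  · exact (hw.smul (hf.continuous.comp (by fun_prop))).aestronglyMeasurable
  · exact (hw.smul (hf.continuous.comp (by fun_prop))).intervalIntegrable _ _
  · exact ((hw.mul continuous_id).smul (hf'.comp (by fun_prop))).aestronglyMeasurable
  · refine .of_forall fun τ hτ s hs => ?_
    rw [uIoc_of_le zero_le_one] at hτ
    have h1 := hN τ ⟨hτ.1.le, hτ.2⟩
    have h3 : |s| ≤ |t| + 1 := by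
      have h4 : |s - t| < 1 := hs
      have h5 := abs_add_le (s - t) t
      rw [sub_add_cancel] at h5
      linarith
    have h2 := hM (τ * s) (by
      rw [mem_closedBall_zero_iff, Real.norm_eq_abs, abs_mul, abs_of_pos hτ.1]
      nlinarith [abs_nonneg s, hτ.1, hτ.2])
    have h6 : ‖w τ * τ‖ ≤ N := by
      rw [norm_mul, Real.norm_eq_abs τ, abs_of_pos hτ.1]
      nlinarith [norm_nonneg (w τ), hτ.1, hτ.2]
    rw [norm_smul]
    exact mul_le_mul h6 h2 (norm_nonneg _) ((norm_nonneg _).trans h6)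
  · exact intervalIntegrable_const
  · refine .of_forall fun τ _ s _ => ?_
    have h1 : HasDerivAt (fun s : ℝ => f (τ * s)) (τ • deriv f (τ * s)) s := by
      have := (hf (τ * s)).hasDerivAt.scomp s ((hasDerivAt_id s).const_mul τ)
      simpa [Function.comp_def] using this
    have h2 := h1.const_smul (w τ)
    rw [smul_smul] at h2
    exact h2

/-- The weight `w` makes the class of these integrals closed under differentiation. -/
theorem SmoothFamOn.integral_smul_comp_mul [CompleteSpace V] (hg : SmoothFamOn g univ) {w : ℝ → ℝ}
    (hw : Continuous w) :
    SmoothFamOn (fun y t => ∫ τ in (0 : ℝ)..1, w τ • g y (τ * t)) univ := by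
  intro k
  have hc : ∀ {g : Y → ℝ → V} {w : ℝ → ℝ}, SmoothFamOn g univ → Continuous w →
      Continuous fun p : Y × ℝ => ∫ τ in (0 : ℝ)..1, w τ • g p.1 (τ * p.2) := fun {g w} hg hw =>
    intervalIntegral.continuous_parametric_intervalIntegral_of_continuous'
      (f := fun (p : Y × ℝ) τ => w τ • g p.1 (τ * p.2))
      ((hw.comp continuous_snd).smul (hg.continuous.comp (g := fun p : Y × ℝ => g p.1 p.2)
        ((continuous_fst.comp continuous_fst).prodMk
          (continuous_snd.mul (continuous_snd.comp continuous_fst))))) _ _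
  induction k generalizing g w with
  | zero => exact (hc hg hw).continuousOn
  | succ k ih =>
    exact .succ_of_hasDerivAt isOpen_univ (hc hg hw).continuousOn
      (fun p _ => hasDerivAt_integral_smul_comp_mul hw (hg.differentiable p.1)
        (hg.deriv.continuous.comp (Continuous.prodMk_right p.1)) p.2)
      (ih hg.deriv (hw.mul continuous_id))

/-- The quotient `(g(t) - g(0)) / t`, extended over `t = 0` by Hadamard's formula. -/
def quot (g : Y → ℝ → V) (y : Y) (t : ℝ) : V := ∫ τ in (0 : ℝ)..1, deriv (g y) (τ * t)

theorem SmoothFamOn.quot [CompleteSpace V] (hg : SmoothFamOn g univ) :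
    SmoothFamOn (quot g) univ := by
  have h := hg.deriv.integral_smul_comp_mul (w := fun _ => 1) continuous_const
  simp only [one_smul] at h
  exact h

theorem quot_zero {Z : Type*} [CompleteSpace V] (g : Z → ℝ → V) (z : Z) :
    quot g z 0 = deriv (g z) 0 := by
  simp [quot]

theorem SmoothFamOn.smul_quot [CompleteSpace V] (hg : SmoothFamOn g univ) (y : Y) (t : ℝ) :
    t • KnotSpaces.quot g y t = g y t - g y 0 := by
  have h : ∫ s in (0 : ℝ)..t, _root_.deriv (g y) s = g y t - g y 0 :=
    intervalIntegral.integral_deriv_eq_sub (fun s _ => hg.differentiable y s)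
      ((hg.deriv.continuous.comp (Continuous.prodMk_right y)).intervalIntegrable _ _)
  rw [KnotSpaces.quot, intervalIntegral.smul_integral_comp_mul_right]
  simpa using h

end Families

/-! ### Embeddings of the circle and of the line as curves -/

/-- A closed curve in the sphere in its angular parametrisation. -/
def angular {n : ℕ} (f : Circle → Sph n) (t : ℝ) : E (n + 1) := f (Circle.exp t)

theorem contMDiff_of_angular {n : ℕ} {f : Circle → Sph n} (h : ContDiff ℝ ∞ (angular f)) :
    ContMDiff (𝓡 1) (𝓡 n) ∞ f := by
  have := Fact.mk (@finrank_euclideanSpace_fin ℝ _ (n + 1))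
  have := finrank_real_complex_fact'
  have h1 : ContMDiff (𝓡 1) 𝓘(ℝ, E (n + 1)) ∞ fun z => (f z : E (n + 1)) := by
    intro z₀
    -- Near `z₀` the map is `angular f` composed with a smooth branch of the argument.
    let A : ℂ → E (n + 1) := fun z =>
      angular f (Complex.arg (z₀ : ℂ) + (Complex.log (z * (starRingEnd ℂ) (z₀ : ℂ))).im)
    have hA : ContDiffAt ℝ ∞ A (z₀ : ℂ) := by
      refine h.contDiffAt.comp _ (contDiffAt_const.add ?_)
      refine ContDiffAt.comp (g := Complex.im) _ Complex.imCLM.contDiff.contDiffAt ?_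
      have h2 : ContDiffAt ℝ ∞ Complex.log ((z₀ : ℂ) * (starRingEnd ℂ) (z₀ : ℂ)) := by
        refine (Complex.contDiffAt_log (n := ∞) ?_).restrict_scalars ℝ
        rw [Complex.mul_conj, z₀.normSq_coe]
        simp
      exact h2.comp (z₀ : ℂ) (contDiffAt_id.mul contDiffAt_const)
    have h3 : (fun z : Circle => (f z : E (n + 1))) = A ∘ ((↑) : Circle → ℂ) := by
      funext z
      have h4 : (z : ℂ) * (starRingEnd ℂ) (z₀ : ℂ) = ((z * z₀⁻¹ : Circle) : ℂ) := by
        rw [Circle.coe_mul, Circle.coe_inv_eq_conj]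
      simp only [A, angular, Function.comp, Complex.log_im, Circle.exp_add, h4, Circle.exp_arg,
        mul_comm z₀, inv_mul_cancel_right]
    rw [h3]
    exact hA.contMDiffAt.comp z₀ (contMDiff_coe_sphere z₀)
  exact h1.codRestrict_sphere fun z => (f z).2

theorem contDiff_angular {n : ℕ} {f : Circle → Sph n} (h : ContMDiff (𝓡 1) (𝓡 n) ∞ f) :
    ContDiff ℝ ∞ (angular f) := by
  have := Fact.mk (@finrank_euclideanSpace_fin ℝ _ (n + 1))
  have := finrank_real_complex_fact'
  exact (contMDiff_coe_sphere.comp (h.comp contMDiff_circleExp)).contDiff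

theorem injective_of_apply_ne_zero {V W : Type*} [AddCommGroup V] [Module ℝ V]
    [AddCommGroup W] [Module ℝ W] (hV : Module.finrank ℝ V = 1) (L : V →ₗ[ℝ] W) {v : V}
    (hv : L v ≠ 0) : Function.Injective L := by
  have hv0 : v ≠ 0 := fun h => hv (by rw [h, map_zero])
  refine (injective_iff_map_eq_zero L).2 fun w hw => ?_
  obtain ⟨c, rfl⟩ := (finrank_eq_one_iff_of_nonzero' v hv0).1 hV w
  rw [map_smul, smul_eq_zero] at hw
  rw [hw.resolve_right hv, zero_smul]

theorem deriv_angular_ne_zero_iff {n : ℕ} {f : Circle → Sph n} (h : ContMDiff (𝓡 1) (𝓡 n) ∞ f)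
    (t : ℝ) : deriv (angular f) t ≠ 0 ↔
      Function.Injective (mfderiv (𝓡 1) (𝓡 n) f (Circle.exp t)) := by
  have := Fact.mk (@finrank_euclideanSpace_fin ℝ _ (n + 1))
  have := finrank_real_complex_fact'
  have hf := (h.mdifferentiable (by simp) (Circle.exp t)).hasMFDerivAt
  have he := ((contMDiff_circleExp (m := ∞)).mdifferentiable (by simp) t).hasMFDerivAt
  have hc := ((contMDiff_coe_sphere (E := E (n + 1)) (m := ∞) (n := n)).mdifferentiable (by simp)
    (f (Circle.exp t))).hasMFDerivAt
  have hcoe : ContMDiff (𝓡 1) 𝓘(ℝ, ℂ) ∞ fun z : Circle => (z : ℂ) := contMDiff_coe_sphere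
  have hcirc := (hcoe.mdifferentiable (by simp) (Circle.exp t)).hasMFDerivAt
  let Lc : EuclideanSpace ℝ (Fin n) →L[ℝ] E (n + 1) :=
    mfderiv (𝓡 n) 𝓘(ℝ, E (n + 1)) ((↑) : Sph n → E (n + 1)) (f (Circle.exp t))
  let Lf : EuclideanSpace ℝ (Fin 1) →L[ℝ] EuclideanSpace ℝ (Fin n) :=
    mfderiv (𝓡 1) (𝓡 n) f (Circle.exp t)
  let Le : ℝ →L[ℝ] EuclideanSpace ℝ (Fin 1) := mfderiv 𝓘(ℝ, ℝ) (𝓡 1) Circle.exp t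
  let Li : EuclideanSpace ℝ (Fin 1) →L[ℝ] ℂ :=
    mfderiv (𝓡 1) 𝓘(ℝ, ℂ) (fun z : Circle => (z : ℂ)) (Circle.exp t)
  have h1 : deriv (angular f) t = Lc (Lf (Le 1)) := by
    have h2 : HasFDerivAt (angular f) (Lc ∘L Lf ∘L Le) t :=
      (hc.comp t (hf.comp t he)).hasFDerivAt
    exact h2.hasDerivAt.deriv
  have h2 : Le 1 ≠ 0 := by
    intro h0
    have h3 : HasFDerivAt (fun t : ℝ => (Circle.exp t : ℂ)) (Li ∘L Le) t :=
      (hcirc.comp t he).hasFDerivAt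
    have h4 : HasDerivAt (fun t : ℝ => (Circle.exp t : ℂ))
        (Complex.exp (t * Complex.I) * (1 * Complex.I)) t := by
      simp only [Circle.coe_exp]
      exact ((Complex.ofRealCLM.hasDerivAt (x := t)).mul_const Complex.I).cexp
    have h5 := h4.unique h3.hasDerivAt
    simp [h0] at h5
  have hinj : Function.Injective Lc := injective_mvfderiv_subtypeVal_sphere (f (Circle.exp t))
  rw [h1]
  constructor
  · intro h3
    have h4 : Lf (Le 1) ≠ 0 := fun h4 => h3 (by rw [h4, map_zero])
    exact injective_of_apply_ne_zero (by simp) Lf.toLinearMap h4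
  · intro h3 h4
    have h3' : Function.Injective Lf := h3
    exact h2 (h3' ((hinj (h4.trans (map_zero Lc).symm)).trans (map_zero Lf).symm))

/-- The circle is compact, so an injective immersion is an embedding. -/
theorem isSmoothEmb_circle_iff {n : ℕ} {f : Circle → Sph n} :
    IsSmoothEmb (𝓡 1) (𝓡 n) f ↔
      ContDiff ℝ ∞ (angular f) ∧ (∀ t, deriv (angular f) t ≠ 0) ∧ Function.Injective f := by
  constructor
  · rintro ⟨h1, h2, h3⟩
    exact ⟨contDiff_angular h1, fun t => (deriv_angular_ne_zero_iff h1 t).2 (h2 _), h3.injective⟩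
  · rintro ⟨h1, h2, h3⟩
    have h4 := contMDiff_of_angular h1
    refine ⟨h4, fun z => ?_, (h4.continuous.isClosedEmbedding h3).isEmbedding⟩
    rw [← Circle.exp_arg z]
    exact (deriv_angular_ne_zero_iff h4 _).1 (h2 _)

/-- A curve which is standard outside of a compact set is proper, so an injective immersion is an
embedding. -/
theorem isSmoothEmb_line_iff {n : ℕ} [NeZero n] {f : ℝ → E n}
    (hf : ∀ x : ℝ, 1 ≤ |x| → f x = EuclideanSpace.single 0 x) :
    IsSmoothEmb 𝓘(ℝ, ℝ) 𝓘(ℝ, E n) f ↔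
      ContDiff ℝ ∞ f ∧ (∀ x, deriv f x ≠ 0) ∧ Function.Injective f := by
  have key : ∀ x, Function.Injective (mfderiv 𝓘(ℝ, ℝ) 𝓘(ℝ, E n) f x) ↔ deriv f x ≠ 0 := by
    intro x
    rw [mfderiv_eq_fderiv, ← fderiv_apply_one_eq_deriv]
    constructor
    · intro h h0
      exact one_ne_zero (α := ℝ) (h (h0.trans (map_zero _).symm))
    · exact fun h => injective_of_apply_ne_zero (Module.finrank_self ℝ) (fderiv ℝ f x).toLinearMap h
  constructor
  · rintro ⟨h1, h2, h3⟩
    exact ⟨contMDiff_iff_contDiff.1 h1, fun x => (key x).1 (h2 x), h3.injective⟩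
  · rintro ⟨h1, h2, h3⟩
    refine ⟨contMDiff_iff_contDiff.2 h1, fun x => (key x).2 (h2 x), ?_⟩
    have h4 : Tendsto f (cocompact ℝ) (cocompact (E n)) := by
      refine tendsto_cocompact_of_tendsto_dist_comp_atTop 0 ?_
      have h5 : Tendsto (fun x : ℝ => ‖x‖) (cocompact ℝ) atTop := tendsto_norm_cocompact_atTop
      refine h5.congr' ?_
      filter_upwards [h5.eventually_ge_atTop 1] with x hx
      rw [hf x hx, dist_zero_right, PiLp.norm_single]
    have h5 : IsProperMap f := isProperMap_iff_tendsto_cocompact.2 ⟨h1.continuous, h4⟩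
    exact (Topology.IsClosedEmbedding.of_continuous_injective_isClosedMap h1.continuous h3
      h5.isClosedMap).isEmbedding


/-! ### Actions of the rotation groups -/

section Rotations

variable {n m : ℕ}

instance : IsTopologicalGroup (SO n) where
  continuous_inv := continuous_induced_rng.2 (continuous_subtype_val.matrix_conjTranspose)

theorem continuous_act : Continuous (act : SO n → E n →L[ℝ] E n) :=
  (LinearMap.continuous_of_finiteDimensional
    (Matrix.toEuclideanCLM (𝕜 := ℝ) (n := Fin n)).toAlgEquiv.toLinearMap).comp
    continuous_subtype_val

theorem norm_act (A : SO n) (v : E n) : ‖act A v‖ = ‖v‖ :=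
  ContinuousLinearMap.norm_map_of_mem_unitary
    (Unitary.map_mem (Matrix.toEuclideanCLM (𝕜 := ℝ) (n := Fin n)) A.2.1) v

theorem act_apply (A : SO n) (v : E n) (i : Fin n) : act A v i = ∑ j, A.1 i j * v j := by
  simp [act, Matrix.ofLp_toEuclideanCLM, Matrix.mulVec, dotProduct]

/-- The last `n` coordinates of a point of `ℝⁿ⁺¹`. -/
def tail : E (n + 1) →L[ℝ] E n :=
  LinearMap.toContinuousLinearMap
    { toFun := fun v => WithLp.toLp 2 fun i => v i.succ
      map_add' := fun _ _ => rfl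
      map_smul' := fun _ _ => rfl }

@[simp] theorem tail_apply (v : E (n + 1)) (i : Fin n) : tail v i = v i.succ := rfl

/-- The identification `ℝ × ℝⁿ = ℝⁿ⁺¹`. -/
def consL : ℝ × E n →L[ℝ] E (n + 1) :=
  LinearMap.toContinuousLinearMap
    { toFun := fun p => WithLp.toLp 2 (Fin.cons p.1 p.2)
      map_add' := fun p q => by
        ext i; refine Fin.cases ?_ (fun i => ?_) i <;> simp
      map_smul' := fun c p => by
        ext i; refine Fin.cases ?_ (fun i => ?_) i <;> simp }

@[simp] theorem consL_zero (p : ℝ × E n) : consL p 0 = p.1 := rfl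

@[simp] theorem consL_succ (p : ℝ × E n) (i : Fin n) : consL p i.succ = p.2 i := rfl

@[simp] theorem tail_consL (p : ℝ × E n) : tail (consL p) = p.2 := rfl

@[simp] theorem consL_tail (v : E (n + 1)) : consL (v 0, tail v) = v := by
  ext i; refine Fin.cases ?_ (fun i => ?_) i <;> simp

theorem ext_tail {v w : E (n + 1)} (h0 : v 0 = w 0) (h : tail v = tail w) : v = w := by
  rw [← consL_tail v, ← consL_tail w, h0, h]

theorem norm_sq_eq_tail (v : E (n + 1)) : ‖v‖ ^ 2 = v 0 ^ 2 + ‖tail v‖ ^ 2 := by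
  simp [EuclideanSpace.real_norm_sq_eq, Fin.sum_univ_succ]

theorem act_stab_zero (A : SO n) (v : E (n + 1)) : act (stab n A) v 0 = v 0 := by
  simp [act_apply, stab, Fin.sum_univ_succ]

theorem tail_act_stab (A : SO n) (v : E (n + 1)) : tail (act (stab n A) v) = act A (tail v) := by
  ext i
  simp [act_apply, stab, Fin.sum_univ_succ]

theorem act_stab_pole (A : SO n) : act (stab n A) (pole n) = pole n := act_stab_single A 1

/-- Rotations of the sphere. -/
instance : SMul (SO (n + 1)) (Sph n) where
  smul A v := ⟨act A v, by simp [norm_act]⟩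

instance : MulAction (SO (n + 1)) (Sph n) where
  one_smul _ := Subtype.ext (act_one _)
  mul_smul A B _ := Subtype.ext (act_mul A B _)

@[simp] theorem coe_smul_sph (A : SO (n + 1)) (v : Sph n) : ((A • v : Sph n) : E (n + 1)) = act A v :=
  rfl

instance : ContinuousSMul (SO (n + 1)) (Sph n) :=
  ⟨continuous_induced_rng.2 ((continuous_act.comp continuous_fst).clm_apply
    (continuous_subtype_val.comp continuous_snd))⟩

theorem angular_smul_aux (A : SO (n + 1)) (f : Circle → Sph n) :
    angular (fun z => A • f z) = fun t => act A (angular f t) := rfl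

/-- Rotations of the sphere act on embeddings by composition. -/
instance : SMul (SO (n + 1)) (Emb n) where
  smul A f := ⟨fun z => A • f.1 z, by
    obtain ⟨h1, h2, h3⟩ := isSmoothEmb_circle_iff.1 f.2
    refine isSmoothEmb_circle_iff.2 ⟨(act A).contDiff.comp h1, fun t h0 => h2 t ?_,
      fun z w h => h3 (smul_left_cancel A h)⟩
    rw [angular_smul_aux] at h0
    have h4 := (act A).hasFDerivAt.comp_hasDerivAt t
      (h1.differentiable (by simp) t).hasDerivAt
    exact act_injective A ((h4.deriv.symm.trans h0).trans (map_zero _).symm)⟩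

instance : MulAction (SO (n + 1)) (Emb n) where
  one_smul f := Subtype.ext (funext fun z => one_smul _ (f.1 z))
  mul_smul A B f := Subtype.ext (funext fun z => mul_smul A B (f.1 z))

theorem smul_emb_apply (A : SO (n + 1)) (f : Emb n) (z : Circle) : (A • f).1 z = A • f.1 z := rfl

theorem angular_smul (A : SO (n + 1)) (f : Emb n) (t : ℝ) :
    angular (A • f).1 t = act A (angular f.1 t) := rfl

/-- Rotations about the base point act on pointed embeddings. -/
instance : SMul (SO n) (EmbPt n) where
  smul A f := ⟨stab n A • f.1, Subtype.ext (by
    rw [smul_emb_apply, f.2, coe_smul_sph, act_stab_pole])⟩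

instance : MulAction (SO n) (EmbPt n) where
  one_smul f := Subtype.ext (by
    change stab n 1 • f.1 = f.1
    rw [map_one, one_smul])
  mul_smul A B f := Subtype.ext (by
    change stab n (A * B) • f.1 = stab n A • stab n B • f.1
    rw [map_mul, mul_smul])

theorem coe_smul_embPt (A : SO n) (f : EmbPt n) : (A • f).1 = stab n A • f.1 := rfl

theorem coe_smul_longKnot (A : SO m) (f : LongKnot (m + 1)) (x : ℝ) :
    (A • f).1 x = act (stab m A) (f.1 x) := rfl

theorem continuous_stab : Continuous (stab n) := by
  refine continuous_induced_rng.2 (continuous_matrix fun i j => ?_)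
  have h : ∀ i j, Continuous fun A : SO n => A.1 i j := fun i j =>
    continuous_subtype_val.matrix_elem i j
  refine Fin.cases ?_ (fun i => ?_) i <;> refine Fin.cases ?_ (fun j => ?_) j <;>
    simp only [Function.comp, stab, MonoidHom.coe_mk, OneHom.coe_mk, blockOne_zero_zero,
      blockOne_zero_succ, blockOne_succ_zero, blockOne_succ_succ]
  exacts [continuous_const, continuous_const, continuous_const, h i j]

end Rotations

/-! ### Continuity of the actions and the direction at the base point -/

section Continuity

variable {Y : Type*} [TopologicalSpace Y] {n m : ℕ}

theorem Emb.contDiff (f : Emb n) : ContDiff ℝ ∞ (angular f.1) := (isSmoothEmb_circle_iff.1 f.2).1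

theorem LongKnot.contDiff [NeZero n] (f : LongKnot n) : ContDiff ℝ ∞ f.1 :=
  contMDiff_iff_contDiff.1 f.2.1.1

theorem continuous_emb_iff {F : Y → Emb n} :
    Continuous F ↔ SmoothFamOn (fun y => angular (F y).1) univ :=
  continuous_smoothTopology_iff (c := fun f : Emb n => angular f.1) Emb.contDiff

theorem continuous_longKnot_iff [NeZero n] {F : Y → LongKnot n} :
    Continuous F ↔ SmoothFamOn (fun y => (F y).1) univ :=
  continuous_smoothTopology_iff (c := fun f : LongKnot n => f.1) LongKnot.contDiff

theorem smoothFamOn_angular : SmoothFamOn (fun f : Emb n => angular f.1) univ :=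
  continuous_emb_iff.1 continuous_id

theorem smoothFamOn_longKnot [NeZero n] : SmoothFamOn (fun f : LongKnot n => f.1) univ :=
  continuous_longKnot_iff.1 continuous_id

theorem SmoothFamOn.act {U : Set (Y × ℝ)} (hU : IsOpen U) {g : Y → ℝ → E n}
    (hg : SmoothFamOn g U) {A : Y → SO n} (hA : Continuous A) :
    SmoothFamOn (fun y t => act (A y) (g y t)) U :=
  ((SmoothFamOn.const hU (continuous_act.comp hA)).prodMk hU hg).comp' hU
    (Φ := fun q : (E n →L[ℝ] E n) × E n => q.1 q.2) isBoundedBilinearMap_apply.contDiff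

instance : ContinuousSMul (SO (n + 1)) (Emb n) :=
  ⟨continuous_emb_iff.2 ((continuous_emb_iff.1 continuous_snd).act isOpen_univ continuous_fst)⟩

instance : ContinuousSMul (SO n) (EmbPt n) :=
  ⟨continuous_induced_rng.2 ((continuous_stab.comp continuous_fst).smul
    (continuous_subtype_val.comp continuous_snd))⟩

theorem continuousSMul_longKnot : ContinuousSMul (SO m) (LongKnot (m + 1)) :=
  ⟨continuous_longKnot_iff.2 ((continuous_longKnot_iff.1 continuous_snd).act isOpen_univ
    (continuous_stab.comp continuous_fst))⟩

theorem continuous_ev : Continuous (ev n) := by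
  refine continuous_induced_rng.2 ?_
  have := (smoothFamOn_angular (n := n)).continuous.comp (Continuous.prodMk_left (0 : ℝ))
  simpa [Function.comp_def, ev, angular] using this

theorem ev_smul (A : SO (n + 1)) (f : Emb n) : ev n (A • f) = A • ev n f := rfl

/-- The velocity at the base point of a pointed embedding. -/
def velocity (f : EmbPt n) : E n := tail (deriv (angular f.1.1) 0)

theorem angular_zero (f : EmbPt n) : angular f.1.1 0 = EuclideanSpace.single 0 1 := by
  rw [angular, Circle.exp_zero, f.2]
  rfl

theorem norm_angular (f : Circle → Sph n) (t : ℝ) : ‖angular f t‖ = 1 := by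
  simp [angular]

theorem deriv_angular_zero (f : EmbPt n) : deriv (angular f.1.1) 0 = consL (0, velocity f) := by
  refine ext_tail ?_ rfl
  have h1 := (f.1.contDiff.differentiable (by simp) 0).hasDerivAt.norm_sq
  simp only [norm_angular, one_pow] at h1
  have h2 := h1.unique (hasDerivAt_const _ _)
  rw [angular_zero] at h2
  simpa [EuclideanSpace.inner_single_left] using h2

theorem velocity_ne_zero (f : EmbPt n) : velocity f ≠ 0 := fun h =>
  (isSmoothEmb_circle_iff.1 f.1.2).2.1 0 (by
    rw [deriv_angular_zero, h, Prod.mk_zero_zero, map_zero])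

theorem continuous_velocity : Continuous (velocity : EmbPt n → E n) :=
  tail.continuous.comp (((smoothFamOn_angular (n := n)).deriv.continuous.comp
    (Continuous.prodMk_left (0 : ℝ))).comp continuous_subtype_val)

theorem tangentDir_eq (f : EmbPt n) : tangentDir f = ‖velocity f‖⁻¹ • velocity f := rfl

theorem velocity_smul (A : SO n) (f : EmbPt n) : velocity (A • f) = act A (velocity f) := by
  have h : deriv (angular (A • f).1.1) 0 = act (stab n A) (deriv (angular f.1.1) 0) :=
    ((act (stab n A)).hasFDerivAt.comp_hasDerivAt (0 : ℝ)
      (f.1.contDiff.differentiable (by simp) 0).hasDerivAt).deriv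
  rw [velocity, h, tail_act_stab, velocity]

/-- The tangent direction at the base point as a point of the sphere of directions. -/
def direction (f : EmbPt (m + 1)) : Sph m := ⟨tangentDir f, by
  rw [tangentDir_eq, mem_sphere_zero_iff_norm, norm_smul, norm_inv, norm_norm,
    inv_mul_cancel₀ (norm_ne_zero_iff.2 (velocity_ne_zero f))]⟩

theorem continuous_direction : Continuous (direction : EmbPt (m + 1) → Sph m) :=
  continuous_induced_rng.2 ((continuous_velocity.norm.inv₀ fun f =>
    norm_ne_zero_iff.2 (velocity_ne_zero f)).smul continuous_velocity)

theorem direction_smul (A : SO (m + 1)) (f : EmbPt (m + 1)) :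
    direction (A • f) = A • direction f := by
  refine Subtype.ext ?_
  change tangentDir (A • f) = act A (tangentDir f)
  rw [tangentDir_eq, tangentDir_eq, velocity_smul, norm_act, map_smul]

end Continuity

/-! ### Local sections of `SO(n+1) → Sⁿ` -/

section Sections

variable {n m : ℕ}

theorem norm_sph (v : Sph n) : ‖(v : E (n + 1))‖ = 1 := mem_sphere_zero_iff_norm.1 v.2

/-- The reflection of `ℝⁿ⁺¹` in the hyperplane orthogonal to `e₀ + v`, for a unit vector `v`. -/
def bisect (v : E (n + 1)) : Matrix (Fin (n + 1)) (Fin (n + 1)) ℝ :=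
  1 - (1 + v 0)⁻¹ • Matrix.vecMulVec (fun i => (if i = 0 then 1 else 0) + v i)
    (fun i => (if i = 0 then 1 else 0) + v i)

/-- The reflection `e₀ ↦ -e₀`. -/
def flip (n : ℕ) : Matrix (Fin (n + 1)) (Fin (n + 1)) ℝ :=
  Matrix.diagonal fun i => if i = 0 then -1 else 1

theorem flip_mul_flip : flip n * flip n = 1 := by
  rw [flip, Matrix.diagonal_mul_diagonal, ← Matrix.diagonal_one]
  congr 1; funext i; split <;> simp

theorem star_flip : star (flip n) = flip n := by
  rw [flip, Matrix.star_eq_conjTranspose, Matrix.diagonal_conjTranspose]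
  congr 1

theorem det_flip : (flip n).det = -1 := by
  simp [flip, Matrix.det_diagonal]

theorem bisect_dot {v : E (n + 1)} (hv : ‖v‖ = 1) :
    (fun i => (if i = 0 then 1 else 0) + v i) ⬝ᵥ (fun i => (if i = 0 then 1 else 0) + v i) =
      2 * (1 + v 0) := by
  have h : ∑ i, v i ^ 2 = 1 := by rw [← EuclideanSpace.real_norm_sq_eq, hv, one_pow]
  rw [Fin.sum_univ_succ] at h
  simp only [dotProduct, Fin.sum_univ_succ, if_true, Fin.succ_ne_zero, if_false, zero_add, ← sq]
  linarith

theorem star_bisect (v : E (n + 1)) : star (bisect v) = bisect v := by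
  ext i j
  simp only [bisect, Matrix.star_apply, Matrix.sub_apply, Matrix.smul_apply, Matrix.vecMulVec_apply,
    Matrix.one_apply, star_trivial, eq_comm (a := i) (b := j), mul_comm]

theorem bisect_mul_bisect {v : E (n + 1)} (hv : ‖v‖ = 1) (h0 : v 0 ≠ -1) :
    bisect v * bisect v = 1 := by
  have h1 : 1 + v 0 ≠ 0 := fun h => h0 (by linarith)
  simp only [bisect, sub_mul, mul_sub, one_mul, mul_one, Matrix.smul_mul, Matrix.mul_smul,
    Matrix.vecMulVec_mul_vecMulVec, bisect_dot hv, smul_smul]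
  have h2 : (1 + v 0)⁻¹ * ((1 + v 0)⁻¹ * (2 * (1 + v 0))) = 2 * (1 + v 0)⁻¹ := by
    field_simp
  ext i j
  simp only [Matrix.sub_apply, Matrix.smul_apply, Matrix.vecMulVec_apply, smul_eq_mul,
    Pi.smul_apply]
  field_simp
  ring

theorem det_bisect {v : E (n + 1)} (hv : ‖v‖ = 1) (h0 : v 0 ≠ -1) : (bisect v).det = -1 := by
  have h1 : 1 + v 0 ≠ 0 := fun h => h0 (by linarith)
  have h2 : bisect v = 1 + Matrix.replicateCol Unit
      (-(1 + v 0)⁻¹ • fun i => (if i = 0 then 1 else 0) + v i) *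
      Matrix.replicateRow Unit (fun i => (if i = 0 then 1 else 0) + v i) := by
    ext i j
    simp [bisect, Matrix.mul_apply, Matrix.vecMulVec_apply]
    ring
  rw [h2, Matrix.det_one_add_replicateCol_mul_replicateRow, dotProduct_smul, bisect_dot hv,
    smul_eq_mul]
  field_simp
  norm_num

theorem bisect_mul_flip_mem {v : E (n + 1)} (hv : ‖v‖ = 1) (h0 : v 0 ≠ -1) :
    bisect v * flip n ∈ Matrix.specialOrthogonalGroup (Fin (n + 1)) ℝ := by
  rw [Matrix.mem_specialOrthogonalGroup_iff, Matrix.mem_unitaryGroup_iff, star_mul, star_flip,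
    star_bisect, mul_assoc, ← mul_assoc (flip n), flip_mul_flip, one_mul, bisect_mul_bisect hv h0,
    Matrix.det_mul, det_bisect hv h0, det_flip]
  norm_num

open Classical in
/-- The rotation in the plane of `e₀` and `v` which takes `e₀` to `v`, for `v ≠ -e₀`; it is the
product of two reflections. -/
def rotTo (v : Sph n) : SO (n + 1) :=
  if h : (v : E (n + 1)) 0 ≠ -1 then
    ⟨bisect (v : E (n + 1)) * flip n, bisect_mul_flip_mem (norm_sph v) h⟩
  else 1

theorem coe_rotTo {v : Sph n} (h : (v : E (n + 1)) 0 ≠ -1) : (rotTo v).1 = bisect v * flip n := by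
  rw [rotTo, dif_pos h]

theorem rotTo_zero_zero {v : Sph n} (h : (v : E (n + 1)) 0 ≠ -1) :
    (rotTo v).1 0 0 = (v : E (n + 1)) 0 := by
  have h1 : 1 + (v : E (n + 1)) 0 ≠ 0 := fun h' => h (by linarith)
  rw [coe_rotTo h, flip, Matrix.mul_diagonal]
  simp [bisect, Matrix.vecMulVec_apply]
  field_simp
  ring

theorem rotTo_zero_succ {v : Sph n} (h : (v : E (n + 1)) 0 ≠ -1) (j : Fin n) :
    (rotTo v).1 0 j.succ = -(v : E (n + 1)) j.succ := by
  have h1 : 1 + (v : E (n + 1)) 0 ≠ 0 := fun h' => h (by linarith)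
  rw [coe_rotTo h, flip, Matrix.mul_diagonal]
  simp [bisect, Matrix.vecMulVec_apply, (Fin.succ_ne_zero j).symm]
  field_simp

theorem rotTo_succ_zero {v : Sph n} (h : (v : E (n + 1)) 0 ≠ -1) (i : Fin n) :
    (rotTo v).1 i.succ 0 = (v : E (n + 1)) i.succ := by
  have h1 : 1 + (v : E (n + 1)) 0 ≠ 0 := fun h' => h (by linarith)
  rw [coe_rotTo h, flip, Matrix.mul_diagonal]
  simp [bisect, Matrix.vecMulVec_apply]
  field_simp

theorem rotTo_succ_succ {v : Sph n} (h : (v : E (n + 1)) 0 ≠ -1) (i j : Fin n) :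
    (rotTo v).1 i.succ j.succ = (if i = j then 1 else 0) -
      (v : E (n + 1)) i.succ * (v : E (n + 1)) j.succ / (1 + (v : E (n + 1)) 0) := by
  rw [coe_rotTo h, flip, Matrix.mul_diagonal]
  simp [bisect, Matrix.vecMulVec_apply, Matrix.one_apply]
  ring

theorem rotTo_smul_pole {v : Sph n} (h : (v : E (n + 1)) 0 ≠ -1) : rotTo v • pole n = v := by
  refine Subtype.ext ?_
  ext i
  refine Fin.cases ?_ (fun i => ?_) i <;>
    simp [act_apply, pole, rotTo_zero_zero h, rotTo_succ_zero h]

theorem rotTo_pole : rotTo (pole n) = 1 := by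
  have h : (pole n : E (n + 1)) 0 ≠ -1 := by norm_num [pole]
  refine Subtype.ext (Matrix.ext fun i j => ?_)
  refine Fin.cases ?_ (fun i => ?_) i <;> refine Fin.cases ?_ (fun j => ?_) j
  · rw [rotTo_zero_zero h]; simp [pole]
  · rw [rotTo_zero_succ h]; simp [pole, (Fin.succ_ne_zero j).symm]
  · rw [rotTo_succ_zero h]; simp [pole]
  · rw [rotTo_succ_succ h]; simp [pole, Matrix.one_apply]

theorem isOpen_ne_neg_pole : IsOpen {v : Sph n | (v : E (n + 1)) 0 ≠ -1} :=
  isOpen_ne_fun (by fun_prop) continuous_const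

theorem continuousOn_rotTo :
    ContinuousOn (rotTo : Sph n → SO (n + 1)) {v | (v : E (n + 1)) 0 ≠ -1} := by
  refine (Topology.IsInducing.subtypeVal.continuousOn_iff).2 ?_
  refine continuousOn_pi.2 fun i => continuousOn_pi.2 fun j => ?_
  have hv : ∀ k, Continuous fun v : Sph n => (v : E (n + 1)) k := fun k => by fun_prop
  refine Fin.cases ?_ (fun i => ?_) i <;> refine Fin.cases ?_ (fun j => ?_) j
  · exact (hv 0).continuousOn.congr fun v h => rotTo_zero_zero h
  · exact (hv j.succ).neg.continuousOn.congr fun v h => rotTo_zero_succ h j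
  · exact (hv i.succ).continuousOn.congr fun v h => rotTo_succ_zero h i
  · have h1 : ContinuousOn (fun v : Sph n => (if i = j then (1 : ℝ) else 0) -
        (v : E (n + 1)) i.succ * (v : E (n + 1)) j.succ / (1 + (v : E (n + 1)) 0))
        {v | (v : E (n + 1)) 0 ≠ -1} := by
      refine continuousOn_const.sub (((hv i.succ).mul (hv j.succ)).continuousOn.div
        (continuous_const.add (hv 0)).continuousOn fun v h h' => h ?_)
      have h2 : 1 + (v : E (n + 1)) 0 = 0 := h'
      linarith
    exact h1.congr fun v h => rotTo_succ_succ h i j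

theorem exists_smul_pole (hm : 1 ≤ m) (v : Sph m) : ∃ A : SO (m + 1), A • pole m = v := by
  by_cases h : (v : E (m + 1)) 0 = -1
  swap
  · exact ⟨rotTo v, rotTo_smul_pole h⟩
  obtain ⟨m, rfl⟩ : ∃ k, m = k + 1 := ⟨m - 1, by omega⟩
  let u : Sph (m + 1) := ⟨EuclideanSpace.single 1 1, by simp⟩
  have hu : (u : E (m + 2)) 0 ≠ -1 := by simp [u]
  -- The square of the quarter turn in the plane of the first two axes takes `e₀` to `-e₀`.
  refine ⟨rotTo u * rotTo u, ?_⟩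
  rw [mul_smul, rotTo_smul_pole hu]
  have h1 : ((rotTo u • u : Sph (m + 1)) : E (m + 2)) 0 = -1 := by
    rw [coe_smul_sph, act_apply, Fin.sum_univ_succ, Fin.sum_univ_succ]
    simpa [u, Fin.ext_iff] using rotTo_zero_succ hu 0
  have key : ∀ w : Sph (m + 1), (w : E (m + 2)) 0 = -1 → tail (w : E (m + 2)) = 0 := by
    intro w hw
    have h2 := norm_sq_eq_tail (w : E (m + 2))
    rw [norm_sph w, hw] at h2
    rw [← norm_eq_zero]
    nlinarith [norm_nonneg (tail (w : E (m + 2)))]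
  exact Subtype.ext (ext_tail (h1.trans h.symm) ((key _ h1).trans (key _ h).symm))

theorem blockOne_injective : Function.Injective
    (blockOne : Matrix (Fin n) (Fin n) ℝ → Matrix (Fin (n + 1)) (Fin (n + 1)) ℝ) := fun M N h => by
  ext i j
  simpa using congrFun (congrFun h i.succ) j.succ

theorem isEmbedding_stab : Topology.IsEmbedding (stab n) := by
  refine ⟨Topology.IsInducing.of_comp (g := fun A : SO (n + 1) => A.1.submatrix Fin.succ Fin.succ)
    continuous_stab (continuous_subtype_val.matrix_submatrix _ _) ?_, fun A B h => ?_⟩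
  · exact Topology.IsInducing.subtypeVal
  · exact Subtype.ext (blockOne_injective (congrArg Subtype.val h))

theorem mem_range_stab {A : SO (n + 1)} (h : A • pole n = pole n) : A ∈ (stab n).range := by
  have h1 : ∀ B : SO (n + 1), B • pole n = pole n →
      ∀ i : Fin (n + 1), B.1 i 0 = (pole n : E (n + 1)) i := by
    intro B hB i
    have := congrArg (fun v : Sph n => (v : E (n + 1)) i) hB
    simpa [act_apply, pole] using this
  have h2 : A⁻¹ • pole n = pole n := by rw [inv_smul_eq_iff, h]
  have h3 : ∀ j, A.1 0 j = (pole n : E (n + 1)) j := h1 _ h2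
  have h4 : blockOne (A.1.submatrix Fin.succ Fin.succ) = A.1 := by
    ext i j
    refine Fin.cases ?_ (fun i => ?_) i <;> refine Fin.cases ?_ (fun j => ?_) j
    · simp [h3, pole]
    · simp [h3, pole]
    · simp [h1 A h, pole]
    · simp
  have h5 := Matrix.mem_specialOrthogonalGroup_iff.1 A.2
  refine ⟨⟨A.1.submatrix Fin.succ Fin.succ, ?_⟩, Subtype.ext h4⟩
  rw [Matrix.mem_specialOrthogonalGroup_iff, Matrix.mem_unitaryGroup_iff]
  refine ⟨blockOne_injective ?_, by rw [← blockOne_det, h4, h5.2]⟩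
  rw [blockOne_mul, ← blockOne_star, h4, blockOne_one, Matrix.mem_unitaryGroup_iff.1 h5.1]

end Sections

/-! ### Homogeneous spaces and fibre bundles -/

section Retraction

variable {G G' H X : Type*} [Group G] [Group G'] [Group H]
  [TopologicalSpace G] [TopologicalSpace G'] [TopologicalSpace H]

/-- The principal bundle `G → G / φ(H)` is trivial near the base point: some `H`-equivariant map to
`H` is defined on an invariant neighbourhood of `1 ∈ G`. -/
def HasLocalRetraction (φ : H →* G) : Prop :=
  ∃ (U : Set G) (η : G → H), IsOpen U ∧ 1 ∈ U ∧ ContinuousOn η U ∧ η 1 = 1 ∧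
    ∀ g ∈ U, ∀ h, g * φ h ∈ U ∧ η (g * φ h) = η g * h

theorem HasLocalRetraction.comp {φ : H →* G'} {ψ : G' →* G} (hψ : HasLocalRetraction ψ)
    (hφ : HasLocalRetraction φ) : HasLocalRetraction (ψ.comp φ) := by
  obtain ⟨U, η, h1, h2, h3, h4, h5⟩ := hψ
  obtain ⟨U', η', h1', h2', h3', h4', h5'⟩ := hφ
  refine ⟨U ∩ η ⁻¹' U', η' ∘ η, h3.isOpen_inter_preimage h1 h1', ⟨h2, by simpa [h4] using h2'⟩,
    h3'.comp (h3.mono inter_subset_left) fun g hg => hg.2, by simp [h4, h4'], ?_⟩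
  rintro g ⟨hg, hg'⟩ h
  obtain ⟨h6, h7⟩ := h5 g hg (φ h)
  obtain ⟨h8, h9⟩ := h5' _ hg' h
  exact ⟨⟨h6, by rw [mem_preimage, MonoidHom.comp_apply, h7]; exact h8⟩, by simp [h7, h9]⟩

theorem hasLocalRetraction_stab (n : ℕ) : HasLocalRetraction (stab n) := by
  let U : Set (SO (n + 1)) := {g | ((g • pole n : Sph n) : E (n + 1)) 0 ≠ -1}
  have h1 : ∀ g ∈ U, ∃ h, stab n h = (rotTo (g • pole n))⁻¹ * g := fun g hg =>
    mem_range_stab (by rw [mul_smul, inv_smul_eq_iff, rotTo_smul_pole hg])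
  let η : SO (n + 1) → SO n := fun g => open Classical in if hg : g ∈ U then (h1 g hg).choose else 1
  have h2 : ∀ g ∈ U, stab n (η g) = (rotTo (g • pole n))⁻¹ * g := fun g hg => by
    simp only [η, dif_pos hg]
    exact (h1 g hg).choose_spec
  have hc : Continuous fun g : SO (n + 1) => g • pole n := continuous_id.smul continuous_const
  have h3 : (1 : SO (n + 1)) ∈ U := by
    change ((((1 : SO (n + 1)) • pole n : Sph n) : E (n + 1)) 0 ≠ -1)
    rw [one_smul]
    norm_num [pole]
  refine ⟨U, η, isOpen_ne_neg_pole.preimage hc, h3, ?_, ?_, fun g hg h => ?_⟩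
  · rw [isEmbedding_stab.isInducing.continuousOn_iff]
    refine ContinuousOn.congr (f := fun g => (rotTo (g • pole n))⁻¹ * g) ?_ h2
    exact ((continuousOn_rotTo.comp hc.continuousOn fun g hg => hg).inv).mul continuousOn_id
  · refine isEmbedding_stab.injective ?_
    rw [h2 1 h3, one_smul, rotTo_pole, map_one, inv_one, one_mul]
  · have h4 : stab n h • pole n = pole n := Subtype.ext (act_stab_pole h)
    have h5 : (g * stab n h) • pole n = g • pole n := by rw [mul_smul, h4]
    have h6 : g * stab n h ∈ U := by
      change ((((g * stab n h) • pole n : Sph n) : E (n + 1)) 0 ≠ -1)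
      rw [h5]; exact hg
    refine ⟨h6, isEmbedding_stab.injective ?_⟩
    rw [map_mul, h2 _ h6, h2 _ hg, h5, mul_assoc]

/-- A local section of `G → G / N` around the base point. -/
theorem HasLocalRetraction.exists_section [IsTopologicalGroup G] {φ : H →* G} (hφ : HasLocalRetraction φ)
    (hc : Continuous φ) : ∃ (W : Set (G ⧸ φ.range)) (s : G ⧸ φ.range → G), IsOpen W ∧
      ((1 : G) : G ⧸ φ.range) ∈ W ∧ ContinuousOn s W ∧ ∀ b, (s b : G ⧸ φ.range) = b := by
  obtain ⟨U, η, h1, h2, h3, h4, h5⟩ := hφ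
  let s : G ⧸ φ.range → G := fun b => b.out * (φ (η b.out))⁻¹
  have h6 : ∀ g ∈ U, s g = g * (φ (η g))⁻¹ := by
    intro g hg
    obtain ⟨⟨_, ⟨h, rfl⟩⟩, hh⟩ := QuotientGroup.mk_out_eq_mul φ.range g
    simp only [s]
    rw [hh, (h5 g hg h).2, map_mul]
    group
  refine ⟨QuotientGroup.mk '' U, s, QuotientGroup.isOpenMap_coe _ h1, ⟨1, h2, rfl⟩, ?_, fun b => ?_⟩
  · rintro _ ⟨g, hg, rfl⟩
    refine ContinuousAt.continuousWithinAt ?_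
    rw [ContinuousAt, ← QuotientGroup.isOpenQuotientMap_mk.map_nhds_eq, tendsto_map'_iff, h6 g hg]
    have h7 : ContinuousOn (fun g => g * (φ (η g))⁻¹) U :=
      continuousOn_id.mul (hc.comp_continuousOn h3).inv
    refine (h7.continuousAt (h1.mem_nhds hg)).tendsto.congr' ?_
    filter_upwards [h1.mem_nhds hg] with g' hg'
    exact (h6 g' hg').symm
  · rw [← QuotientGroup.out_eq' b]
    simp only [s, QuotientGroup.out_eq']
    conv_rhs => rw [← QuotientGroup.out_eq' b]
    rw [QuotientGroup.eq]
    simp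

end Retraction

section Bundle

variable {G F T B : Type*} [Group G] [TopologicalSpace G] [IsTopologicalGroup G]
  [TopologicalSpace F] [TopologicalSpace T] [TopologicalSpace B]
  [MulAction G T] [ContinuousSMul G T] [MulAction G B] [ContinuousSMul G B]

/-- The action of `G` on `B` is transitive and the orbit map `g ↦ g • b₀` has a continuous section
near `b₀`. -/
def HasLocalSection (G : Type*) {B : Type*} [Group G] [TopologicalSpace G] [TopologicalSpace B]
    [MulAction G B] (b₀ : B) : Prop :=
  (∀ b, ∃ g : G, g • b₀ = b) ∧ ∃ (W : Set B) (s : B → G), IsOpen W ∧ b₀ ∈ W ∧ ContinuousOn s W ∧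
    ∀ b ∈ W, s b • b₀ = b

theorem HasLocalRetraction.hasLocalSection {H : Type*} [Group H] [TopologicalSpace H] {φ : H →* G}
    (hφ : HasLocalRetraction φ) (hc : Continuous φ) :
    HasLocalSection G ((1 : G) : G ⧸ φ.range) := by
  obtain ⟨W, s, h1, h2, h3, h4⟩ := hφ.exists_section hc
  have key : ∀ g : G, g • ((1 : G) : G ⧸ φ.range) = g := fun g => by
    rw [MulAction.Quotient.smul_coe, smul_eq_mul, mul_one]
  exact ⟨fun b => ⟨s b, (key _).trans (h4 b)⟩, W, s, h1, h2, h3, fun b _ => (key _).trans (h4 b)⟩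

/-- An equivariant map to a homogeneous space with a local section is a fibre bundle. -/
theorem isFibreBundle_of_equivariant [Nonempty F] {i : F → T} {p : T → B} {b₀ : B}
    (hb : HasLocalSection G b₀) (hp : Continuous p) (hpe : ∀ (g : G) x, p (g • x) = g • p x)
    (hi : Topology.IsEmbedding i) (hr : range i = p ⁻¹' {b₀}) : IsFibreBundle i p b₀ := by
  obtain ⟨ht, W, s, hW, h₀, hs, hsb⟩ := hb
  refine ⟨fun b => ?_, hi, hr⟩
  obtain ⟨g, rfl⟩ := ht b
  let W' : Set B := (fun b => g⁻¹ • b) ⁻¹' W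
  have hW' : IsOpen W' := hW.preimage (continuous_const_smul _)
  let s' : B → G := fun b => g * s (g⁻¹ • b)
  have hs' : ContinuousOn s' W' :=
    continuousOn_const.mul (hs.comp (continuous_const_smul _).continuousOn fun _ h => h)
  have hsb' : ∀ b ∈ W', s' b • b₀ = b := fun b hb => by
    simp only [s']
    rw [mul_smul, hsb _ hb, smul_inv_smul]
  have hinv : ∀ y, Function.invFun i (i y) = y := Function.leftInverse_invFun hi.injective
  have hpi : ∀ y, p (i y) = b₀ := fun y => by
    have : i y ∈ p ⁻¹' {b₀} := hr ▸ mem_range_self y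
    exact this
  have hρ : ∀ x ∈ p ⁻¹' W', i (Function.invFun i ((s' (p x))⁻¹ • x)) = (s' (p x))⁻¹ • x := by
    intro x hx
    refine Function.invFun_eq (f := i) ?_
    have : (s' (p x))⁻¹ • x ∈ range i := by
      rw [hr, mem_preimage, mem_singleton_iff, hpe, inv_smul_eq_iff, hsb' _ hx]
    exact this
  refine ⟨{ toFun := fun x => (p x, Function.invFun i ((s' (p x))⁻¹ • x))
            invFun := fun q => s' q.1 • i q.2
            source := p ⁻¹' W'
            target := W' ×ˢ univ
            baseSet := W'
            map_source' := fun x hx => ⟨hx, trivial⟩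
            map_target' := fun q hq => ?_
            left_inv' := fun x hx => ?_
            right_inv' := fun q hq => ?_
            open_source := hW'.preimage hp
            open_target := hW'.prod isOpen_univ
            continuousOn_toFun := ?_
            continuousOn_invFun := ?_
            open_baseSet := hW'
            source_eq := rfl
            target_eq := rfl
            proj_toFun := fun _ _ => rfl }, ?_⟩
  · rw [mem_preimage, hpe, hpi, hsb' _ hq.1]
    exact hq.1
  · change s' (p x) • i (Function.invFun i ((s' (p x))⁻¹ • x)) = x
    rw [hρ x hx, smul_inv_smul]
  · have h1 : p (s' q.1 • i q.2) = q.1 := by rw [hpe, hpi, hsb' _ hq.1]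
    refine Prod.ext h1 ?_
    change Function.invFun i ((s' (p (s' q.1 • i q.2)))⁻¹ • s' q.1 • i q.2) = q.2
    rw [h1, inv_smul_smul, hinv]
  · refine hp.continuousOn.prodMk ?_
    rw [hi.isInducing.continuousOn_iff]
    refine ContinuousOn.congr ?_ hρ
    exact (hs'.comp hp.continuousOn fun _ h => h).inv.smul continuousOn_id
  · exact (hs'.comp continuousOn_fst fun q hq => hq.1).smul
      (hi.continuous.comp continuous_snd).continuousOn
  · change g⁻¹ • g • b₀ ∈ W
    rwa [inv_smul_smul]

/-- A transitive action with a local section of the orbit map identifies the homogeneous space with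
the quotient by the stabiliser. -/
theorem exists_quotient_homeomorph {N : Subgroup G} {b₀ : B} (hN : ∀ g : G, g ∈ N ↔ g • b₀ = b₀)
    (hb : HasLocalSection G b₀) : ∃ ρ : (G ⧸ N) ≃ₜ B, ∀ g : G, ρ (g : G ⧸ N) = g • b₀ := by
  obtain ⟨ht, W, s, hW, h₀, hs, hsb⟩ := hb
  let f : G ⧸ N → B := Quotient.lift (fun g : G => g • b₀) fun a b hab => by
    have h1 := (hN _).1 (QuotientGroup.leftRel_apply.1 hab)
    rw [mul_smul, inv_smul_eq_iff] at h1
    exact h1.symm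
  have hf : ∀ g : G, f (g : G ⧸ N) = g • b₀ := fun _ => rfl
  have hinj : Function.Injective f := by
    intro a b
    induction a using QuotientGroup.induction_on with | _ a => ?_
    induction b using QuotientGroup.induction_on with | _ b => ?_
    intro hab
    rw [hf, hf] at hab
    rw [QuotientGroup.eq, hN, mul_smul, inv_smul_eq_iff, hab]
  let e : (G ⧸ N) ≃ B := Equiv.ofBijective f ⟨hinj, fun b =>
    let ⟨g, hg⟩ := ht b; ⟨(g : G ⧸ N), hg⟩⟩
  have hsymm : ∀ g : G, e.symm (g • b₀) = (g : G ⧸ N) := fun g => by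
    rw [Equiv.symm_apply_eq]
    rfl
  refine ⟨⟨e, ?_, ?_⟩, hf⟩
  · exact continuous_quot_lift _ (continuous_id.smul continuous_const)
  · refine continuous_iff_continuousAt.2 fun b => ?_
    obtain ⟨g, rfl⟩ := ht b
    have h1 : ContinuousAt (fun b => ((g * s (g⁻¹ • b) : G) : G ⧸ N)) (g • b₀) := by
      refine QuotientGroup.continuous_mk.continuousAt.comp (continuousAt_const.mul ?_)
      refine ContinuousAt.comp (g := s) ?_ (continuous_const_smul _).continuousAt
      rw [inv_smul_smul]
      exact hs.continuousAt (hW.mem_nhds h₀)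
    refine h1.congr ?_
    have h2 : ∀ᶠ b in 𝓝 (g • b₀), g⁻¹ • b ∈ W :=
      (continuous_const_smul g⁻¹).continuousAt.eventually
        (hW.mem_nhds (by simpa only [inv_smul_smul] using h₀))
    filter_upwards [h2] with b hb
    change _ = e.symm b
    rw [← hsymm, mul_smul, hsb _ hb, smul_inv_smul]

end Bundle

/-! ### The topology of balanced products -/

namespace Balanced

variable {G G' H X : Type*} [Group G] [Group G'] [Group H] [MulAction H X]

theorem mk_mul (φ : H →* G) (g : G) (h : H) (x : X) : mk φ (g * φ h) x = mk φ g (h • x) :=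
  Quotient.sound ⟨h, rfl, rfl⟩

theorem mk_eq_mk {φ : H →* G} {g g' : G} {x x' : X} :
    mk φ g x = mk φ g' x' ↔ ∃ h : H, g = g' * φ h ∧ x' = h • x :=
  Quotient.eq (r := balancedSetoid φ X)

theorem exists_mk {φ : H →* G} (a : Balanced φ X) : ∃ g x, mk φ g x = a := by
  obtain ⟨⟨g, x⟩, rfl⟩ := Quotient.exists_rep a
  exact ⟨g, x, rfl⟩

/-- Left translation. -/
instance (φ : H →* G) : SMul G (Balanced φ X) where
  smul g := Quotient.map' (s₁ := balancedSetoid φ X) (s₂ := balancedSetoid φ X)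
    (fun a : G × X => (g * a.1, a.2)) (by
      rintro a b ⟨h, h1, h2⟩
      exact ⟨h, by simp [h1, mul_assoc], h2⟩)

theorem smul_mk (φ : H →* G) (g a : G) (x : X) : g • mk φ a x = mk φ (g * a) x := rfl

instance (φ : H →* G) : MulAction G (Balanced φ X) where
  one_smul a := by
    obtain ⟨g, x, rfl⟩ := exists_mk a
    rw [smul_mk, one_mul]
  mul_smul g g' a := by
    obtain ⟨b, x, rfl⟩ := exists_mk a
    rw [smul_mk, smul_mk, smul_mk, mul_assoc]

theorem proj_smul (φ : H →* G) (N : Subgroup G) (hN : φ.range ≤ N) (g : G) (a : Balanced φ X) :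
    proj φ N hN (g • a) = g • proj φ N hN a := by
  obtain ⟨b, x, rfl⟩ := exists_mk a
  rfl

theorem map_mk (φ : H →* G') (ψ : G' →* G) (g : G') (x : X) :
    map φ ψ (mk φ g x) = mk (ψ.comp φ) (ψ g) x := rfl

section Topology

variable [TopologicalSpace G] [TopologicalSpace G'] [TopologicalSpace H] [TopologicalSpace X]
  [IsTopologicalGroup G] [IsTopologicalGroup G'] [ContinuousSMul H X]

theorem isOpenQuotientMap_mk (φ : H →* G) :
    IsOpenQuotientMap (fun a : G × X => mk φ a.1 a.2) := by
  refine ⟨fun a => ?_, continuous_quot_mk, fun O hO => ?_⟩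
  · obtain ⟨g, x, h⟩ := exists_mk a
    exact ⟨(g, x), h⟩
  · change IsOpen ((fun a : G × X => mk φ a.1 a.2) ⁻¹' ((fun a : G × X => mk φ a.1 a.2) '' O))
    have h1 : (fun a : G × X => mk φ a.1 a.2) ⁻¹' ((fun a : G × X => mk φ a.1 a.2) '' O) =
        ⋃ h : H, (fun a : G × X => (a.1 * φ h, h⁻¹ • a.2)) ⁻¹' O := by
      ext ⟨g, x⟩
      simp only [mem_preimage, mem_image, Prod.exists, mem_iUnion, mk_eq_mk]
      constructor
      · rintro ⟨g', x', h1, h, rfl, rfl⟩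
        exact ⟨h, by rwa [inv_smul_smul]⟩
      · rintro ⟨h, hh⟩
        exact ⟨_, _, hh, h, rfl, by rw [smul_inv_smul]⟩
    rw [h1]
    exact isOpen_iUnion fun h => hO.preimage
      ((continuous_fst.mul continuous_const).prodMk (continuous_snd.const_smul _))

theorem continuous_mk (φ : H →* G) : Continuous fun a : G × X => mk φ a.1 a.2 :=
  (isOpenQuotientMap_mk φ).continuous

theorem continuous_iff {Z : Type*} [TopologicalSpace Z] {φ : H →* G} {f : Balanced φ X → Z} :
    Continuous f ↔ Continuous fun a : G × X => f (mk φ a.1 a.2) :=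
  (isOpenQuotientMap_mk φ).isQuotientMap.continuous_iff

theorem continuous_prod_iff {Z W : Type*} [TopologicalSpace Z] [TopologicalSpace W] {φ : H →* G}
    {f : W × Balanced φ X → Z} :
    Continuous f ↔ Continuous fun a : W × G × X => f (a.1, mk φ a.2.1 a.2.2) :=
  (IsOpenQuotientMap.id.prodMap (isOpenQuotientMap_mk φ)).isQuotientMap.continuous_iff

instance (φ : H →* G) : ContinuousSMul G (Balanced φ X) where
  continuous_smul := continuous_prod_iff.2 ((continuous_mk φ).comp
    ((continuous_fst.mul (continuous_fst.comp continuous_snd)).prodMk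
      (continuous_snd.comp continuous_snd)))

theorem continuous_proj (φ : H →* G) (N : Subgroup G) (hN : φ.range ≤ N) :
    Continuous (proj (X := X) φ N hN) :=
  continuous_iff.2 (QuotientGroup.continuous_mk.comp continuous_fst)

theorem isEmbedding_mk_one {φ : H →* G} (hφ : HasLocalRetraction φ) :
    Topology.IsEmbedding fun x : X => mk φ 1 x := by
  obtain ⟨U, η, h1, h2, h3, h4, h5⟩ := hφ
  have hη : ∀ h, η (φ h) = h := fun h => by simpa [h4] using (h5 1 h2 h).2
  refine ⟨⟨le_antisymm (continuous_iff_le_induced.1 ((continuous_mk φ).comp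
    (Continuous.prodMk_right 1)))
    fun O hO => ?_⟩, fun x x' hxx => ?_⟩
  · refine ⟨(fun a : G × X => mk φ a.1 a.2) '' {a | a.1 ∈ U ∧ η a.1 • a.2 ∈ O},
      (isOpenQuotientMap_mk φ).isOpenMap _ ?_, ?_⟩
    · have h6 : ContinuousOn (fun a : G × X => η a.1 • a.2) (Prod.fst ⁻¹' U) :=
        (h3.comp continuousOn_fst fun _ h => h).smul continuousOn_snd
      exact h6.isOpen_inter_preimage (h1.preimage continuous_fst) hO
    · ext x
      simp only [mem_preimage, mem_image, Prod.exists, mk_eq_mk]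
      constructor
      · rintro ⟨g, y, ⟨h6, h7⟩, h, h8, rfl⟩
        simp only [h8, one_mul, hη] at h7
        exact h7
      · intro hx
        exact ⟨1, x, ⟨h2, by simpa only [h4, one_smul] using hx⟩, 1, by simp, by simp⟩
  · obtain ⟨h, h6, rfl⟩ := mk_eq_mk.1 hxx
    have := hη h
    rw [one_mul] at h6
    rw [← h6, h4] at this
    rw [← this, one_smul]

theorem isEmbedding_map (φ : H →* G') {ψ : G' →* G} (hc : Continuous ψ)
    (hψ : HasLocalRetraction ψ) :
    Topology.IsEmbedding (map (X := X) φ ψ) := by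
  obtain ⟨U, η, h1, h2, h3, h4, h5⟩ := hψ
  have hη : ∀ h, η (ψ h) = h := fun h => by simpa [h4] using (h5 1 h2 h).2
  have hU : ∀ h, ψ h ∈ U := fun h => by simpa using (h5 1 h2 h).1
  have hcont : Continuous (map (X := X) φ ψ) := continuous_iff.2
    ((continuous_mk (ψ.comp φ)).comp ((hc.comp continuous_fst).prodMk continuous_snd))
  refine ⟨⟨le_antisymm (continuous_iff_le_induced.1 hcont) fun O hO => ?_⟩, fun a a' haa => ?_⟩
  · refine ⟨(fun a : G × X => mk (ψ.comp φ) a.1 a.2) '' {a | a.1 ∈ U ∧ mk φ (η a.1) a.2 ∈ O},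
      (isOpenQuotientMap_mk _).isOpenMap _ ?_, ?_⟩
    · have h6 : ContinuousOn (fun a : G × X => mk φ (η a.1) a.2) (Prod.fst ⁻¹' U) :=
        (continuous_mk φ).comp_continuousOn
          ((h3.comp continuousOn_fst fun _ h => h).prodMk continuousOn_snd)
      exact h6.isOpen_inter_preimage (h1.preimage continuous_fst) hO
    · ext a
      obtain ⟨b, x, rfl⟩ := exists_mk a
      simp only [mem_preimage, mem_image, Prod.exists, map_mk, mk_eq_mk]
      constructor
      · rintro ⟨g, y, ⟨h6, h7⟩, h, rfl, rfl⟩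
        simp only [MonoidHom.comp_apply, ← map_mul, hη] at h7
        rwa [mk_mul] at h7
      · intro hx
        exact ⟨ψ b, x, ⟨hU b, by simpa only [hη] using hx⟩, 1, by simp, by simp⟩
  · obtain ⟨b, x, rfl⟩ := exists_mk a
    obtain ⟨b', x', rfl⟩ := exists_mk a'
    obtain ⟨h, h6, rfl⟩ := mk_eq_mk.1 haa
    refine mk_eq_mk.2 ⟨h, ?_, rfl⟩
    rw [MonoidHom.comp_apply, ← map_mul] at h6
    rw [← hη b, h6, hη]

end Topology

end Balanced

/-! ### Equivariant homotopy equivalences of slices -/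

section Equivalence

open KnotSpaces.Balanced ContinuousMap

variable {G H X Y T B : Type*} [Group G] [Group H] [TopologicalSpace G] [TopologicalSpace H]
  [IsTopologicalGroup G] [TopologicalSpace X] [TopologicalSpace Y] [TopologicalSpace T]
  [MulAction H X] [ContinuousSMul H X] [MulAction G T] [ContinuousSMul G T]

/-- Let `T` be a `G`-space which is locally, over a slice `Y ⊆ T` with stabiliser `H`, a product with
`G`. An `H`-equivariant homotopy equivalence `κ : X → Y` then induces a homotopy equivalence
`G ×_H X → G ×_H Y = T`, which is fibrewise over every space on which the translates of the slice
are fibres. -/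
theorem isFibreHomotopyEquiv_of_equivariant {φ : H →* G} {i : Y → T} (hi : Topology.IsEmbedding i)
    {κ : C(X, Y)} {r : C(Y, X)} (HX : Homotopy (r.comp κ) (.id X)) (HY : Homotopy (κ.comp r) (.id Y))
    (hr : ∀ (h : H) y y', i y' = φ h • i y → r y' = h • r y)
    (hHX : ∀ t (h : H) x, HX (t, h • x) = h • HX (t, x))
    (hHY : ∀ t (h : H) y y', i y' = φ h • i y → i (HY (t, y')) = φ h • i (HY (t, y)))
    (hstab : ∀ (g : G) y y', g • i y = i y' → g ∈ φ.range)
    (hloc : ∀ e : T, ∃ U ∈ 𝓝 e, ∃ γ : T → G, ContinuousOn γ U ∧ ∀ e' ∈ U, ∃ y, γ e' • i y = e')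
    {Θ : C(Balanced φ X, T)} (hΘ : ∀ g x, Θ (mk φ g x) = g • i (κ x))
    {p : Balanced φ X → B} {q : T → B} (hpq : ∀ a, q (Θ a) = p a)
    (hq : ∀ (g : G) y y', q (g • i y) = q (g • i y')) : IsFibreHomotopyEquiv p q Θ := by
  have hsurj : ∀ e : T, ∃ a : G × Y, a.1 • i a.2 = e := fun e => by
    obtain ⟨U, hU, γ, -, h⟩ := hloc e
    obtain ⟨y, hy⟩ := h e (mem_of_mem_nhds hU)
    exact ⟨(γ e, y), hy⟩
  choose a ha using hsurj
  have hrel : ∀ g g' y y', g • i y = g' • i y' → ∃ h, g = g' * φ h ∧ i y' = φ h • i y := by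
    intro g g' y y' h
    rw [← inv_smul_eq_iff, smul_smul] at h
    obtain ⟨k, hk⟩ := hstab _ _ _ h
    exact ⟨k, by rw [hk, mul_inv_cancel_left], by rw [hk, h]⟩
  let Ψ : T → Balanced φ X := fun e => mk φ (a e).1 (r (a e).2)
  have hΨ : ∀ g y, Ψ (g • i y) = mk φ g (r y) := fun g y => by
    obtain ⟨h, h1, h2⟩ := hrel g _ y _ (ha (g • i y)).symm
    simp only [Ψ]
    rw [hr _ _ _ h2, ← mk_mul, ← h1]
  let L : unitInterval × T → T := fun z => (a z.2).1 • i (HY (z.1, (a z.2).2))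
  have hL : ∀ t g y, L (t, g • i y) = g • i (HY (t, y)) := fun t g y => by
    obtain ⟨h, h1, h2⟩ := hrel g _ y _ (ha (g • i y)).symm
    simp only [L]
    rw [hHY _ _ _ _ h2, smul_smul, ← h1]
  -- Near each point the slice coordinates can be chosen continuously.
  have hcoord : ∀ e : T, ∃ U ∈ 𝓝 e, ∃ (γ : T → G) (y : T → Y), ContinuousOn γ U ∧
      ContinuousOn y U ∧ ∀ e' ∈ U, γ e' • i (y e') = e' := by
    intro e
    obtain ⟨U, hU, γ, hγ, h⟩ := hloc e
    have : ∀ e', ∃ y, e' ∈ U → γ e' • i y = e' := fun e' => by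
      by_cases he : e' ∈ U
      · obtain ⟨y, hy⟩ := h e' he
        exact ⟨y, fun _ => hy⟩
      · exact ⟨(a e').2, fun h => absurd h he⟩
    choose y hy using this
    refine ⟨U, hU, γ, y, hγ, ?_, hy⟩
    rw [hi.isInducing.continuousOn_iff]
    exact (hγ.inv.smul continuousOn_id).congr fun e' he' => by
      change i (y e') = (γ e')⁻¹ • e'
      rw [eq_inv_smul_iff, hy e' he']
  have hΨc : Continuous Ψ := continuous_iff_continuousAt.2 fun e => by
    obtain ⟨U, hU, γ, y, h1, h2, h3⟩ := hcoord e
    refine ContinuousAt.congr (f := fun e' => mk φ (γ e') (r (y e'))) ?_ ?_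
    · exact ((continuous_mk φ).comp_continuousOn
        (h1.prodMk (r.continuous.comp_continuousOn h2))).continuousAt hU
    · filter_upwards [hU] with e' he'
      rw [← hΨ, h3 e' he']
  have hLc : Continuous L := continuous_iff_continuousAt.2 fun z => by
    obtain ⟨U, hU, γ, y, h1, h2, h3⟩ := hcoord z.2
    have hU' : Prod.snd ⁻¹' U ∈ 𝓝 z := continuous_snd.continuousAt.preimage_mem_nhds hU
    refine ContinuousAt.congr (f := fun z => γ z.2 • i (HY (z.1, y z.2))) ?_ ?_
    · have h4 : ContinuousOn y U := h2
      exact ((h1.comp continuousOn_snd fun _ h => h).smul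
        ((hi.continuous.comp HY.continuous).comp_continuousOn
          (continuousOn_fst.prodMk (h2.comp continuousOn_snd fun _ h => h)))).continuousAt hU'
    · filter_upwards [hU'] with z' hz'
      rw [← hL, h3 _ hz']
  let M : unitInterval × Balanced φ X → Balanced φ X := fun z =>
    Quotient.map' (s₁ := balancedSetoid φ X) (s₂ := balancedSetoid φ X)
      (fun a : G × X => (a.1, HX (z.1, a.2))) (by
        rintro a b ⟨h, h1, h2⟩
        exact ⟨h, h1, by simp only [h2, hHX]⟩) z.2
  have hM : ∀ t g x, M (t, mk φ g x) = mk φ g (HX (t, x)) := fun _ _ _ => rfl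
  have hMc : Continuous M := continuous_prod_iff.2 ((continuous_mk φ).comp
    ((continuous_fst.comp continuous_snd).prodMk (HX.continuous.comp
      (continuous_fst.prodMk (continuous_snd.comp continuous_snd)))))
  refine ⟨hpq, ⟨Ψ, hΨc⟩, fun e => ?_, ⟨⟨⟨M, hMc⟩, fun b => ?_, fun b => ?_⟩, fun t b => ?_⟩,
    ⟨⟨⟨L, hLc⟩, fun e => ?_, fun e => ?_⟩, fun t e => ?_⟩⟩
  · change p (mk φ (a e).1 (r (a e).2)) = q e
    rw [← hpq, hΘ, hq _ _ (a e).2, ha]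
  · obtain ⟨g, x, rfl⟩ := exists_mk b
    change M (0, mk φ g x) = Ψ (Θ (mk φ g x))
    rw [hM, hΘ, hΨ, HX.apply_zero]
    rfl
  · obtain ⟨g, x, rfl⟩ := exists_mk b
    change M (1, mk φ g x) = mk φ g x
    rw [hM, HX.apply_one]
    rfl
  · obtain ⟨g, x, rfl⟩ := exists_mk b
    change p (M (t, mk φ g x)) = p (mk φ g x)
    rw [hM, ← hpq, ← hpq, hΘ, hΘ]
    exact hq _ _ _
  · change L (0, e) = Θ (Ψ e)
    simp only [L, Ψ, hΘ, HY.apply_zero]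
    rfl
  · change L (1, e) = e
    simp only [L, HY.apply_one]
    exact ha e
  · change q (L (t, e)) = q e
    simp only [L]
    rw [hq _ _ (a e).2, ha]

theorem IsFibreHomotopyEquiv.isHomotopyEquiv {p : X → B} {q : Y → B} {f : C(X, Y)}
    (h : IsFibreHomotopyEquiv p q f) : IsHomotopyEquiv f := by
  obtain ⟨-, g, -, ⟨h1, -⟩, h2, -⟩ := h
  exact ⟨⟨f, g, ⟨h1⟩, ⟨h2⟩⟩, rfl⟩

end Equivalence

/-! ### Stereographic coordinates along a pointed knot -/

section Line

/-- The angle of the point of the circle with stereographic coordinate `x`, that is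
`x = cot (lineAngle x / 2)`. -/
def lineAngle (x : ℝ) : ℝ := Real.pi - 2 * Real.arctan x

theorem contDiff_lineAngle : ContDiff ℝ ∞ lineAngle :=
  contDiff_const.sub (contDiff_const.mul Real.contDiff_arctan)

theorem hasDerivAt_lineAngle (x : ℝ) : HasDerivAt lineAngle (-(2 / (1 + x ^ 2))) x := by
  have h := ((Real.hasDerivAt_arctan x).const_mul 2).const_sub Real.pi
  convert! h using 1
  ring

theorem lineAngle_mem (x : ℝ) : lineAngle x ∈ Ioo 0 (2 * Real.pi) := by
  have h1 := Real.arctan_lt_pi_div_two x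
  have h2 := Real.neg_pi_div_two_lt_arctan x
  constructor <;> rw [lineAngle] <;> linarith

theorem sin_lineAngle_div_two (x : ℝ) : Real.sin (lineAngle x / 2) = 1 / √(1 + x ^ 2) := by
  rw [lineAngle, show (Real.pi - 2 * Real.arctan x) / 2 = Real.pi / 2 - Real.arctan x by ring,
    Real.sin_pi_div_two_sub, Real.cos_arctan]

theorem cos_lineAngle_div_two (x : ℝ) : Real.cos (lineAngle x / 2) = x / √(1 + x ^ 2) := by
  rw [lineAngle, show (Real.pi - 2 * Real.arctan x) / 2 = Real.pi / 2 - Real.arctan x by ring,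
    Real.cos_pi_div_two_sub, Real.sin_arctan]

theorem sin_lineAngle_div_two_pos (x : ℝ) : 0 < Real.sin (lineAngle x / 2) := by
  rw [sin_lineAngle_div_two]; positivity

theorem cos_lineAngle_div_two' (x : ℝ) :
    Real.cos (lineAngle x / 2) = Real.sin (lineAngle x / 2) * x := by
  rw [sin_lineAngle_div_two, cos_lineAngle_div_two]; ring

theorem cos_lineAngle (x : ℝ) : Real.cos (lineAngle x) = (x ^ 2 - 1) / (x ^ 2 + 1) := by
  have h := Real.cos_two_mul (lineAngle x / 2)
  rw [mul_div_cancel₀ _ two_ne_zero, cos_lineAngle_div_two, div_pow,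
    Real.sq_sqrt (by positivity)] at h
  rw [h]
  have : (1 : ℝ) + x ^ 2 ≠ 0 := by positivity
  have : x ^ 2 + (1 : ℝ) ≠ 0 := by positivity
  field_simp
  ring

/-- The stereographic coordinate of the point of the circle with angle `t`. -/
def cotHalf (t : ℝ) : ℝ := Real.cos (t / 2) / Real.sin (t / 2)

theorem cotHalf_lineAngle (x : ℝ) : cotHalf (lineAngle x) = x := by
  rw [cotHalf, cos_lineAngle_div_two', mul_div_cancel_left₀ _ (sin_lineAngle_div_two_pos x).ne']

theorem circle_exp_eq_of_cos_sin {s t : ℝ} (hc : Real.cos s = Real.cos t)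
    (hs : Real.sin s = Real.sin t) : Circle.exp s = Circle.exp t := by
  ext
  rw [Circle.coe_exp, Circle.coe_exp, Complex.exp_mul_I, Complex.exp_mul_I, ← Complex.ofReal_cos,
    ← Complex.ofReal_cos, ← Complex.ofReal_sin, ← Complex.ofReal_sin, hc, hs]

theorem cos_eq_half (t : ℝ) : Real.cos t = Real.cos (t / 2) ^ 2 - Real.sin (t / 2) ^ 2 := by
  rw [← Real.cos_two_mul', mul_div_cancel₀ _ two_ne_zero]

theorem sin_eq_half (t : ℝ) : Real.sin t = 2 * Real.sin (t / 2) * Real.cos (t / 2) := by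
  rw [← Real.sin_two_mul, mul_div_cancel₀ _ two_ne_zero]

theorem exp_lineAngle_cotHalf {t : ℝ} (ht : Real.sin (t / 2) ≠ 0) :
    Circle.exp (lineAngle (cotHalf t)) = Circle.exp t := by
  set x := cotHalf t with hx
  set C := Real.cos (t / 2) with hC
  set S := Real.sin (t / 2) with hS
  have h1 : S ^ 2 + C ^ 2 = 1 := Real.sin_sq_add_cos_sq _
  have h2 : C = S * x := by rw [hx, cotHalf, mul_div_cancel₀ _ ht]
  set S' := Real.sin (lineAngle x / 2) with hS'
  have h3 : S' ^ 2 + (S' * x) ^ 2 = 1 := by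
    rw [← cos_lineAngle_div_two']; exact Real.sin_sq_add_cos_sq _
  -- both squared sines are `1 / (1 + x²)`
  have h4 : S' ^ 2 = S ^ 2 := by
    rw [h2] at h1
    have h5 : (1 + x ^ 2) * S' ^ 2 = (1 + x ^ 2) * S ^ 2 := by nlinarith
    exact mul_left_cancel₀ (by positivity) h5
  refine circle_exp_eq_of_cos_sin ?_ ?_
  · rw [cos_eq_half, cos_eq_half t, cos_lineAngle_div_two', ← hC, ← hS, h2, ← hS', mul_pow, mul_pow,
      h4]
  · rw [sin_eq_half, sin_eq_half t, cos_lineAngle_div_two', ← hC, ← hS, h2, ← hS']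
    linear_combination 2 * x * h4

theorem periodic_eq_of_exp_eq {α : Type*} {u : ℝ → α}
    (hu : Function.Periodic u (2 * Real.pi)) {s t : ℝ} (h : Circle.exp s = Circle.exp t) :
    u s = u t := by
  obtain ⟨k, rfl⟩ := Circle.exp_eq_exp.1 h
  exact hu.int_mul k t

theorem exp_eq_one_iff_sin {t : ℝ} : Circle.exp t = 1 ↔ Real.sin (t / 2) = 0 := by
  rw [Circle.exp_eq_one, Real.sin_eq_zero_iff]
  refine exists_congr fun k => ?_
  constructor <;> intro h <;> linarith

theorem exists_lineAngle {z : Circle} (hz : z ≠ 1) : ∃ x, z = Circle.exp (lineAngle x) := by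
  have h : Real.sin (Complex.arg z / 2) ≠ 0 := fun h =>
    hz (by rw [← Circle.exp_arg z, exp_eq_one_iff_sin]; exact h)
  exact ⟨_, by rw [exp_lineAngle_cotHalf h, Circle.exp_arg]⟩

/-- The dilation of the circle which multiplies the stereographic coordinate by `a`, lifted to
angles. -/
def dilate (a t : ℝ) : ℝ := t - 2 * Real.arctan
  ((a - 1) * (Real.sin (t / 2) * Real.cos (t / 2)) / (Real.sin (t / 2) ^ 2 + a * Real.cos (t / 2) ^ 2))

theorem dilate_add_two_pi (a t : ℝ) : dilate a (t + 2 * Real.pi) = dilate a t + 2 * Real.pi := by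
  have h : (t + 2 * Real.pi) / 2 = t / 2 + Real.pi := by ring
  simp only [dilate, h, Real.sin_add_pi, Real.cos_add_pi, neg_mul_neg, neg_sq]
  ring

theorem dilate_lineAngle {a : ℝ} (ha : 0 < a) (x : ℝ) :
    dilate a (lineAngle x) = lineAngle (a * x) := by
  have h := Real.arctan_add (x := a * x) (y := -x) (by nlinarith [mul_nonneg ha.le (sq_nonneg x)])
  have hs := (sin_lineAngle_div_two_pos x).ne'
  have h1 : (a - 1) * (Real.sin (lineAngle x / 2) * Real.cos (lineAngle x / 2)) /
      (Real.sin (lineAngle x / 2) ^ 2 + a * Real.cos (lineAngle x / 2) ^ 2) =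
      (a * x + -x) / (1 - a * x * -x) := by
    rw [cos_lineAngle_div_two']
    have h2 : (1 : ℝ) - a * x * -x ≠ 0 := by nlinarith [mul_nonneg ha.le (sq_nonneg x)]
    have h3 : Real.sin (lineAngle x / 2) ^ 2 + a * (Real.sin (lineAngle x / 2) * x) ^ 2 =
      Real.sin (lineAngle x / 2) ^ 2 * (1 - a * x * -x) := by ring
    rw [h3, div_eq_div_iff (mul_ne_zero (pow_ne_zero 2 hs) h2) h2]
    ring
  rw [dilate, h1, ← h, Real.arctan_neg, lineAngle, lineAngle]
  ring

theorem dilate_den_pos {a : ℝ} (ha : 0 < a) (t : ℝ) :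
    0 < Real.sin (t / 2) ^ 2 + a * Real.cos (t / 2) ^ 2 := by
  have h := Real.sin_sq_add_cos_sq (t / 2)
  rcases eq_or_ne (Real.sin (t / 2)) 0 with h0 | h0
  · rw [h0] at h ⊢
    nlinarith
  · have : 0 < Real.sin (t / 2) ^ 2 := by positivity
    positivity

variable {Y : Type*} [TopologicalSpace Y]

theorem smoothFamOn_dilate {a : Y → ℝ} (ha : Continuous a) (ha0 : ∀ y, 0 < a y) :
    SmoothFamOn (fun y t => dilate (a y) t) univ := by
  have hS : SmoothFamOn (fun (_ : Y) t => Real.sin (t / 2)) univ :=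
    .of_contDiff isOpen_univ (Real.contDiff_sin.comp (contDiff_id.div_const 2))
  have hC : SmoothFamOn (fun (_ : Y) t => Real.cos (t / 2)) univ :=
    .of_contDiff isOpen_univ (Real.contDiff_cos.comp (contDiff_id.div_const 2))
  have h1 := (SmoothFamOn.const (c := fun y => a y - 1) isOpen_univ
    (ha.sub continuous_const)).mul isOpen_univ
    (hS.mul isOpen_univ hC)
  have h2 := (hS.comp' isOpen_univ (Φ := fun x : ℝ => x ^ 2) (contDiff_id.pow 2)).add isOpen_univ
    ((SmoothFamOn.const isOpen_univ ha).mul isOpen_univ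
      (hC.comp' isOpen_univ (Φ := fun x : ℝ => x ^ 2) (contDiff_id.pow 2)))
  exact (SmoothFamOn.id isOpen_univ).sub isOpen_univ
    ((h1.div isOpen_univ h2 fun p _ => (dilate_den_pos (ha0 p.1) p.2).ne').comp' isOpen_univ
      (Φ := fun x => 2 * Real.arctan x) (contDiff_const.mul Real.contDiff_arctan))

end Line

section Stereo

variable {n : ℕ}

/-- Stereographic projection from `e₀`. -/
def stereo (v : E (n + 1)) : E n := (1 - v 0)⁻¹ • tail v

theorem invStereo_eq (y : E n) :
    invStereo y = (‖y‖ ^ 2 + 1)⁻¹ • consL (‖y‖ ^ 2 - 1, (2 : ℝ) • y) := by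
  ext i
  refine Fin.cases ?_ (fun i => ?_) i
  · simp [invStereo, div_eq_inv_mul]
  · simp [invStereo, div_eq_inv_mul]

theorem stereo_invStereo (y : E n) : stereo (invStereo y) = y := by
  have h : ‖y‖ ^ 2 + 1 ≠ 0 := by positivity
  have h0 : 1 - (invStereo y) 0 = 2 / (‖y‖ ^ 2 + 1) := by
    change 1 - (‖y‖ ^ 2 - 1) / (‖y‖ ^ 2 + 1) = _
    field_simp; ring
  rw [stereo, h0, invStereo_eq, map_smul, tail_consL, smul_smul, smul_smul]
  rw [show (2 / (‖y‖ ^ 2 + 1))⁻¹ * (‖y‖ ^ 2 + 1)⁻¹ * 2 = 1 by field_simp, one_smul]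

theorem apply_zero_lt_one {v : E (n + 1)} (hv : ‖v‖ = 1) (h : v ≠ pole n) : v 0 < 1 := by
  have h1 := norm_sq_eq_tail v
  rw [hv] at h1
  by_contra h2
  have h3 : ‖tail v‖ = 0 := by nlinarith [norm_nonneg (tail v)]
  have h4 : v 0 = 1 := by
    rw [h3] at h1
    nlinarith
  refine h (ext_tail (by simpa [pole] using h4) ?_)
  rw [norm_eq_zero.1 h3]
  ext i
  simp [pole]

theorem invStereo_stereo {v : E (n + 1)} (hv : ‖v‖ = 1) (h : v ≠ pole n) :
    invStereo (stereo v) = v := by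
  have h0 : 0 < 1 - v 0 := sub_pos.2 (apply_zero_lt_one hv h)
  have h1 := norm_sq_eq_tail v
  rw [hv] at h1
  have h2 : ‖stereo v‖ ^ 2 = (1 + v 0) / (1 - v 0) := by
    rw [stereo, norm_smul, mul_pow, norm_inv, Real.norm_eq_abs, abs_of_pos h0, inv_pow]
    field_simp
    linarith
  have h3 : ‖stereo v‖ ^ 2 + 1 = 2 / (1 - v 0) := by rw [h2]; field_simp; ring
  rw [invStereo_eq, h3]
  refine ext_tail ?_ ?_
  · rw [PiLp.smul_apply, consL_zero, h2, smul_eq_mul]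
    field_simp; ring
  · rw [map_smul, tail_consL, stereo, smul_smul, smul_smul]
    rw [show (2 / (1 - v 0))⁻¹ * 2 * (1 - v 0)⁻¹ = 1 by field_simp, one_smul]

theorem contDiff_invStereo : ContDiff ℝ ∞ (invStereo : E n → E (n + 1)) := by
  simp_rw [funext invStereo_eq]
  refine ContDiff.smul (((contDiff_norm_sq ℝ).add contDiff_const).inv fun y => by positivity) ?_
  exact consL.contDiff.comp (((contDiff_norm_sq ℝ).sub contDiff_const).prodMk
    (contDiff_const_smul (2 : ℝ)))

theorem contDiffAt_stereo {v : E (n + 1)} (h : v 0 ≠ 1) : ContDiffAt ℝ ∞ stereo v := by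
  have h1 : ContDiff ℝ ∞ fun w : E (n + 1) => w 0 :=
    contDiff_euclidean.1 contDiff_id 0
  exact ((contDiffAt_const.sub h1.contDiffAt).inv (sub_ne_zero.2 h.symm)).smul
    tail.contDiff.contDiffAt

theorem act_stab_invStereo (A : SO n) (y : E n) :
    act (stab n A) (invStereo y) = invStereo (act A y) := by
  refine ext_tail ?_ ?_
  · rw [act_stab_zero, invStereo_eq, invStereo_eq, norm_act]
    rfl
  · rw [tail_act_stab, invStereo_eq, invStereo_eq, norm_act, map_smul, map_smul, map_smul,
      tail_consL, tail_consL, map_smul]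

theorem invStereo_ne_pole (y : E n) : invStereo y ≠ pole n := by
  intro h
  have h0 : (‖y‖ ^ 2 - 1) / (‖y‖ ^ 2 + 1) = 1 := by
    have := congrArg (fun v : E (n + 1) => v 0) h
    exact this.trans (by simp [pole])
  rw [div_eq_one_iff_eq (by positivity)] at h0
  linarith

theorem norm_invStereo (y : E n) : ‖invStereo y‖ = 1 := by
  have h1 : ‖invStereo y‖ ^ 2 = 1 := by
    rw [invStereo_eq, norm_smul, mul_pow, norm_sq_eq_tail (consL _), consL_zero, tail_consL,
      norm_smul, norm_inv, Real.norm_of_nonneg (by positivity : 0 ≤ ‖y‖ ^ 2 + 1), Real.norm_two]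
    field_simp
    ring
  nlinarith [norm_nonneg (invStereo y)]

end Stereo

/-! ### Pointed knots from their stereographic coordinates -/

section Model

variable {m : ℕ}

/-- The tangent direction at the base point as a continuous map. -/
def directionMap (m : ℕ) : C(EmbPt (m + 1), Sph m) := ⟨direction, continuous_direction⟩

/-- The pointed embeddings which leave the base point in the direction of the long axis. -/
abbrev DirEmb (m : ℕ) : Type := {f : EmbPt (m + 1) // directionMap m f = pole m}

/-- The direction of the long axis. -/
def axis (m : ℕ) : E (m + 1) := EuclideanSpace.single 0 1

theorem norm_axis : ‖axis m‖ = 1 := by simp [axis]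

theorem smul_axis (x : ℝ) : x • axis m = EuclideanSpace.single 0 x := by
  ext i; simp [axis]

theorem act_stab_axis (A : SO m) : act (stab m A) (axis m) = axis m := act_stab_single A 1

/-- The homogeneous stereographic coordinate `sin (t / 2) • (μ cot (t / 2) e + v)`. -/
def homCoord (μ : ℝ) (v : E (m + 1)) (t : ℝ) : E (m + 1) :=
  (μ * Real.cos (t / 2)) • axis m + Real.sin (t / 2) • v

/-- The point of the sphere with stereographic coordinate `μ cot (t / 2) e + v`, written so as to be
smooth where the cotangent is infinite. -/
def spherePoint (μ : ℝ) (v : E (m + 1)) (t : ℝ) : E (m + 2) :=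
  (‖homCoord μ v t‖ ^ 2 + Real.sin (t / 2) ^ 2)⁻¹ •
    consL (‖homCoord μ v t‖ ^ 2 - Real.sin (t / 2) ^ 2, (2 * Real.sin (t / 2)) • homCoord μ v t)

theorem homCoord_of_sin_eq_zero {μ : ℝ} {v : E (m + 1)} {t : ℝ} (ht : Real.sin (t / 2) = 0) :
    ‖homCoord μ v t‖ ^ 2 = μ ^ 2 := by
  have h := Real.sin_sq_add_cos_sq (t / 2)
  rw [ht] at h
  rw [homCoord, ht, zero_smul, add_zero, norm_smul, norm_axis, mul_one, Real.norm_eq_abs, sq_abs,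
    mul_pow]
  nlinarith

theorem spherePoint_den_pos {μ : ℝ} (hμ : 0 < μ) (v : E (m + 1)) (t : ℝ) :
    0 < ‖homCoord μ v t‖ ^ 2 + Real.sin (t / 2) ^ 2 := by
  rcases eq_or_ne (Real.sin (t / 2)) 0 with h0 | h0
  · rw [homCoord_of_sin_eq_zero h0, h0]; positivity
  · positivity

theorem spherePoint_of_sin_eq_zero {μ : ℝ} (hμ : 0 < μ) {v : E (m + 1)} {t : ℝ}
    (ht : Real.sin (t / 2) = 0) : spherePoint μ v t = pole (m + 1) := by
  rw [spherePoint, homCoord_of_sin_eq_zero ht, ht]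
  refine ext_tail ?_ ?_
  · simp [pole, hμ.ne']
  · ext i
    simp [pole]

theorem spherePoint_of_sin_ne_zero (μ : ℝ) (v : E (m + 1)) {t : ℝ} (ht : Real.sin (t / 2) ≠ 0) :
    spherePoint μ v t = invStereo ((μ * cotHalf t) • axis m + v) := by
  have h : homCoord μ v t = Real.sin (t / 2) • ((μ * cotHalf t) • axis m + v) := by
    rw [homCoord, smul_add, smul_smul, cotHalf]
    congr 2
    field_simp
  rw [spherePoint, h, invStereo_eq, norm_smul, mul_pow, Real.norm_eq_abs, sq_abs]
  set S := Real.sin (t / 2)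
  set w := (μ * cotHalf t) • axis m + v
  have h1 : S ^ 2 * ‖w‖ ^ 2 + S ^ 2 = S ^ 2 * (‖w‖ ^ 2 + 1) := by ring
  have h2 : ((S ^ 2 * ‖w‖ ^ 2 - S ^ 2, (2 * S) • S • w) : ℝ × E (m + 1)) =
      S ^ 2 • (‖w‖ ^ 2 - 1, (2 : ℝ) • w) := by
    rw [Prod.smul_mk, smul_eq_mul, smul_smul, smul_smul]
    congr 2 <;> ring
  rw [h1, h2, map_smul, smul_smul, mul_inv, mul_right_comm, inv_mul_cancel₀ (pow_ne_zero 2 ht),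
    one_mul]

theorem norm_spherePoint {μ : ℝ} (hμ : 0 < μ) (v : E (m + 1)) (t : ℝ) :
    ‖spherePoint μ v t‖ = 1 := by
  rcases eq_or_ne (Real.sin (t / 2)) 0 with h0 | h0
  · rw [spherePoint_of_sin_eq_zero hμ h0, norm_sph]
  · rw [spherePoint_of_sin_ne_zero μ v h0, norm_invStereo]

theorem spherePoint_add_two_pi (μ : ℝ) (v : E (m + 1)) (t : ℝ) :
    spherePoint μ v (t + 2 * Real.pi) = spherePoint μ v t := by
  have h : (t + 2 * Real.pi) / 2 = t / 2 + Real.pi := by ring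
  have h1 : homCoord μ v (t + 2 * Real.pi) = -homCoord μ v t := by
    rw [homCoord, homCoord, h, Real.sin_add_pi, Real.cos_add_pi, mul_neg, neg_smul, neg_smul,
      neg_add]
  rw [spherePoint, spherePoint, h1, h, Real.sin_add_pi, norm_neg, neg_sq, mul_neg, neg_smul_neg]

theorem contDiffAt_spherePoint {μ : ℝ} (hμ : 0 < μ) (v : E (m + 1)) (t : ℝ) :
    ContDiffAt ℝ ∞ (fun q : ℝ × E (m + 1) × ℝ => spherePoint q.1 q.2.1 q.2.2) (μ, v, t) := by
  have hs : ContDiff ℝ ∞ fun q : ℝ × E (m + 1) × ℝ => Real.sin (q.2.2 / 2) :=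
    Real.contDiff_sin.comp ((contDiff_snd.comp contDiff_snd).div_const 2)
  have hc : ContDiff ℝ ∞ fun q : ℝ × E (m + 1) × ℝ => Real.cos (q.2.2 / 2) :=
    Real.contDiff_cos.comp ((contDiff_snd.comp contDiff_snd).div_const 2)
  have hh : ContDiff ℝ ∞ fun q : ℝ × E (m + 1) × ℝ => homCoord q.1 q.2.1 q.2.2 :=
    ((contDiff_fst.mul hc).smul contDiff_const).add (hs.smul (contDiff_fst.comp contDiff_snd))
  have h1 : ContDiff ℝ ∞ fun q : ℝ × E (m + 1) × ℝ =>
      ‖homCoord q.1 q.2.1 q.2.2‖ ^ 2 + Real.sin (q.2.2 / 2) ^ 2 := (hh.norm_sq ℝ).add (hs.pow 2)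
  have h2 : ContDiff ℝ ∞ fun q : ℝ × E (m + 1) × ℝ =>
      (‖homCoord q.1 q.2.1 q.2.2‖ ^ 2 - Real.sin (q.2.2 / 2) ^ 2,
        (2 * Real.sin (q.2.2 / 2)) • homCoord q.1 q.2.1 q.2.2) :=
    ((hh.norm_sq ℝ).sub (hs.pow 2)).prodMk ((contDiff_const.mul hs).smul hh)
  have h3 := consL.contDiff.comp h2
  have h4 := h1.contDiffAt.inv (x := (μ, v, t)) (spherePoint_den_pos hμ v t).ne'
  exact h4.smul h3.contDiffAt

/-- The curve `x ↦ μ x e + u` in stereographic coordinates, for a perturbation `u` given as a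
function of the angle. -/
def line (μ : ℝ) (u : ℝ → E (m + 1)) (x : ℝ) : E (m + 1) := (μ * x) • axis m + u (lineAngle x)

/-- The curve `x ↦ μ x e + u` is the stereographic image of an embedded circle. -/
structure IsModel (μ : ℝ) (u : ℝ → E (m + 1)) : Prop where
  pos : 0 < μ
  contDiff : ContDiff ℝ ∞ u
  periodic : Function.Periodic u (2 * Real.pi)
  injective : Function.Injective (line μ u)
  deriv_ne_zero : ∀ x, deriv (line μ u) x ≠ 0

variable {μ : ℝ} {u : ℝ → E (m + 1)}

theorem spherePoint_lineAngle (μ : ℝ) (u : ℝ → E (m + 1)) (x : ℝ) :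
    spherePoint μ (u (lineAngle x)) (lineAngle x) = invStereo (line μ u x) := by
  rw [spherePoint_of_sin_ne_zero _ _ (sin_lineAngle_div_two_pos x).ne', cotHalf_lineAngle, line]

theorem IsModel.periodic_spherePoint (h : IsModel μ u) :
    Function.Periodic (fun t => spherePoint μ (u t) t) (2 * Real.pi) := fun t => by
  simp only [h.periodic t, spherePoint_add_two_pi]

theorem IsModel.contDiff_spherePoint (h : IsModel μ u) :
    ContDiff ℝ ∞ fun t => spherePoint μ (u t) t := contDiff_iff_contDiffAt.2 fun t =>
  ContDiffAt.comp (g := fun q : ℝ × E (m + 1) × ℝ => spherePoint q.1 q.2.1 q.2.2)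
    (f := fun t => (μ, u t, t)) t (contDiffAt_spherePoint h.pos (u t) t)
    (contDiffAt_const.prodMk (h.contDiff.contDiffAt.prodMk contDiffAt_id))

/-- The closed curve in the sphere with given stereographic coordinates. -/
def modelCurve (μ : ℝ) (u : ℝ → E (m + 1)) (hμ : 0 < μ) (z : Circle) : Sph (m + 1) :=
  ⟨spherePoint μ (u (Complex.arg z)) (Complex.arg z), by simp [norm_spherePoint hμ]⟩

theorem IsModel.angular_modelCurve (h : IsModel μ u) (t : ℝ) :
    angular (modelCurve μ u h.pos) t = spherePoint μ (u t) t :=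
  periodic_eq_of_exp_eq h.periodic_spherePoint (by rw [Circle.exp_arg])

theorem tail_spherePoint (μ : ℝ) (v : E (m + 1)) (t : ℝ) :
    tail (spherePoint μ v t) = Real.sin (t / 2) •
      ((2 * (‖homCoord μ v t‖ ^ 2 + Real.sin (t / 2) ^ 2)⁻¹) • homCoord μ v t) := by
  rw [spherePoint, map_smul, tail_consL, smul_smul, smul_smul]
  congr 1
  ring

theorem IsModel.tail_deriv_spherePoint_zero (h : IsModel μ u) :
    tail (deriv (fun t => spherePoint μ (u t) t) 0) = μ⁻¹ • axis m := by
  have h1 := tail.hasFDerivAt.comp_hasDerivAt (0 : ℝ)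
    (h.contDiff_spherePoint.differentiable (by simp) 0).hasDerivAt
  have hs : HasDerivAt (fun t : ℝ => Real.sin (t / 2)) (1 / 2) 0 := by
    have := ((hasDerivAt_id (0 : ℝ)).div_const 2).sin
    simpa using this
  have hh : ContDiff ℝ ∞ fun t => homCoord μ (u t) t :=
    ((contDiff_const.mul (Real.contDiff_cos.comp (contDiff_id.div_const 2))).smul
      contDiff_const).add ((Real.contDiff_sin.comp (contDiff_id.div_const 2)).smul h.contDiff)
  have hb : ContDiff ℝ ∞ fun t =>
      (2 * (‖homCoord μ (u t) t‖ ^ 2 + Real.sin (t / 2) ^ 2)⁻¹) • homCoord μ (u t) t := by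
    refine ContDiff.smul (contDiff_const.mul (ContDiff.inv ((hh.norm_sq ℝ).add
      ((Real.contDiff_sin.comp (contDiff_id.div_const 2)).pow 2)) fun t => ?_)) hh
    exact (spherePoint_den_pos h.pos (u t) t).ne'
  have h2 := hs.smul (hb.differentiable (by simp) 0).hasDerivAt
  have h3 := h1.unique (h2.congr_of_eventuallyEq (.of_forall fun t => tail_spherePoint μ (u t) t))
  have h0 : homCoord μ (u 0) 0 = μ • axis m := by simp [homCoord]
  rw [h3, zero_div, Real.sin_zero, zero_smul, zero_add, h0, norm_smul, norm_axis, mul_one,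
    Real.norm_of_nonneg h.pos.le, smul_smul, smul_smul]
  congr 1
  have hμ := h.pos.ne'
  field_simp
  norm_num

theorem IsModel.injective_modelCurve (h : IsModel μ u) :
    Function.Injective (modelCurve μ u h.pos) := by
  have key : ∀ x, (modelCurve μ u h.pos (Circle.exp (lineAngle x)) : E (m + 2)) =
      invStereo (line μ u x) := fun x =>
    (h.angular_modelCurve _).trans (spherePoint_lineAngle μ u x)
  have h1 : (modelCurve μ u h.pos 1 : E (m + 2)) = pole (m + 1) := by
    rw [← Circle.exp_zero]
    exact (h.angular_modelCurve 0).trans (spherePoint_of_sin_eq_zero h.pos (by simp))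
  intro z w hzw
  have hzw' := congrArg (fun v : Sph (m + 1) => (v : E (m + 2))) hzw
  by_cases hz : z = 1 <;> by_cases hw : w = 1
  · rw [hz, hw]
  · obtain ⟨x, rfl⟩ := exists_lineAngle hw
    rw [hz, h1, key] at hzw'
    exact absurd hzw'.symm (invStereo_ne_pole _)
  · obtain ⟨x, rfl⟩ := exists_lineAngle hz
    rw [hw, h1, key] at hzw'
    exact absurd hzw' (invStereo_ne_pole _)
  · obtain ⟨x, rfl⟩ := exists_lineAngle hz
    obtain ⟨y, rfl⟩ := exists_lineAngle hw
    rw [key, key] at hzw'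
    have h2 := congrArg stereo hzw'
    rw [stereo_invStereo, stereo_invStereo] at h2
    rw [h.injective h2]

theorem invStereo_zero_ne_one {n : ℕ} (y : E n) : invStereo y 0 ≠ 1 :=
  (apply_zero_lt_one (norm_invStereo y) (invStereo_ne_pole y)).ne

theorem exists_exp_eq_lineAngle (t : ℝ) (ht : Real.sin (t / 2) ≠ 0) :
    ∃ (k : ℤ) (x : ℝ), t = lineAngle x + k * (2 * Real.pi) := by
  obtain ⟨k, hk⟩ := Circle.exp_eq_exp.1 (exp_lineAngle_cotHalf ht).symm
  exact ⟨k, _, hk⟩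

theorem periodic_deriv {V : Type*} [NormedAddCommGroup V] [NormedSpace ℝ V] {g : ℝ → V} {c : ℝ}
    (h : Function.Periodic g c) : Function.Periodic (deriv g) c := fun t => by
  rw [← deriv_comp_add_const, funext h]

theorem IsModel.deriv_spherePoint_ne_zero (h : IsModel μ u) (t : ℝ) :
    deriv (fun t => spherePoint μ (u t) t) t ≠ 0 := by
  have hper := periodic_deriv h.periodic_spherePoint
  rcases eq_or_ne (Real.sin (t / 2)) 0 with h0 | h0
  · obtain ⟨k, hk⟩ := Circle.exp_eq_one.1 (exp_eq_one_iff_sin.2 h0)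
    have h1 : t = 0 + k * (2 * Real.pi) := by rw [hk, zero_add]
    rw [h1, hper.int_mul k 0]
    intro h2
    have h3 := h.tail_deriv_spherePoint_zero
    rw [h2, map_zero] at h3
    have h4 := congrArg norm h3
    rw [norm_zero, norm_smul, norm_axis, mul_one, norm_inv, eq_comm, inv_eq_zero, norm_eq_zero] at h4
    exact h.pos.ne' h4
  · obtain ⟨k, x, rfl⟩ := exists_exp_eq_lineAngle t h0
    rw [hper.int_mul k]
    intro h1
    have h2 := (h.contDiff_spherePoint.differentiable (by simp) (lineAngle x)).hasDerivAt
    rw [h1] at h2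
    have h3 := h2.scomp x (hasDerivAt_lineAngle x)
    have h4 : (fun t => spherePoint μ (u t) t) ∘ lineAngle = fun x => invStereo (line μ u x) :=
      funext (spherePoint_lineAngle μ u)
    rw [h4, smul_zero] at h3
    have h5 := ((contDiffAt_stereo (invStereo_zero_ne_one (line μ u x))).differentiableAt
      (by simp)).hasFDerivAt.comp_hasDerivAt x h3
    have h6 : stereo ∘ (fun x => invStereo (line μ u x)) = line μ u :=
      funext fun x => stereo_invStereo _
    rw [h6, map_zero] at h5
    exact h.deriv_ne_zero x h5.deriv

/-- The embedding with given stereographic coordinates. -/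
def IsModel.emb (h : IsModel μ u) : Emb (m + 1) := ⟨modelCurve μ u h.pos, by
  have h1 : angular (modelCurve μ u h.pos) = fun t => spherePoint μ (u t) t :=
    funext h.angular_modelCurve
  rw [isSmoothEmb_circle_iff, h1]
  exact ⟨h.contDiff_spherePoint, h.deriv_spherePoint_ne_zero, h.injective_modelCurve⟩⟩

theorem IsModel.angular_emb (h : IsModel μ u) :
    angular h.emb.1 = fun t => spherePoint μ (u t) t := funext h.angular_modelCurve

theorem IsModel.emb_one (h : IsModel μ u) : h.emb.1 1 = pole (m + 1) := by
  refine Subtype.ext ?_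
  rw [← Circle.exp_zero]
  exact (congrFun h.angular_emb 0).trans (spherePoint_of_sin_eq_zero h.pos (by simp))

theorem direction_eq_pole_iff {f : EmbPt (m + 1)} :
    directionMap m f = pole m ↔ velocity f = ‖velocity f‖ • axis m := by
  rw [Subtype.ext_iff]
  change tangentDir f = axis m ↔ _
  rw [tangentDir_eq, inv_smul_eq_iff₀ (norm_ne_zero_iff.2 (velocity_ne_zero f))]

/-- The pointed embedding with given stereographic coordinates. -/
def IsModel.dirEmb (h : IsModel μ u) : DirEmb m := ⟨⟨h.emb, h.emb_one⟩, by
  have h1 : velocity ⟨h.emb, h.emb_one⟩ = μ⁻¹ • axis m := by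
    rw [velocity]
    change tail (deriv (angular h.emb.1) 0) = _
    rw [h.angular_emb, h.tail_deriv_spherePoint_zero]
  rw [direction_eq_pole_iff, h1, norm_smul, norm_axis, mul_one,
    Real.norm_of_nonneg (inv_pos.2 h.pos).le]⟩

theorem continuous_dirEmb {Y : Type*} [TopologicalSpace Y] {μ : Y → ℝ} {u : Y → ℝ → E (m + 1)}
    (h : ∀ y, IsModel (μ y) (u y)) (hμ : Continuous μ) (hu : SmoothFamOn u univ) :
    Continuous fun y => (h y).dirEmb := by
  refine continuous_induced_rng.2 (continuous_induced_rng.2 (continuous_emb_iff.2 ?_))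
  change SmoothFamOn (fun y => angular (h y).emb.1) univ
  simp only [IsModel.angular_emb]
  exact ((SmoothFamOn.const isOpen_univ hμ).prodMk isOpen_univ
    (hu.prodMk isOpen_univ (.id isOpen_univ))).comp isOpen_univ
    (Φ := fun q : ℝ × E (m + 1) × ℝ => spherePoint q.1 q.2.1 q.2.2)
    fun p _ => contDiffAt_spherePoint (h p.1).pos _ _

/-- A pointed embedding in stereographic coordinates, as a curve parametrised by the line. -/
def lineOf (f : DirEmb m) (x : ℝ) : E (m + 1) := stereo (angular f.1.1.1 (lineAngle x))

theorem angular_eq_pole_iff (f : DirEmb m) {t : ℝ} :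
    angular f.1.1.1 t = pole (m + 1) ↔ Real.sin (t / 2) = 0 := by
  rw [← exp_eq_one_iff_sin, ← (isSmoothEmb_circle_iff.1 f.1.1.2).2.2.eq_iff, Subtype.ext_iff]
  have h : f.1.1.1 1 = pole (m + 1) := f.1.2
  rw [h]
  rfl

theorem invStereo_lineOf (f : DirEmb m) (x : ℝ) :
    invStereo (lineOf f x) = angular f.1.1.1 (lineAngle x) :=
  invStereo_stereo (norm_angular _ _)
    fun h => (sin_lineAngle_div_two_pos x).ne' ((angular_eq_pole_iff f).1 h)

theorem lineOf_injective : Function.Injective (lineOf : DirEmb m → ℝ → E (m + 1)) := by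
  intro f g h
  refine Subtype.ext (Subtype.ext (Subtype.ext (funext fun z => Subtype.ext ?_)))
  by_cases hz : z = 1
  · rw [hz, f.1.2, g.1.2]
  · obtain ⟨x, rfl⟩ := exists_lineAngle hz
    exact (invStereo_lineOf f x).symm.trans ((congrArg invStereo (congrFun h x)).trans
      (invStereo_lineOf g x))

theorem IsModel.lineOf_dirEmb (h : IsModel μ u) : lineOf h.dirEmb = line μ u := by
  funext x
  have h1 : angular h.dirEmb.1.1.1 (lineAngle x) = invStereo (line μ u x) :=
    (congrFun h.angular_emb (lineAngle x)).trans (spherePoint_lineAngle μ u x)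
  rw [lineOf, h1, stereo_invStereo]

end Model

/-! ### The perturbation of the axis described by a pointed knot -/

section Pert

variable {m : ℕ}

theorem isModel_zero : IsModel 1 (fun _ : ℝ => (0 : E (m + 1))) := by
  have h : line 1 (fun _ => (0 : E (m + 1))) = fun x => x • axis m := by
    funext x; simp [line]
  have h0 : axis m ≠ 0 := norm_ne_zero_iff.1 (by rw [norm_axis]; exact one_ne_zero)
  refine ⟨one_pos, contDiff_const, fun _ => rfl, ?_, fun x => ?_⟩
  · rw [h]
    exact smul_left_injective ℝ h0
  · have h1 : HasDerivAt (fun x : ℝ => x • axis m) ((1 : ℝ) • axis m) x :=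
      (hasDerivAt_id x).smul_const _
    rwa [h, h1.deriv, one_smul]

/-- The standard great circle through the base point. -/
def stdCircle (m : ℕ) : DirEmb m := isModel_zero.dirEmb

theorem angular_stdCircle (t : ℝ) :
    angular (stdCircle m).1.1.1 t = spherePoint 1 (0 : E (m + 1)) t :=
  congrFun isModel_zero.angular_emb t

/-- The speed of a pointed embedding at the base point. -/
def speed (f : DirEmb m) : ℝ := ‖velocity f.1‖

theorem speed_pos (f : DirEmb m) : 0 < speed f := norm_pos_iff.2 (velocity_ne_zero f.1)

theorem continuous_speed : Continuous (speed : DirEmb m → ℝ) :=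
  (continuous_velocity.comp continuous_subtype_val).norm

/-- The curve of an element of `DirEmb`. -/
def crv (f : DirEmb m) : ℝ → E (m + 2) := angular f.1.1.1

theorem smoothFamOn_crv : SmoothFamOn (crv : DirEmb m → ℝ → E (m + 2)) univ :=
  smoothFamOn_angular.reparam isOpen_univ
    (continuous_subtype_val.comp continuous_subtype_val) (.id isOpen_univ) fun _ _ => trivial

theorem periodic_crv (f : DirEmb m) : Function.Periodic (crv f) (2 * Real.pi) := fun t => by
  rw [crv, angular, angular, Circle.exp_add, Circle.exp_two_pi, mul_one]

theorem deriv_crv_zero (f : DirEmb m) : deriv (crv f) 0 = consL (0, speed f • axis m) := by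
  have h := deriv_angular_zero f.1
  rw [direction_eq_pole_iff.1 f.2] at h
  exact h

/-- The difference quotient `(f(t) - f(0)) / t`. -/
def quot₁ : DirEmb m → ℝ → E (m + 2) := quot crv

/-- The second order difference quotient `(f(t) - f(0) - t f'(0)) / t²`. -/
def quot₂ : DirEmb m → ℝ → E (m + 2) := quot quot₁

theorem smul_quot₁ (f : DirEmb m) (t : ℝ) : t • quot₁ f t = crv f t - pole (m + 1) := by
  have h : crv f 0 = pole (m + 1) := angular_zero f.1
  rw [← h]
  exact smoothFamOn_crv.smul_quot f t

theorem quot₁_eq (f : DirEmb m) (t : ℝ) :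
    quot₁ f t = consL (0, speed f • axis m) + t • quot₂ f t := by
  have h : quot₁ f 0 = consL (0, speed f • axis m) := by
    rw [quot₁, quot_zero, deriv_crv_zero]
  exact (eq_add_of_sub_eq ((SmoothFamOn.quot smoothFamOn_crv).smul_quot f t).symm).trans
    ((add_comm _ _).trans (congrArg (· + t • quot₂ f t) h))

theorem quot₁_ne_zero (f : DirEmb m) {t : ℝ} (ht : |t| < 2 * Real.pi) : quot₁ f t ≠ 0 := by
  rcases eq_or_ne t 0 with rfl | h0
  · intro h
    rw [quot₁_eq, zero_smul, add_zero] at h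
    have h1 := congrArg (fun v => ‖tail v‖) h
    simp only [tail_consL, norm_smul, norm_axis, mul_one, map_zero, norm_zero,
      Real.norm_of_nonneg (speed_pos f).le] at h1
    exact (speed_pos f).ne' h1
  · intro h
    have h1 := smul_quot₁ f t
    rw [h, smul_zero, eq_comm, sub_eq_zero] at h1
    obtain ⟨k, hk⟩ := Circle.exp_eq_one.1 (exp_eq_one_iff_sin.2 ((angular_eq_pole_iff f).1 h1))
    rw [hk, abs_mul, abs_of_pos Real.two_pi_pos] at ht
    have h2 : |(k : ℝ)| < 1 := by
      by_contra h3
      nlinarith [Real.pi_pos]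
    have h3 : k = 0 := by
      rw [← Int.cast_abs] at h2
      exact Int.abs_lt_one_iff.1 (by exact_mod_cast h2)
    rw [h3] at hk
    simp at hk
    exact h0 hk

/-- The part of the stereographic coordinate of `f` that stays bounded at the base point; the
singular part is `2 e / (speed f * t)`. -/
def regPart (f : DirEmb m) (t : ℝ) : E (m + 1) :=
  (2 * (speed f * ‖quot₁ f t‖ ^ 2)⁻¹) • (speed f • tail (quot₂ f t) -
    (2 * speed f * tail (quot₂ f t) 0 + t * ‖quot₂ f t‖ ^ 2) • axis m)

theorem norm_sq_quot₁ (f : DirEmb m) (t : ℝ) : ‖quot₁ f t‖ ^ 2 =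
    speed f ^ 2 + 2 * (t * (speed f * tail (quot₂ f t) 0)) + t ^ 2 * ‖quot₂ f t‖ ^ 2 := by
  rw [quot₁_eq, norm_add_sq_real, norm_sq_eq_tail (consL _), norm_smul, inner_smul_right]
  have h : inner ℝ (consL (0, speed f • axis m)) (quot₂ f t) = speed f * tail (quot₂ f t) 0 := by
    conv_lhs => rw [smul_axis]
    simp [PiLp.inner_apply, Fin.sum_univ_succ, mul_comm]
  rw [h, consL_zero, tail_consL, norm_smul, norm_axis, mul_pow, Real.norm_eq_abs, sq_abs,
    Real.norm_eq_abs, mul_pow |t|, sq_abs]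
  ring

theorem stereo_crv_eq (f : DirEmb m) {t : ℝ} (h0 : t ≠ 0) (ht : |t| < 2 * Real.pi) :
    stereo (crv f t) = (2 / (speed f * t)) • axis m + regPart f t := by
  have hN : ‖quot₁ f t‖ ^ 2 ≠ 0 := pow_ne_zero 2 (norm_ne_zero_iff.2 (quot₁_ne_zero f ht))
  have hs := (speed_pos f).ne'
  have h1 : crv f t = pole (m + 1) + t • quot₁ f t := by rw [smul_quot₁, add_sub_cancel]
  have h2 : tail (crv f t) = t • (speed f • axis m + t • tail (quot₂ f t)) := by
    have h3 : tail ((pole (m + 1) : Sph (m + 1)) : E (m + 2)) = 0 := by ext i; simp [pole]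
    rw [h1, map_add, h3, zero_add, map_smul, quot₁_eq, map_add, tail_consL, map_smul]
  have h4 : 1 - crv f t 0 = t ^ 2 * ‖quot₁ f t‖ ^ 2 / 2 := by
    have h5 : ‖t • quot₁ f t‖ ^ 2 = 2 - 2 * crv f t 0 := by
      rw [smul_quot₁, norm_sub_sq_real, norm_sph, crv, norm_angular]
      simp [pole, EuclideanSpace.inner_single_right]
      ring
    rw [norm_smul, mul_pow, Real.norm_eq_abs, sq_abs] at h5
    linarith
  rw [stereo, h4, h2, regPart, smul_smul]
  have h6 := norm_sq_quot₁ f t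
  set N := ‖quot₁ f t‖ ^ 2
  ext i
  simp only [PiLp.add_apply, PiLp.sub_apply, PiLp.smul_apply, smul_eq_mul]
  field_simp
  rw [h6]
  ring

theorem stereo_crv_stdCircle {t : ℝ} (ht : Real.sin (t / 2) ≠ 0) :
    stereo (crv (stdCircle m) t) = cotHalf t • axis m := by
  rw [crv, angular_stdCircle, spherePoint_of_sin_ne_zero _ _ ht, stereo_invStereo, one_mul, add_zero]

theorem speed_stdCircle : speed (stdCircle m) = 1 := by
  have h : velocity (stdCircle m).1 = (1 : ℝ)⁻¹ • axis m := by
    rw [velocity, ← isModel_zero.tail_deriv_spherePoint_zero]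
    exact congrArg (fun g => tail (deriv g 0)) isModel_zero.angular_emb
  rw [speed, h, norm_smul, norm_axis]
  norm_num

/-- The bounded part of the stereographic coordinate near the base point, relative to the standard
line. -/
def localPert (f : DirEmb m) (t : ℝ) : E (m + 1) :=
  regPart f t - (speed f)⁻¹ • regPart (stdCircle m) t

open Classical in
/-- The perturbation `u` in the stereographic coordinate `μ cot (t / 2) e + u(t)` of a pointed
embedding, where `μ` is the inverse of the speed at the base point. -/
def pert (f : DirEmb m) (t : ℝ) : E (m + 1) :=
  if Real.sin (t / 2) = 0 then localPert f 0
  else stereo (crv f t) - ((speed f)⁻¹ * cotHalf t) • axis m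

theorem cotHalf_add_int_mul (t : ℝ) (k : ℤ) : cotHalf (t + k * (2 * Real.pi)) = cotHalf t := by
  have h : Function.Periodic cotHalf (2 * Real.pi) := fun t => by
    have h : (t + 2 * Real.pi) / 2 = t / 2 + Real.pi := by ring
    rw [cotHalf, cotHalf, h, Real.sin_add_pi, Real.cos_add_pi, neg_div_neg_eq]
  exact h.int_mul k t

theorem sin_half_add_int_mul (t : ℝ) (k : ℤ) :
    Real.sin ((t + k * (2 * Real.pi)) / 2) = 0 ↔ Real.sin (t / 2) = 0 := by
  have h : Circle.exp (t + k * (2 * Real.pi)) = Circle.exp t := Circle.exp_eq_exp.2 ⟨k, rfl⟩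
  rw [← exp_eq_one_iff_sin, ← exp_eq_one_iff_sin, h]

theorem pert_add_int_mul (f : DirEmb m) (t : ℝ) (k : ℤ) :
    pert f (t + k * (2 * Real.pi)) = pert f t := by
  simp only [pert, sin_half_add_int_mul, cotHalf_add_int_mul, (periodic_crv f).int_mul k t]

theorem periodic_pert (f : DirEmb m) : Function.Periodic (pert f) (2 * Real.pi) := fun t => by
  simpa using pert_add_int_mul f t 1

theorem sin_half_ne_zero {t : ℝ} (h0 : t ≠ 0) (ht : |t| < 2 * Real.pi) : Real.sin (t / 2) ≠ 0 := by
  have h := abs_lt.1 ht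
  rcases lt_or_gt_of_ne h0 with h1 | h1
  · exact (Real.sin_neg_of_neg_of_neg_pi_lt (by linarith) (by linarith)).ne
  · exact (Real.sin_pos_of_pos_of_lt_pi (by linarith) (by linarith)).ne'

theorem pert_eq_localPert (f : DirEmb m) {t : ℝ} (ht : |t| < 2 * Real.pi) :
    pert f t = localPert f t := by
  rcases eq_or_ne t 0 with rfl | h0
  · rw [pert, if_pos (by simp)]
  · have h1 := sin_half_ne_zero h0 ht
    have h2 := stereo_crv_eq (stdCircle m) h0 ht
    rw [stereo_crv_stdCircle h1, speed_stdCircle, one_mul] at h2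
    rw [pert, if_neg h1, stereo_crv_eq f h0 ht, localPert, mul_smul, h2, smul_add, smul_smul]
    have h3 : 2 / (speed f * t) = (speed f)⁻¹ * (2 / t) := by
      rw [div_mul_eq_div_div_swap, div_eq_inv_mul (2 / t)]
    rw [h3]
    abel

theorem isOpen_near (c r : ℝ) : IsOpen {p : DirEmb m × ℝ | |p.2 - c| < r} :=
  isOpen_lt (by fun_prop) continuous_const

theorem smoothFamOn_regPart :
    SmoothFamOn (regPart : DirEmb m → ℝ → E (m + 1)) {p | |p.2 - 0| < 2 * Real.pi} := by
  have hU := isOpen_near (m := m) 0 (2 * Real.pi)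
  have h1 : SmoothFamOn (quot₁ : DirEmb m → ℝ → E (m + 2)) {p | |p.2 - 0| < 2 * Real.pi} :=
    (SmoothFamOn.quot smoothFamOn_crv).mono (subset_univ _)
  have h2 : SmoothFamOn (quot₂ : DirEmb m → ℝ → E (m + 2)) {p | |p.2 - 0| < 2 * Real.pi} :=
    (SmoothFamOn.quot (SmoothFamOn.quot smoothFamOn_crv)).mono (subset_univ _)
  have hs : SmoothFamOn (fun (f : DirEmb m) _ => speed f) {p | |p.2 - 0| < 2 * Real.pi} :=
    .const hU continuous_speed
  have ht := h2.comp' hU (Φ := fun v => tail v) tail.contDiff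
  have h0 := ht.comp' hU (Φ := fun v : E (m + 1) => 2 * v 0)
    (contDiff_const.mul (contDiff_euclidean.1 contDiff_id 0))
  have hn1 := h1.comp' hU (Φ := fun v : E (m + 2) => ‖v‖ ^ 2) (contDiff_norm_sq ℝ)
  have hn2 := h2.comp' hU (Φ := fun v : E (m + 2) => ‖v‖ ^ 2) (contDiff_norm_sq ℝ)
  have hinv := (hs.mul hU hn1).inv hU fun p hp => mul_ne_zero (speed_pos p.1).ne'
    (pow_ne_zero 2 (norm_ne_zero_iff.2 (quot₁_ne_zero p.1 (by simpa using hp))))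
  have hc := (hs.mul hU h0).add hU ((SmoothFamOn.id hU).mul hU hn2)
  have := (hinv.comp' hU (Φ := fun x => 2 * x) (contDiff_const.mul contDiff_id)).smul hU
    ((hs.smul hU ht).sub hU (hc.smul hU (.const hU (c := fun _ => axis m) continuous_const)))
  refine this.congr hU fun p _ => ?_
  rw [regPart, ← mul_assoc (speed p.1) 2, mul_comm (speed p.1) 2]

theorem smoothFamOn_localPert :
    SmoothFamOn (localPert : DirEmb m → ℝ → E (m + 1)) {p | |p.2 - 0| < 2 * Real.pi} := by
  have hU := isOpen_near (m := m) 0 (2 * Real.pi)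
  refine smoothFamOn_regPart.sub hU ((SmoothFamOn.const hU (c := fun f => (speed f)⁻¹)
    (continuous_speed.inv₀ fun f => (speed_pos f).ne')).smul hU ?_)
  exact smoothFamOn_regPart.reparam hU (c := fun _ => stdCircle m) continuous_const (.id hU)
    fun p hp => hp

/-- The perturbation is smooth at the base point as well, since Hadamard's lemma divides the
singularity out. -/
theorem smoothFamOn_pert : SmoothFamOn (pert : DirEmb m → ℝ → E (m + 1)) univ := by
  refine .of_local fun p _ => ?_
  by_cases h0 : Real.sin (p.2 / 2) = 0
  · obtain ⟨k, hk⟩ := Circle.exp_eq_one.1 (exp_eq_one_iff_sin.2 h0)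
    have hU := isOpen_near (m := m) (k * (2 * Real.pi)) (2 * Real.pi)
    refine ⟨_, hU, by simp [hk, Real.pi_pos], ?_⟩
    refine (smoothFamOn_localPert.reparam hU (θ := fun _ t => t - k * (2 * Real.pi))
      continuous_id ?_ fun q hq => by simpa using hq).congr hU fun q hq => ?_
    · exact (SmoothFamOn.id hU).comp' hU (contDiff_id.sub contDiff_const)
    · have h := pert_add_int_mul q.1 (q.2 - k * (2 * Real.pi)) k
      rw [sub_add_cancel, pert_eq_localPert q.1 hq] at h
      exact h
  · have hU : IsOpen {q : DirEmb m × ℝ | Real.sin (q.2 / 2) ≠ 0} :=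
      isOpen_ne_fun (by fun_prop) continuous_const
    refine ⟨_, hU, h0, ?_⟩
    have hcot : SmoothFamOn (fun (_ : DirEmb m) t => cotHalf t)
        {q : DirEmb m × ℝ | Real.sin (q.2 / 2) ≠ 0} :=
      (SmoothFamOn.of_contDiff hU (Real.contDiff_cos.comp (contDiff_id.div_const 2))).div hU
        (SmoothFamOn.of_contDiff hU (Real.contDiff_sin.comp (contDiff_id.div_const 2)))
        fun q hq => hq
    have hst : SmoothFamOn (fun (f : DirEmb m) t => stereo (crv f t))
        {q : DirEmb m × ℝ | Real.sin (q.2 / 2) ≠ 0} :=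
      (smoothFamOn_crv.mono (subset_univ _)).comp hU fun q hq =>
        contDiffAt_stereo (apply_zero_lt_one (norm_angular _ _)
          fun h => hq ((angular_eq_pole_iff q.1).1 h)).ne
    refine (hst.sub hU ((((SmoothFamOn.const hU (c := fun f => (speed f)⁻¹) (continuous_speed.inv₀ fun f =>
      (speed_pos f).ne')).mul hU hcot).smul hU
        (.const hU (c := fun _ => axis m) continuous_const)))).congr hU fun q hq => ?_
    rw [pert, if_neg hq]

theorem lineAngle_injOn {x y : ℝ} (h : Circle.exp (lineAngle x) = Circle.exp (lineAngle y)) :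
    lineAngle x = lineAngle y := by
  have hx := lineAngle_mem x
  have hy := lineAngle_mem y
  obtain ⟨k, hk⟩ := Circle.exp_eq_exp.1 h
  have h1 : (-1 : ℝ) < k := by nlinarith [hx.1, hx.2, hy.1, hy.2, Real.pi_pos]
  have h2 : (k : ℝ) < 1 := by nlinarith [hx.1, hx.2, hy.1, hy.2, Real.pi_pos]
  have h3 : k = 0 := by
    have h1 : -1 < k := by exact_mod_cast h1
    have h2 : k < 1 := by exact_mod_cast h2
    omega
  rw [hk, h3]; simp

theorem line_pert (f : DirEmb m) : line (speed f)⁻¹ (pert f) = lineOf f := by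
  funext x
  rw [line, pert, if_neg (sin_lineAngle_div_two_pos x).ne', cotHalf_lineAngle, lineOf, crv,
    add_sub_cancel]

theorem isModel_pert (f : DirEmb m) : IsModel (speed f)⁻¹ (pert f) where
  pos := inv_pos.2 (speed_pos f)
  contDiff := smoothFamOn_pert.contDiff f
  periodic := periodic_pert f
  injective x y h := by
    rw [line_pert] at h
    have h1 := congrArg invStereo h
    rw [invStereo_lineOf, invStereo_lineOf] at h1
    have h2 := (isSmoothEmb_circle_iff.1 f.1.1.2).2.2 (Subtype.ext h1)
    have h3 := congrArg cotHalf (lineAngle_injOn h2)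
    rwa [cotHalf_lineAngle, cotHalf_lineAngle] at h3
  deriv_ne_zero x h := by
    have h1 : ContDiff ℝ ∞ (line (speed f)⁻¹ (pert f)) :=
      ((contDiff_const.mul contDiff_id).smul contDiff_const).add
        ((smoothFamOn_pert.contDiff f).comp contDiff_lineAngle)
    have h2 := (h1.differentiable (by simp) x).hasDerivAt
    rw [h, line_pert] at h2
    have h3 := (contDiff_invStereo.differentiable (by simp) (lineOf f x)).hasFDerivAt.comp_hasDerivAt
      x h2
    have h4 : invStereo ∘ lineOf f = fun x => crv f (lineAngle x) := funext (invStereo_lineOf f)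
    rw [h4, map_zero] at h3
    have h5 := (f.1.1.contDiff.differentiable (by simp) (lineAngle x)).hasDerivAt.scomp x
      (hasDerivAt_lineAngle x)
    have h6 := h5.unique h3
    rw [smul_eq_zero] at h6
    refine h6.elim (fun h7 => ?_) ((isSmoothEmb_circle_iff.1 f.1.1.2).2.1 _)
    have : 0 < 2 / (1 + x ^ 2) := by positivity
    linarith

end Pert

/-! ### Straightening a knot near the base point -/

section Damp

variable {m : ℕ}

/-- The `C¹` norm of a function of the angle over one period. -/
def circNorm {V : Type*} [NormedAddCommGroup V] [NormedSpace ℝ V] (u : ℝ → V) : ℝ :=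
  sSup ((fun t => ‖u t‖ + ‖deriv u t‖) '' Icc 0 (2 * Real.pi))

theorem norm_add_norm_deriv_le_circNorm {V : Type*} [NormedAddCommGroup V] [NormedSpace ℝ V]
    {u : ℝ → V} (hu : ContDiff ℝ ∞ u) (x : ℝ) :
    ‖u (lineAngle x)‖ + ‖deriv u (lineAngle x)‖ ≤ circNorm u :=
  le_csSup (isCompact_Icc.bddAbove_image
    ((hu.continuous.norm.add (hu.continuous_deriv (by simp)).norm).continuousOn))
    (mem_image_of_mem _ (Ioo_subset_Icc_self (lineAngle_mem x)))

theorem continuous_circNorm {Y : Type*} {V : Type} [TopologicalSpace Y] [NormedAddCommGroup V]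
    [NormedSpace ℝ V] {g : Y → ℝ → V} (hg : SmoothFamOn g univ) :
    Continuous fun y => circNorm (g y) :=
  isCompact_Icc.continuous_sSup (f := fun y t => ‖g y t‖ + ‖deriv (g y) t‖)
    (hg.continuous.norm.add hg.deriv.continuous.norm)

theorem circNorm_nonneg {V : Type*} [NormedAddCommGroup V] [NormedSpace ℝ V]
    {u : ℝ → V} (hu : ContDiff ℝ ∞ u) : 0 ≤ circNorm u :=
  le_trans (by positivity) (norm_add_norm_deriv_le_circNorm hu 0)

/-- A cutoff function of the angle, which is `1` where the stereographic coordinate `x` satisfies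
`|x| ≥ 1` and `0` where `|x| ≤ 1 / 2`: the cosine of the angle is `0` at `x = 1` and `-3 / 5` at
`x = 1 / 2`. -/
def cutoff (t : ℝ) : ℝ := Real.smoothTransition (1 + 5 / 3 * Real.cos t)

theorem contDiff_cutoff : ContDiff ℝ ∞ cutoff :=
  (Real.smoothTransition.contDiff (n := ⊤)).comp
    (contDiff_const.add (contDiff_const.mul Real.contDiff_cos))

theorem cutoff_add_two_pi (t : ℝ) : cutoff (t + 2 * Real.pi) = cutoff t := by
  rw [cutoff, Real.cos_add_two_pi, cutoff]

theorem cutoff_lineAngle_of_one_le {x : ℝ} (hx : 1 ≤ |x|) : cutoff (lineAngle x) = 1 := by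
  rw [cutoff, cos_lineAngle]
  have h : 1 ≤ x ^ 2 := by rw [← sq_abs]; nlinarith
  refine Real.smoothTransition.one_of_one_le ?_
  have : 0 ≤ (x ^ 2 - 1) / (x ^ 2 + 1) := div_nonneg (by linarith) (by positivity)
  linarith

theorem cutoff_lineAngle_of_le {x : ℝ} (hx : |x| ≤ 1 / 2) : cutoff (lineAngle x) = 0 := by
  rw [cutoff, cos_lineAngle]
  have h : x ^ 2 ≤ 1 / 4 := by rw [← sq_abs]; nlinarith [abs_nonneg x]
  refine Real.smoothTransition.zero_of_nonpos ?_
  have : (x ^ 2 - 1) / (x ^ 2 + 1) ≤ -(3 / 5) := by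
    rw [div_le_iff₀ (by positivity)]; linarith
  linarith

theorem cutoff_mem (t : ℝ) : cutoff t ∈ Icc (0 : ℝ) 1 :=
  ⟨Real.smoothTransition.nonneg _, Real.smoothTransition.le_one _⟩

/-- The perturbation `u`, dilated by `a` in the source and by `b⁻¹` in the target, and damped by the
factor `1 - σ` outside of the unit interval. -/
def damped (σ a b : ℝ) (u : ℝ → E (m + 1)) (t : ℝ) : E (m + 1) :=
  (1 - σ * cutoff t) • (b⁻¹ • u (dilate a t))

theorem line_damped (μ σ : ℝ) {a : ℝ} (ha : 0 < a) (b : ℝ) (u : ℝ → E (m + 1)) (x : ℝ) :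
    line μ (damped σ a b u) x =
      (μ * x) • axis m + (1 - σ * cutoff (lineAngle x)) • b⁻¹ • u (lineAngle (a * x)) := by
  rw [line, damped, dilate_lineAngle ha]

theorem contDiff_dilate {a : ℝ} (ha : 0 < a) : ContDiff ℝ ∞ (dilate a) :=
  (smoothFamOn_dilate (Y := Unit) (a := fun _ => a) continuous_const fun _ => ha).contDiff ()

variable {μ : ℝ} {u : ℝ → E (m + 1)}

theorem IsModel.contDiff_damped (h : IsModel μ u) (σ : ℝ) {a : ℝ} (ha : 0 < a) (b : ℝ) :
    ContDiff ℝ ∞ (damped σ a b u) :=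
  (contDiff_const.sub (contDiff_const.mul contDiff_cutoff)).smul
    ((h.contDiff.comp (contDiff_dilate ha)).const_smul b⁻¹)

theorem IsModel.periodic_damped (h : IsModel μ u) (σ a b : ℝ) :
    Function.Periodic (damped σ a b u) (2 * Real.pi) := fun t => by
  rw [damped, damped, cutoff_add_two_pi, dilate_add_two_pi, h.periodic]

theorem IsModel.contDiff_line (h : IsModel μ u) : ContDiff ℝ ∞ (line μ u) :=
  ((contDiff_const.mul contDiff_id).smul contDiff_const).add (h.contDiff.comp contDiff_lineAngle)

theorem IsModel.damped_zero (h : IsModel μ u) {a b : ℝ} (ha : 0 < a) (hb : 0 < b) :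
    IsModel (μ * a / b) (damped 0 a b u) := by
  have key : line (μ * a / b) (damped 0 a b u) = fun x => b⁻¹ • line μ u (a * x) := by
    funext x
    rw [line_damped _ _ ha, line, zero_mul, sub_zero, one_smul, smul_add, smul_smul]
    congr 2
    ring
  refine ⟨div_pos (mul_pos h.pos ha) hb, h.contDiff_damped 0 ha b, h.periodic_damped 0 a b, ?_,
    fun x => ?_⟩
  · rw [key]
    intro x y hxy
    exact mul_left_cancel₀ ha.ne' (h.injective (smul_right_injective _ (inv_pos.2 hb).ne' hxy))
  · have h1 := (h.contDiff_line.differentiable (by simp) (a * x)).hasDerivAt.scomp x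
      ((hasDerivAt_id x).const_mul a)
    have h2 : deriv (fun x => b⁻¹ • line μ u (a * x)) x = _ := (h1.const_smul b⁻¹).deriv
    rw [key, h2, mul_one]
    exact smul_ne_zero (inv_pos.2 hb).ne' (smul_ne_zero ha.ne' (h.deriv_ne_zero _))

/-- A dilation factor large enough for the damping to preserve embeddings. The coefficient `16` makes
the dilated perturbation at most `1 / 16`, and the other two make the derivative of the damped
perturbation at most `1 / 2` where `|x| ≥ 1 / 4`. -/
def safeScale (μ : ℝ) (u : ℝ → E (m + 1)) : ℝ :=
  1 + (16 + 4 * circNorm cutoff + 64 * μ) * circNorm u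

theorem IsModel.one_le_safeScale (h : IsModel μ u) : 1 ≤ safeScale μ u := by
  have := circNorm_nonneg h.contDiff
  have := circNorm_nonneg contDiff_cutoff
  have := h.pos
  rw [safeScale]
  exact le_add_of_nonneg_right (by positivity)

/-- The dilated and damped perturbation, as a function of the stereographic coordinate. -/
def dampedOffset (μ σ : ℝ) (u : ℝ → E (m + 1)) (x : ℝ) : E (m + 1) :=
  damped σ (safeScale μ u / μ) (safeScale μ u) u (lineAngle x)

theorem IsModel.dampedOffset_eq (h : IsModel μ u) (σ x : ℝ) : dampedOffset μ σ u x =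
    (1 - σ * cutoff (lineAngle x)) •
      (safeScale μ u)⁻¹ • u (lineAngle (safeScale μ u / μ * x)) := by
  have := h.one_le_safeScale
  rw [dampedOffset, damped, dilate_lineAngle (div_pos (by linarith) h.pos)]

theorem one_sub_mul_cutoff_mem {σ : ℝ} (hσ : σ ∈ Icc (0 : ℝ) 1) (t : ℝ) :
    1 - σ * cutoff t ∈ Icc (0 : ℝ) 1 := by
  have h := cutoff_mem t
  constructor <;> nlinarith [hσ.1, hσ.2, h.1, h.2, mul_nonneg hσ.1 h.1, mul_le_one₀ hσ.2 h.1 h.2]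

theorem IsModel.norm_dampedOffset_le (h : IsModel μ u) {σ : ℝ} (hσ : σ ∈ Icc (0 : ℝ) 1) (x : ℝ) :
    ‖dampedOffset μ σ u x‖ ≤ 1 / 16 := by
  have hR := h.one_le_safeScale
  have hR0 : 0 < safeScale μ u := by linarith
  have hc := one_sub_mul_cutoff_mem hσ (lineAngle x)
  have h1 := norm_add_norm_deriv_le_circNorm h.contDiff (safeScale μ u / μ * x)
  have hC := circNorm_nonneg h.contDiff
  have hM := circNorm_nonneg contDiff_cutoff
  rw [h.dampedOffset_eq, norm_smul, norm_smul, norm_inv, Real.norm_of_nonneg hc.1,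
    Real.norm_of_nonneg hR0.le]
  have h2 : (safeScale μ u)⁻¹ * ‖u (lineAngle (safeScale μ u / μ * x))‖ ≤ 1 / 16 := by
    rw [inv_mul_le_iff₀ hR0]
    have h3 : ‖u (lineAngle (safeScale μ u / μ * x))‖ ≤ circNorm u :=
      le_trans (le_add_of_nonneg_right (norm_nonneg _)) h1
    have h4 : 16 * circNorm u ≤ safeScale μ u := by
      rw [safeScale]
      nlinarith [mul_nonneg hM hC, mul_nonneg h.pos.le hC]
    linarith
  calc _ ≤ 1 * (1 / 16) := mul_le_mul hc.2 h2 (by positivity) zero_le_one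
    _ = _ := one_mul _

theorem hasDerivAt_comp_lineAngle {V : Type*} [NormedAddCommGroup V] [NormedSpace ℝ V]
    {g : ℝ → V} (hg : ContDiff ℝ ∞ g) (x : ℝ) : HasDerivAt (fun x => g (lineAngle x))
      (-(2 / (1 + x ^ 2)) • deriv g (lineAngle x)) x :=
  (hg.differentiable (by simp) (lineAngle x)).hasDerivAt.scomp x (hasDerivAt_lineAngle x)

theorem IsModel.differentiable_dampedOffset (h : IsModel μ u) (σ : ℝ) :
    Differentiable ℝ (dampedOffset μ σ u) := by
  have hR := h.one_le_safeScale
  exact ((h.contDiff_damped σ (div_pos (by linarith) h.pos) _).comp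
    contDiff_lineAngle).differentiable (by simp)

/-- After the dilation, the perturbation varies slowly away from the origin, since the derivative of
the angle decays quadratically. -/
theorem IsModel.norm_deriv_dampedOffset_le (h : IsModel μ u) {σ : ℝ} (hσ : σ ∈ Icc (0 : ℝ) 1)
    {x : ℝ} (hx : 1 / 4 ≤ |x|) : ‖deriv (dampedOffset μ σ u) x‖ ≤ 1 / 2 := by
  have hR := h.one_le_safeScale
  have hC := circNorm_nonneg h.contDiff
  have hM := circNorm_nonneg contDiff_cutoff
  have hμ := h.pos
  have hR' : 4 * circNorm cutoff * circNorm u + 64 * μ * circNorm u ≤ safeScale μ u := by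
    rw [safeScale]; nlinarith
  have hfun : dampedOffset μ σ u = fun x => (1 - σ * cutoff (lineAngle x)) •
      (safeScale μ u)⁻¹ • u (lineAngle (safeScale μ u / μ * x)) := funext (h.dampedOffset_eq σ)
  set R := safeScale μ u
  have hR0 : 0 < R := by linarith
  have h1 := norm_add_norm_deriv_le_circNorm h.contDiff (R / μ * x)
  have h2 := norm_add_norm_deriv_le_circNorm contDiff_cutoff x
  have hd1 := ((hasDerivAt_comp_lineAngle contDiff_cutoff x).const_mul σ).const_sub 1
  have hd2 : HasDerivAt (fun x => R⁻¹ • u (lineAngle (R / μ * x))) (R⁻¹ • (R / μ) •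
      (-(2 / (1 + (R / μ * x) ^ 2)) • deriv u (lineAngle (R / μ * x)))) x := by
    have := (hasDerivAt_comp_lineAngle h.contDiff (R / μ * x)).scomp x
      ((hasDerivAt_id x).const_mul (R / μ))
    rw [mul_one] at this
    exact this.const_smul R⁻¹
  have hc := one_sub_mul_cutoff_mem hσ (lineAngle x)
  have hd : deriv (fun x => (1 - σ * cutoff (lineAngle x)) • R⁻¹ • u (lineAngle (R / μ * x))) x =
    _ := (hd1.smul hd2).deriv
  rw [hfun, hd]
  set U := ‖u (lineAngle (R / μ * x))‖
  set U' := ‖deriv u (lineAngle (R / μ * x))‖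
  have hU : U ≤ circNorm u := le_trans (le_add_of_nonneg_right (norm_nonneg _)) h1
  have hU' : U' ≤ circNorm u := le_trans (le_add_of_nonneg_left (norm_nonneg _)) h1
  have hP : ‖deriv cutoff (lineAngle x)‖ ≤ circNorm cutoff :=
    le_trans (le_add_of_nonneg_left (norm_nonneg _)) h2
  have hq : 2 / (1 + (R / μ * x) ^ 2) ≤ 32 * μ ^ 2 / R ^ 2 := by
    rw [div_le_div_iff₀ (by positivity) (by positivity)]
    have hx2 : 1 / 16 ≤ x ^ 2 := by rw [← sq_abs]; nlinarith
    have : μ ^ 2 * (R / μ * x) ^ 2 = R ^ 2 * x ^ 2 := by field_simp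
    nlinarith [mul_le_mul_of_nonneg_left hx2 (sq_nonneg R), sq_nonneg μ]
  have hA : ‖(1 - σ * cutoff (lineAngle x)) • R⁻¹ • (R / μ) •
      (-(2 / (1 + (R / μ * x) ^ 2)) • deriv u (lineAngle (R / μ * x)))‖ ≤
        R⁻¹ * (32 * μ * circNorm u) := by
    rw [norm_smul, norm_smul, norm_smul, norm_smul, norm_neg, Real.norm_of_nonneg hc.1,
      Real.norm_of_nonneg (inv_pos.2 hR0).le, Real.norm_of_nonneg (div_pos hR0 hμ).le,
      Real.norm_of_nonneg (by positivity : 0 ≤ 2 / (1 + (R / μ * x) ^ 2))]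
    have hB : R / μ * (2 / (1 + (R / μ * x) ^ 2) * U') ≤ 32 * μ * circNorm u := by
      calc _ ≤ R / μ * (32 * μ ^ 2 / R ^ 2 * circNorm u) := by gcongr
        _ = 32 * μ * circNorm u / R := by field_simp
        _ ≤ 32 * μ * circNorm u := div_le_self (by positivity) hR
    calc _ ≤ 1 * (R⁻¹ * (32 * μ * circNorm u)) :=
        mul_le_mul hc.2 (mul_le_mul_of_nonneg_left hB (by positivity)) (by positivity) zero_le_one
      _ = _ := one_mul _
  have hB : ‖(-(σ * (-(2 / (1 + x ^ 2)) • deriv cutoff (lineAngle x)))) •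
      R⁻¹ • u (lineAngle (R / μ * x))‖ ≤ R⁻¹ * (2 * circNorm cutoff * circNorm u) := by
    have h3 : 2 / (1 + x ^ 2) ≤ 2 := div_le_self zero_le_two (by nlinarith [sq_nonneg x])
    rw [norm_smul, norm_smul, norm_neg, norm_mul, norm_smul, norm_neg, Real.norm_of_nonneg hσ.1,
      Real.norm_of_nonneg (by positivity : 0 ≤ 2 / (1 + x ^ 2)),
      Real.norm_of_nonneg (inv_pos.2 hR0).le, mul_left_comm]
    refine mul_le_mul_of_nonneg_left ?_ (by positivity)
    calc _ ≤ 1 * (2 * circNorm cutoff) * circNorm u := by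
          gcongr
          exact hσ.2
      _ = _ := by ring
  refine (norm_add_le_of_le hA hB).trans ?_
  rw [← mul_add, inv_mul_le_iff₀ hR0]
  linarith

/-- Where the perturbation is undamped, injectivity and immersivity are inherited from the original
curve, elsewhere they hold because the perturbation is a contraction. -/
theorem IsModel.damped_one (h : IsModel μ u) {σ : ℝ} (hσ : σ ∈ Icc (0 : ℝ) 1) :
    IsModel 1 (damped σ (safeScale μ u / μ) (safeScale μ u) u) := by
  have hR0 : 0 < safeScale μ u := by linarith [h.one_le_safeScale]
  have ha : 0 < safeScale μ u / μ := div_pos hR0 h.pos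
  have hline : line 1 (damped σ (safeScale μ u / μ) (safeScale μ u) u) =
      fun x => x • axis m + dampedOffset μ σ u x := by
    funext x; rw [line, one_mul, dampedOffset]
  have h0 := h.damped_zero ha hR0
  have hμ : μ * (safeScale μ u / μ) / safeScale μ u = 1 := by
    have := h.pos
    field_simp
  rw [hμ] at h0
  have hin : ∀ x : ℝ, |x| ≤ 1 / 2 → line 1 (damped σ (safeScale μ u / μ) (safeScale μ u) u) x =
      line 1 (damped 0 (safeScale μ u / μ) (safeScale μ u) u) x := fun x hx => by
    rw [line_damped _ _ ha, line_damped _ _ ha, cutoff_lineAngle_of_le hx, mul_zero, mul_zero]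
  have hcontr : ∀ s : Set ℝ, Convex ℝ s → (∀ x ∈ s, 1 / 4 ≤ |x|) → ∀ x ∈ s, ∀ y ∈ s,
      x • axis m + dampedOffset μ σ u x = y • axis m + dampedOffset μ σ u y → x = y := by
    intro s hs hs4 x hx y hy hxy
    have h1 := hs.norm_image_sub_le_of_norm_deriv_le
      (fun z _ => h.differentiable_dampedOffset σ z)
      (fun z hz => h.norm_deriv_dampedOffset_le hσ (hs4 z hz)) hx hy
    have h2 : (x - y) • axis m = dampedOffset μ σ u y - dampedOffset μ σ u x := by
      rw [sub_smul, sub_eq_sub_iff_add_eq_add, hxy, add_comm (_ • _)]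
    rw [← h2, norm_smul, norm_axis, mul_one, norm_sub_rev] at h1
    have h3 := norm_nonneg (y - x)
    exact (sub_eq_zero.1 (norm_eq_zero.1 (by linarith))).symm
  refine ⟨one_pos, h.contDiff_damped σ ha _, h.periodic_damped _ _ _, ?_, fun x => ?_⟩
  · -- The perturbation moves points by at most `1 / 16`, so `x` and `y` are on the same side of the
    -- origin and in the region where it is a contraction.
    have main : ∀ x y : ℝ, 1 / 2 < |x| →
        x • axis m + dampedOffset μ σ u x = y • axis m + dampedOffset μ σ u y → x = y := by
      intro x y hx hxy
      have h2 : (x - y) • axis m = dampedOffset μ σ u y - dampedOffset μ σ u x := by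
        rw [sub_smul, sub_eq_sub_iff_add_eq_add, hxy, add_comm (_ • _)]
      have h3 := norm_sub_le (dampedOffset μ σ u y) (dampedOffset μ σ u x)
      rw [← h2, norm_smul, norm_axis, mul_one, Real.norm_eq_abs] at h3
      have h4 : |x - y| ≤ 1 / 8 := by
        linarith [h.norm_dampedOffset_le hσ x, h.norm_dampedOffset_le hσ y]
      have h5 := abs_le.1 h4
      rcases lt_abs.1 hx with h6 | h6
      · exact hcontr (Ici (1 / 4)) (convex_Ici _) (fun z hz => le_abs.2 (Or.inl hz)) x
          (mem_Ici.2 (by linarith)) y (mem_Ici.2 (by linarith)) hxy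
      · exact hcontr (Iic (-(1 / 4))) (convex_Iic _)
          (fun z hz => le_abs.2 (Or.inr (by linarith [mem_Iic.1 hz]))) x
          (mem_Iic.2 (by linarith)) y (mem_Iic.2 (by linarith)) hxy
    intro x y hxy
    rcases le_or_gt |x| (1 / 2) with hx | hx
    · rcases le_or_gt |y| (1 / 2) with hy | hy
      · rw [hin x hx, hin y hy] at hxy
        exact h0.injective hxy
      · rw [hline] at hxy
        exact (main y x hy hxy.symm).symm
    · rw [hline] at hxy
      exact main x y hx hxy
  · rcases lt_or_ge |x| (1 / 2) with hx | hx
    · have h1 : line 1 (damped σ (safeScale μ u / μ) (safeScale μ u) u) =ᶠ[𝓝 x]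
          line 1 (damped 0 (safeScale μ u / μ) (safeScale μ u) u) :=
        (continuous_abs.continuousAt.eventually (gt_mem_nhds hx)).mono fun y hy => hin y hy.le
      rw [h1.deriv_eq]
      exact h0.deriv_ne_zero x
    · have h1 : deriv (fun x => x • axis m + dampedOffset μ σ u x) x =
          (1 : ℝ) • axis m + deriv (dampedOffset μ σ u) x :=
        (((hasDerivAt_id x).smul_const (axis m)).add
          (h.differentiable_dampedOffset σ x).hasDerivAt).deriv
      rw [hline, h1, one_smul]
      intro h2
      have h3 := congrArg norm (eq_neg_of_add_eq_zero_left h2)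
      rw [norm_axis, norm_neg] at h3
      linarith [h.norm_deriv_dampedOffset_le hσ (by linarith : 1 / 4 ≤ |x|)]

end Damp

/-! ### The deformation of pointed knots onto compactified long knots -/

section Deform

variable {m : ℕ}

theorem smoothFamOn_lineOf : SmoothFamOn (lineOf : DirEmb m → ℝ → E (m + 1)) univ :=
  (smoothFamOn_crv.reparam isOpen_univ (c := fun f => f) (θ := fun _ x => lineAngle x) continuous_id
    (.of_contDiff isOpen_univ contDiff_lineAngle) fun _ _ => trivial).comp isOpen_univ fun p _ =>
      contDiffAt_stereo (apply_zero_lt_one (norm_angular _ _)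
        fun h => (sin_lineAngle_div_two_pos p.2).ne' ((angular_eq_pole_iff p.1).1 h)).ne

theorem IsModel.speed_dirEmb {μ : ℝ} {u : ℝ → E (m + 1)} (h : IsModel μ u) :
    speed h.dirEmb = μ⁻¹ := by
  have h1 : velocity h.dirEmb.1 = μ⁻¹ • axis m := by
    rw [velocity, ← h.tail_deriv_spherePoint_zero]
    exact congrArg (fun g => tail (deriv g 0)) h.angular_emb
  rw [speed, h1, norm_smul, norm_axis, mul_one, Real.norm_of_nonneg (inv_pos.2 h.pos).le]

theorem pert_lineAngle (f : DirEmb m) (x : ℝ) :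
    pert f (lineAngle x) = lineOf f x - ((speed f)⁻¹ * x) • axis m := by
  rw [← line_pert, line, add_sub_cancel_left]

/-- The amount of dilation at time `s`. -/
def dilTime (s : unitInterval) : ℝ := min (2 * s) 1

/-- The amount of damping at time `s`. -/
def dampTime (s : unitInterval) : ℝ := max (2 * s - 1) 0

theorem dilTime_mem (s : unitInterval) : dilTime s ∈ Icc (0 : ℝ) 1 :=
  ⟨le_min (by linarith [s.2.1]) zero_le_one, min_le_right _ _⟩

theorem dampTime_mem (s : unitInterval) : dampTime s ∈ Icc (0 : ℝ) 1 :=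
  ⟨le_max_right _ _, max_le (by linarith [s.2.2]) zero_le_one⟩

theorem dampTime_eq_zero_or (s : unitInterval) : dampTime s = 0 ∨ dilTime s = 1 := by
  rcases le_total (2 * (s : ℝ)) 1 with h | h
  · exact Or.inl (max_eq_right (by linarith))
  · exact Or.inr (min_eq_right h)

/-- The dilation factor for a pointed embedding. -/
def knotScale (f : DirEmb m) : ℝ := safeScale (speed f)⁻¹ (pert f)

theorem one_le_knotScale (f : DirEmb m) : 1 ≤ knotScale f := (isModel_pert f).one_le_safeScale

theorem continuous_inv_speed : Continuous fun f : DirEmb m => (speed f)⁻¹ :=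
  continuous_speed.inv₀ fun f => (speed_pos f).ne'

theorem continuous_knotScale : Continuous (knotScale : DirEmb m → ℝ) :=
  continuous_const.add ((continuous_const.add (continuous_const.mul continuous_inv_speed)).mul
    (continuous_circNorm smoothFamOn_pert))

/-- The dilation factor in the source at time `s`. -/
def srcScale (s : unitInterval) (f : DirEmb m) : ℝ :=
  1 - dilTime s + dilTime s * (knotScale f / (speed f)⁻¹)

/-- The dilation factor in the target at time `s`. -/
def tgtScale (s : unitInterval) (f : DirEmb m) : ℝ := 1 - dilTime s + dilTime s * knotScale f

theorem interpolation_pos {t c : ℝ} (ht : t ∈ Icc (0 : ℝ) 1) (hc : 0 < c) : 0 < 1 - t + t * c := by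
  rcases ht.1.eq_or_lt with rfl | h
  · simp
  · have := mul_pos h hc
    linarith [ht.2]

theorem srcScale_pos (s : unitInterval) (f : DirEmb m) : 0 < srcScale s f :=
  interpolation_pos (dilTime_mem s)
    (div_pos (by linarith [one_le_knotScale f]) (inv_pos.2 (speed_pos f)))

theorem tgtScale_pos (s : unitInterval) (f : DirEmb m) : 0 < tgtScale s f :=
  interpolation_pos (dilTime_mem s) (by linarith [one_le_knotScale f])

theorem isModel_deform (s : unitInterval) (f : DirEmb m) :
    IsModel ((speed f)⁻¹ * srcScale s f / tgtScale s f)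
      (damped (dampTime s) (srcScale s f) (tgtScale s f) (pert f)) := by
  rcases dampTime_eq_zero_or s with h | h
  · rw [h]
    exact (isModel_pert f).damped_zero (srcScale_pos s f) (tgtScale_pos s f)
  · have h1 : srcScale s f = knotScale f / (speed f)⁻¹ := by rw [srcScale, h]; ring
    have h2 : tgtScale s f = knotScale f := by rw [tgtScale, h]; ring
    have h3 := one_le_knotScale f
    have h4 : (speed f)⁻¹ * (knotScale f / (speed f)⁻¹) / knotScale f = 1 := by
      rw [mul_div_cancel₀ _ (inv_pos.2 (speed_pos f)).ne', div_self (by linarith)]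
    rw [h1, h2, h4]
    exact (isModel_pert f).damped_one (dampTime_mem s)

/-- The deformation of a pointed embedding: its stereographic image is first shrunk, so that it
becomes close to a line away from the origin, and then its deviation from that line is damped. -/
def deform (s : unitInterval) (f : DirEmb m) : DirEmb m := (isModel_deform s f).dirEmb

theorem lineOf_deform (s : unitInterval) (f : DirEmb m) (x : ℝ) : lineOf (deform s f) x =
    ((speed f)⁻¹ * srcScale s f / tgtScale s f * x) • axis m +
      (1 - dampTime s * cutoff (lineAngle x)) • (tgtScale s f)⁻¹ •
        (lineOf f (srcScale s f * x) - ((speed f)⁻¹ * (srcScale s f * x)) • axis m) := by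
  rw [deform, IsModel.lineOf_dirEmb, line_damped _ _ (srcScale_pos s f), pert_lineAngle]

theorem continuous_deform : Continuous fun p : unitInterval × DirEmb m => deform p.1 p.2 := by
  have hd : Continuous fun p : unitInterval × DirEmb m => dilTime p.1 :=
    (continuous_const.mul (continuous_subtype_val.comp continuous_fst)).min continuous_const
  have hσ : Continuous fun p : unitInterval × DirEmb m => dampTime p.1 :=
    ((continuous_const.mul (continuous_subtype_val.comp continuous_fst)).sub
      continuous_const).max continuous_const
  have hk : Continuous fun p : unitInterval × DirEmb m => knotScale p.2 :=
    continuous_knotScale.comp continuous_snd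
  have hμ : Continuous fun p : unitInterval × DirEmb m => (speed p.2)⁻¹ :=
    continuous_inv_speed.comp continuous_snd
  have ha : Continuous fun p : unitInterval × DirEmb m => srcScale p.1 p.2 :=
    (continuous_const.sub hd).add
      (hd.mul (hk.div hμ fun p => (inv_pos.2 (speed_pos p.2)).ne'))
  have hb : Continuous fun p : unitInterval × DirEmb m => tgtScale p.1 p.2 :=
    (continuous_const.sub hd).add (hd.mul hk)
  have hc : Continuous fun p : unitInterval × DirEmb m =>
      (speed p.2)⁻¹ * srcScale p.1 p.2 / tgtScale p.1 p.2 :=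
    (hμ.mul ha).div hb fun p => (tgtScale_pos p.1 p.2).ne'
  refine continuous_dirEmb (fun p : unitInterval × DirEmb m => isModel_deform p.1 p.2) hc ?_
  have hU := isOpen_univ (X := (unitInterval × DirEmb m) × ℝ)
  have h1 : SmoothFamOn (fun (p : unitInterval × DirEmb m) t => pert p.2 (dilate (srcScale p.1 p.2) t))
      univ :=
    smoothFamOn_pert.reparam hU (c := Prod.snd) continuous_snd
      (smoothFamOn_dilate ha fun p => srcScale_pos p.1 p.2) fun _ _ => trivial
  exact ((SmoothFamOn.const hU continuous_const).sub hU ((SmoothFamOn.const hU hσ).mul hU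
    (.of_contDiff hU contDiff_cutoff))).smul hU ((SmoothFamOn.const hU
      (c := fun p : unitInterval × DirEmb m => (tgtScale p.1 p.2)⁻¹)
      (hb.inv₀ fun p => (tgtScale_pos p.1 p.2).ne')).smul hU h1)

theorem deform_zero (f : DirEmb m) : deform 0 f = f := by
  have h1 : dilTime 0 = 0 := by simp [dilTime]
  have h2 : dampTime 0 = 0 := by simp [dampTime]
  refine lineOf_injective (funext fun x => ?_)
  rw [lineOf_deform, srcScale, tgtScale, h1, h2]
  simp

/-- The pointed embedding is the compactification of a long knot. -/
def IsLong (f : DirEmb m) : Prop := ∀ x : ℝ, 1 ≤ |x| → lineOf f x = EuclideanSpace.single 0 x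

theorem isLong_deform_one (f : DirEmb m) : IsLong (deform 1 f) := fun x hx => by
  have h1 : dilTime 1 = 1 := by norm_num [dilTime]
  have h2 : dampTime 1 = 1 := by norm_num [dampTime]
  have h3 := one_le_knotScale f
  have h4 := (speed_pos f).ne'
  have h5 : (speed f)⁻¹ * srcScale 1 f / tgtScale 1 f = 1 := by
    rw [srcScale, tgtScale, h1]
    have : knotScale f ≠ 0 := by linarith
    field_simp
    ring
  rw [lineOf_deform, h5, h2, cutoff_lineAngle_of_one_le hx, mul_one, sub_self, zero_smul, add_zero,
    one_mul, smul_axis]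

open Classical in
/-- The perturbation of the axis described by a long knot, as a function of the angle. -/
def knotPert (f : LongKnot (m + 1)) (t : ℝ) : E (m + 1) :=
  if Real.sin (t / 2) = 0 then 0 else f.1 (cotHalf t) - cotHalf t • axis m

theorem knotPert_of_cos_pos (f : LongKnot (m + 1)) {t : ℝ} (ht : 0 < Real.cos t) :
    knotPert f t = 0 := by
  rw [knotPert]
  split_ifs with h
  · rfl
  · have h1 : 1 ≤ |cotHalf t| := by
      rw [cos_eq_half] at ht
      rw [← one_le_sq_iff_one_le_abs, cotHalf, div_pow, one_le_div (by positivity)]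
      linarith
    rw [f.2.2 _ h1, smul_axis, sub_self]

theorem line_knotPert (f : LongKnot (m + 1)) : line 1 (knotPert f) = f.1 := by
  funext x
  rw [line, knotPert, if_neg (sin_lineAngle_div_two_pos x).ne', cotHalf_lineAngle, one_mul,
    add_sub_cancel]

/-- Near the base point the perturbation vanishes, since the knot is standard there. -/
theorem smoothFamOn_knotPert :
    SmoothFamOn (knotPert : LongKnot (m + 1) → ℝ → E (m + 1)) univ := by
  refine .of_local fun p _ => ?_
  by_cases h0 : Real.sin (p.2 / 2) = 0
  · have hU : IsOpen {q : LongKnot (m + 1) × ℝ | 0 < Real.cos q.2} :=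
      isOpen_lt continuous_const (by fun_prop)
    refine ⟨_, hU, ?_, (SmoothFamOn.const hU (c := fun _ => 0) continuous_const).congr hU
      fun q hq => knotPert_of_cos_pos q.1 hq⟩
    have h := Real.sin_sq_add_cos_sq (p.2 / 2)
    rw [h0] at h
    rw [mem_ofPred_eq, cos_eq_half, h0]
    linarith
  · have hU : IsOpen {q : LongKnot (m + 1) × ℝ | Real.sin (q.2 / 2) ≠ 0} :=
      isOpen_ne_fun (by fun_prop) continuous_const
    have hcot : SmoothFamOn (fun (_ : LongKnot (m + 1)) t => cotHalf t)
        {q : LongKnot (m + 1) × ℝ | Real.sin (q.2 / 2) ≠ 0} :=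
      (SmoothFamOn.of_contDiff hU (Real.contDiff_cos.comp (contDiff_id.div_const 2))).div hU
        (SmoothFamOn.of_contDiff hU (Real.contDiff_sin.comp (contDiff_id.div_const 2)))
        fun q hq => hq
    refine ⟨_, hU, h0, (((smoothFamOn_longKnot.reparam hU (c := fun f => f) continuous_id hcot
      fun _ _ => trivial).sub hU (hcot.smul hU
        (.const hU (c := fun _ => axis m) continuous_const)))).congr hU fun q hq => ?_⟩
    rw [knotPert, if_neg hq]

theorem isModel_knotPert (f : LongKnot (m + 1)) : IsModel 1 (knotPert f) := by
  have h := (isSmoothEmb_line_iff f.2.2).1 f.2.1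
  refine ⟨one_pos, smoothFamOn_knotPert.contDiff f, fun t => ?_, ?_, ?_⟩
  · have h1 := sin_half_add_int_mul t 1
    have h2 := cotHalf_add_int_mul t 1
    rw [Int.cast_one, one_mul] at h1 h2
    simp only [knotPert, h1, h2]
  · rw [line_knotPert]; exact h.2.2
  · rw [line_knotPert]; exact h.2.1

/-- The one-point compactification of a long knot. -/
def closure (f : LongKnot (m + 1)) : DirEmb m := (isModel_knotPert f).dirEmb

theorem lineOf_closure (f : LongKnot (m + 1)) : lineOf (closure f) = f.1 := by
  rw [closure, IsModel.lineOf_dirEmb, line_knotPert]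

theorem isLong_closure (f : LongKnot (m + 1)) : IsLong (closure f) := fun x hx => by
  rw [lineOf_closure]; exact f.2.2 x hx

theorem continuous_closure : Continuous (closure : LongKnot (m + 1) → DirEmb m) :=
  continuous_dirEmb isModel_knotPert continuous_const smoothFamOn_knotPert

theorem coe_closure (f : LongKnot (m + 1)) (z : Circle) :
    ((closure f).1.1.1 z : E (m + 2)) = compactify f z := by
  by_cases hz : z = 1
  · rw [compactify, if_pos hz, hz, (closure f).1.2]
  · obtain ⟨x, rfl⟩ := exists_lineAngle hz
    have h1 := invStereo_lineOf (closure f) x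
    rw [lineOf_closure] at h1
    rw [compactify, if_neg hz]
    have h2 : ((Circle.exp (lineAngle x) : Circle) : ℂ).im /
        (1 - ((Circle.exp (lineAngle x) : Circle) : ℂ).re) = x := by
      have h3 := sin_lineAngle_div_two_pos x
      have h4 := Real.sin_sq_add_cos_sq (lineAngle x / 2)
      rw [Circle.coe_exp, Complex.exp_ofReal_mul_I_re, Complex.exp_ofReal_mul_I_im, sin_eq_half,
        cos_eq_half (lineAngle x), div_eq_iff (by nlinarith)]
      rw [cos_lineAngle_div_two'] at h4 ⊢
      linear_combination x * h4
    rw [h2, h1]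
    rfl

/-- The long knot whose compactification is a given pointed embedding. -/
def toLongKnot (f : DirEmb m) (hf : IsLong f) : LongKnot (m + 1) := ⟨lineOf f, by
  have h := isModel_pert f
  have h1 := h.contDiff_line
  have h2 := h.injective
  have h3 := h.deriv_ne_zero
  rw [line_pert] at h1 h2 h3
  exact ⟨(isSmoothEmb_line_iff hf).2 ⟨h1, h3, h2⟩, hf⟩⟩

theorem closure_toLongKnot (f : DirEmb m) (hf : IsLong f) : closure (toLongKnot f hf) = f :=
  lineOf_injective (lineOf_closure _)

theorem toLongKnot_closure (f : LongKnot (m + 1)) (hf : IsLong (closure f)) :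
    toLongKnot (closure f) hf = f := Subtype.ext (lineOf_closure f)

theorem continuous_toLongKnot {Y : Type*} [TopologicalSpace Y] {F : Y → DirEmb m}
    (hF : Continuous F) (hl : ∀ y, IsLong (F y)) :
    Continuous fun y => toLongKnot (F y) (hl y) :=
  continuous_longKnot_iff.2 (smoothFamOn_lineOf.reparam isOpen_univ hF (.id isOpen_univ)
    fun _ _ => trivial)

theorem IsLong.speed_eq_one {f : DirEmb m} (hf : IsLong f) : speed f = 1 := by
  rw [← closure_toLongKnot f hf, closure, IsModel.speed_dirEmb, inv_one]

theorem IsLong.deform {f : DirEmb m} (hf : IsLong f) (s : unitInterval) :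
    IsLong (deform s f) := fun x hx => by
  have h1 : srcScale s f = tgtScale s f := by
    rw [srcScale, tgtScale, hf.speed_eq_one, inv_one, div_one]
  have h2 : 1 ≤ srcScale s f := by
    rw [h1, tgtScale]
    nlinarith [(dilTime_mem s).1, one_le_knotScale f]
  have h3 : 1 ≤ |srcScale s f * x| := by
    rw [abs_mul, abs_of_pos (srcScale_pos s f)]
    exact one_le_mul_of_one_le_of_one_le h2 hx
  rw [lineOf_deform, hf _ h3, hf.speed_eq_one, inv_one, one_mul, one_mul, smul_axis, smul_axis,
    sub_self, smul_zero, smul_zero, add_zero, h1, div_self (tgtScale_pos s f).ne', one_mul]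

/-! ### Equivariance under rotations about the long axis -/

theorem stereo_act_stab (A : SO (m + 1)) (v : E (m + 2)) :
    stereo (act (stab (m + 1) A) v) = act A (stereo v) := by
  rw [stereo, stereo, act_stab_zero, tail_act_stab, map_smul]

variable {f f' : DirEmb m} {A : SO m}

theorem smul_eq_iff_lineOf :
    f'.1 = stab m A • f.1 ↔ ∀ x, lineOf f' x = act (stab m A) (lineOf f x) := by
  constructor
  · intro h x
    rw [lineOf, h, coe_smul_embPt, angular_smul, stereo_act_stab, lineOf]
  · intro h
    refine Subtype.ext (Subtype.ext (funext fun z => Subtype.ext ?_))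
    by_cases hz : z = 1
    · rw [hz, f'.1.2, (stab m A • f.1).2]
    · obtain ⟨x, rfl⟩ := exists_lineAngle hz
      have h1 := invStereo_lineOf f' x
      rw [h x, ← act_stab_invStereo, invStereo_lineOf] at h1
      exact h1.symm

theorem speed_eq_of_smul (h : f'.1 = stab m A • f.1) : speed f' = speed f := by
  rw [speed, h, velocity_smul, norm_act, speed]

theorem dense_sin_half_ne_zero : Dense {t : ℝ | Real.sin (t / 2) ≠ 0} := by
  have h : {t : ℝ | Real.sin (t / 2) = 0} ⊆ range fun k : ℤ => (k : ℝ) * (2 * Real.pi) :=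
    fun t ht => by
      obtain ⟨k, hk⟩ := Circle.exp_eq_one.1 (exp_eq_one_iff_sin.2 ht)
      exact ⟨k, hk.symm⟩
  exact ((countable_range _).mono h).dense_compl ℝ

/-- Away from the base point this is a direct computation, at the base point it follows by continuity. -/
theorem pert_eq_of_smul (h : f'.1 = stab m A • f.1) : pert f' = fun t => act (stab m A) (pert f t) := by
  refine Continuous.ext_on dense_sin_half_ne_zero (smoothFamOn_pert.contDiff f').continuous
    ((act _).continuous.comp (smoothFamOn_pert.contDiff f).continuous) fun t ht => ?_
  have h1 : crv f' t = act (stab (m + 1) (stab m A)) (crv f t) := by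
    rw [crv, h, coe_smul_embPt, angular_smul, crv]
  change pert f' t = act (stab m A) (pert f t)
  rw [pert, pert, if_neg ht, if_neg ht, speed_eq_of_smul h, map_sub, map_smul, act_stab_axis, h1,
    stereo_act_stab]

theorem knotScale_eq_of_smul (h : f'.1 = stab m A • f.1) : knotScale f' = knotScale f := by
  have h1 : ∀ t, deriv (pert f') t = act (stab m A) (deriv (pert f) t) := fun t => by
    rw [pert_eq_of_smul h]
    exact ((act (stab m A)).hasFDerivAt.comp_hasDerivAt t
      ((smoothFamOn_pert.contDiff f).differentiable (by simp) t).hasDerivAt).deriv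
  simp only [knotScale, safeScale, speed_eq_of_smul h, circNorm, h1, norm_act]
  simp only [pert_eq_of_smul h, norm_act]

theorem deform_smul (h : f'.1 = stab m A • f.1) (s : unitInterval) :
    (deform s f').1 = stab m A • (deform s f).1 := by
  have h1 : srcScale s f' = srcScale s f := by
    rw [srcScale, srcScale, knotScale_eq_of_smul h, speed_eq_of_smul h]
  have h2 : tgtScale s f' = tgtScale s f := by rw [tgtScale, tgtScale, knotScale_eq_of_smul h]
  refine smul_eq_iff_lineOf.2 fun x => ?_
  rw [lineOf_deform, lineOf_deform, h1, h2, speed_eq_of_smul h, smul_eq_iff_lineOf.1 h, map_add,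
    map_smul, map_smul, map_smul, map_sub, map_smul, act_stab_axis]

theorem closure_smul (A : SO m) (f : LongKnot (m + 1)) :
    (closure (A • f)).1 = stab m A • (closure f).1 :=
  smul_eq_iff_lineOf.2 fun x => by rw [lineOf_closure, lineOf_closure, coe_smul_longKnot]

theorem toLongKnot_smul (h : f'.1 = stab m A • f.1) (hf : IsLong f) (hf' : IsLong f') :
    toLongKnot f' hf' = A • toLongKnot f hf :=
  Subtype.ext (funext fun x => by
    rw [coe_smul_longKnot]; exact smul_eq_iff_lineOf.1 h x)

/-! ### The homotopy equivalence between long knots and pointed knots with fixed direction -/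

/-- The one-point compactification as a continuous map. -/
def closureMap (m : ℕ) : C(LongKnot (m + 1), DirEmb m) := ⟨closure, continuous_closure⟩

/-- The straightening of a pointed embedding to a long knot. -/
def straighten (m : ℕ) : C(DirEmb m, LongKnot (m + 1)) :=
  ⟨fun f => toLongKnot (deform 1 f) (isLong_deform_one f),
    continuous_toLongKnot (continuous_deform.comp (.prodMk_right 1)) _⟩

/-- The straightening homotopy of pointed embeddings. -/
def dirEmbHomotopy (m : ℕ) :
    ((closureMap m).comp (straighten m)).Homotopy (.id (DirEmb m)) :=
  ContinuousMap.Homotopy.symm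
    { toFun := fun p => deform p.1 p.2
      continuous_toFun := continuous_deform
      map_zero_left := deform_zero
      map_one_left := fun f => (closure_toLongKnot _ (isLong_deform_one f)).symm }

/-- The straightening homotopy of long knots. -/
def longKnotHomotopy (m : ℕ) :
    ((straighten m).comp (closureMap m)).Homotopy (.id (LongKnot (m + 1))) :=
  ContinuousMap.Homotopy.symm
    { toFun := fun p => toLongKnot (deform p.1 (closure p.2)) ((isLong_closure p.2).deform p.1)
      continuous_toFun := continuous_toLongKnot (continuous_deform.comp
        (continuous_fst.prodMk (continuous_closure.comp continuous_snd))) _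
      map_zero_left := fun f => by
        simp only [deform_zero]
        exact toLongKnot_closure f _
      map_one_left := fun f => rfl }

theorem isHomotopyEquiv_closureMap : IsHomotopyEquiv (closureMap m) :=
  ⟨⟨closureMap m, straighten m, ⟨longKnotHomotopy m⟩, ⟨dirEmbHomotopy m⟩⟩, rfl⟩

end Deform

/-! ### The bundles of knots and their comparison maps -/

section Slices

variable {G H X T B Y : Type*} [Group G] [TopologicalSpace G] [IsTopologicalGroup G] [Group H]
  [TopologicalSpace H] [TopologicalSpace X] [MulAction H X] [ContinuousSMul H X]
  [TopologicalSpace T] [MulAction G T]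

/-- The map `G ×_H X → T`, `[g, x] ↦ g • i(x)`, for an `H`-equivariant map `i : X → T` to a
`G`-space. -/
def Balanced.actionMap [ContinuousSMul G T] (φ : H →* G) (i : C(X, T)) (hi : ∀ h x, i (h • x) = φ h • i x) :
    C(Balanced φ X, T) where
  toFun := Quotient.lift (fun a : G × X => a.1 • i a.2) (by
    rintro a b ⟨h, h1, h2⟩
    rw [h1, h2, hi, mul_smul])
  continuous_toFun := Balanced.continuous_iff.2
    (continuous_fst.smul (i.continuous.comp continuous_snd))

variable [TopologicalSpace B] [MulAction G B] [ContinuousSMul G B]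

/-- The fibre of an equivariant map to a homogeneous space is a slice. -/
theorem exists_local_slice {i : Y → T} {p : T → B} {b₀ : B} (hb : HasLocalSection G b₀)
    (hp : Continuous p) (hpe : ∀ (g : G) x, p (g • x) = g • p x) (hr : range i = p ⁻¹' {b₀})
    (e : T) : ∃ U ∈ 𝓝 e, ∃ γ : T → G, ContinuousOn γ U ∧ ∀ e' ∈ U, ∃ y, γ e' • i y = e' := by
  obtain ⟨ht, W, s, hW, h₀, hs, hsb⟩ := hb
  obtain ⟨g, hg⟩ := ht (p e)
  have hc : Continuous fun e' => g⁻¹ • p e' := hp.const_smul _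
  refine ⟨(fun e' => g⁻¹ • p e') ⁻¹' W, (hW.preimage hc).mem_nhds ?_, fun e' => g * s (g⁻¹ • p e'),
    continuousOn_const.mul (hs.comp hc.continuousOn fun _ h => h), fun e' he' => ?_⟩
  · rw [mem_preimage, ← hg, inv_smul_smul]
    exact h₀
  · have h1 : (g * s (g⁻¹ • p e'))⁻¹ • e' ∈ range i := by
      rw [hr, mem_preimage, mem_singleton_iff, hpe, inv_smul_eq_iff, mul_smul, hsb _ he',
        smul_inv_smul]
    obtain ⟨y, hy⟩ := h1
    exact ⟨y, by rw [hy, smul_inv_smul]⟩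

end Slices

section Spheres

variable {n m : ℕ}

theorem mem_range_stab_iff {A : SO (n + 1)} : A ∈ (stab n).range ↔ A • pole n = pole n :=
  ⟨fun ⟨B, hB⟩ => by rw [← hB]; exact Subtype.ext (act_stab_pole B), mem_range_stab⟩

theorem hasLocalSection_pole (hn : 1 ≤ n) : HasLocalSection (SO (n + 1)) (pole n) :=
  ⟨exists_smul_pole hn, _, rotTo, isOpen_ne_neg_pole, by norm_num [pole], continuousOn_rotTo,
    fun _ => rotTo_smul_pole⟩

/-- The sphere as a homogeneous space. -/
theorem exists_sphere_homeomorph (hn : 1 ≤ n) :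
    ∃ ρ : (SO (n + 1) ⧸ (stab n).range) ≃ₜ Sph n,
      ∀ A : SO (n + 1), ρ (A : SO (n + 1) ⧸ (stab n).range) = A • pole n :=
  exists_quotient_homeomorph (fun _ => mem_range_stab_iff) (hasLocalSection_pole hn)

end Spheres

section Knots

variable {m : ℕ}

attribute [local instance] continuousSMul_longKnot

instance : Nonempty (DirEmb m) := ⟨stdCircle m⟩

instance : Nonempty (EmbPt (m + 1)) := ⟨(stdCircle m).1⟩

instance : Nonempty (LongKnot (m + 1)) := ⟨straighten m (stdCircle m)⟩

theorem range_embPt : range (Subtype.val : EmbPt (m + 1) → Emb (m + 1)) = ev (m + 1) ⁻¹' {pole (m + 1)} :=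
  Subtype.range_coe

theorem range_dirEmb :
    range (Subtype.val : DirEmb m → EmbPt (m + 1)) = directionMap m ⁻¹' {pole m} :=
  Subtype.range_coe

theorem range_smallToBig : range (smallToBig m) =
    bigProj m ⁻¹' {((1 : SO (m + 2)) : SO (m + 2) ⧸ (stab (m + 1)).range)} := by
  ext a
  constructor
  · rintro ⟨b, rfl⟩
    obtain ⟨g, f, rfl⟩ := Balanced.exists_mk b
    exact (QuotientGroup.eq.2 (by rw [mul_one]; exact inv_mem ⟨g, rfl⟩))
  · obtain ⟨g, f, rfl⟩ := Balanced.exists_mk a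
    intro h
    have h1 : (g : SO (m + 2) ⧸ (stab (m + 1)).range) = (1 : SO (m + 2)) := h
    rw [QuotientGroup.eq, mul_one, inv_mem_iff] at h1
    obtain ⟨g', rfl⟩ := h1
    exact ⟨Balanced.mk _ g' f, rfl⟩

theorem range_mk_one {G H X : Type*} [Group G] [Group H] [MulAction H X] (φ : H →* G) :
    range (fun x : X => Balanced.mk φ 1 x) =
      Balanced.proj φ φ.range le_rfl ⁻¹' {((1 : G) : G ⧸ φ.range)} := by
  ext a
  constructor
  · rintro ⟨x, rfl⟩
    rfl
  · obtain ⟨g, x, rfl⟩ := Balanced.exists_mk a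
    intro h
    have h1 : (g : G ⧸ φ.range) = (1 : G) := h
    rw [QuotientGroup.eq, mul_one, inv_mem_iff] at h1
    obtain ⟨h', rfl⟩ := h1
    refine ⟨h' • x, ?_⟩
    change Balanced.mk φ 1 (h' • x) = _
    rw [← Balanced.mk_mul, one_mul]

theorem isFibreBundle_smallToBig : IsFibreBundle (smallToBig m) (bigProj m)
    ((1 : SO (m + 2)) : SO (m + 2) ⧸ (stab (m + 1)).range) :=
  haveI : Nonempty (SmallTotal m) := ⟨Balanced.mk _ 1 (straighten m (stdCircle m))⟩
  isFibreBundle_of_equivariant ((hasLocalRetraction_stab (m + 1)).hasLocalSection continuous_stab)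
    (Balanced.continuous_proj _ _ _) (Balanced.proj_smul _ _ _)
    (Balanced.isEmbedding_map _ continuous_stab (hasLocalRetraction_stab (m + 1))) range_smallToBig

theorem isFibreBundle_mk_one {G H X : Type*} [Group G] [TopologicalSpace G] [IsTopologicalGroup G]
    [Group H] [TopologicalSpace H] [TopologicalSpace X] [Nonempty X] [MulAction H X]
    [ContinuousSMul H X] {φ : H →* G} (hφ : HasLocalRetraction φ) (hc : Continuous φ) :
    IsFibreBundle (fun x : X => Balanced.mk φ 1 x) (Balanced.proj φ φ.range le_rfl)
      ((1 : G) : G ⧸ φ.range) :=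
  isFibreBundle_of_equivariant (hφ.hasLocalSection hc) (Balanced.continuous_proj _ _ _)
    (Balanced.proj_smul _ _ _) (Balanced.isEmbedding_mk_one hφ) (range_mk_one φ)

theorem isFibreBundle_smallProj :
    IsFibreBundle (fun f : LongKnot (m + 1) => Balanced.mk (stab m) 1 f) (smallProj m)
      ((1 : SO (m + 1)) : SO (m + 1) ⧸ (stab m).range) :=
  isFibreBundle_mk_one (hasLocalRetraction_stab m) continuous_stab

theorem isFibreBundle_finerProj :
    IsFibreBundle (fun f : LongKnot (m + 1) => Balanced.mk ((stab (m + 1)).comp (stab m)) 1 f)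
      (finerProj m) ((1 : SO (m + 2)) : SO (m + 2) ⧸ ((stab (m + 1)).comp (stab m)).range) :=
  isFibreBundle_mk_one ((hasLocalRetraction_stab (m + 1)).comp (hasLocalRetraction_stab m))
    (continuous_stab.comp continuous_stab)

theorem isFibreBundle_ev :
    IsFibreBundle (Subtype.val : EmbPt (m + 1) → Emb (m + 1)) (ev (m + 1)) (pole (m + 1)) :=
  isFibreBundle_of_equivariant (hasLocalSection_pole (by omega)) continuous_ev ev_smul .subtypeVal
    range_embPt

theorem isFibreBundle_direction (hm : 1 ≤ m) :
    IsFibreBundle (Subtype.val : DirEmb m → EmbPt (m + 1)) (directionMap m) (pole m) :=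
  isFibreBundle_of_equivariant (hasLocalSection_pole hm) continuous_direction direction_smul
    .subtypeVal range_dirEmb

theorem isFibreBundle_stab (hm : 1 ≤ m) :
    IsFibreBundle (stab m) (fun A : SO (m + 1) => A • pole m) (pole m) := by
  have hr : range (stab m) = (fun A : SO (m + 1) => A • pole m) ⁻¹' {pole m} := by
    ext A
    exact mem_range_stab_iff
  exact isFibreBundle_of_equivariant (G := SO (m + 1)) (hasLocalSection_pole hm)
    (continuous_id.smul continuous_const) (fun g A => mul_smul g A (pole m)) isEmbedding_stab hr

/-- The map `SO(n) ×_{SO(n-1)} K_{n,1} → Emb_*(S¹, Sⁿ)`. -/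
def thetaPt (m : ℕ) : C(SmallTotal m, EmbPt (m + 1)) :=
  Balanced.actionMap (stab m) ((ContinuousMap.mk Subtype.val).comp (closureMap m)) closure_smul

/-- The map `SO(n+1) ×_{SO(n-1)} K_{n,1} → Emb(S¹, Sⁿ)`. -/
def theta (m : ℕ) : C(BigTotal m, Emb (m + 1)) :=
  Balanced.actionMap ((stab (m + 1)).comp (stab m))
    (((ContinuousMap.mk Subtype.val).comp (ContinuousMap.mk Subtype.val)).comp (closureMap m))
    fun h f => congrArg Subtype.val (closure_smul h f)

theorem straighten_smul (h : SO m) (f f' : DirEmb m) (hf : f'.1 = stab m h • f.1) :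
    straighten m f' = h • straighten m f :=
  toLongKnot_smul (deform_smul hf 1) (isLong_deform_one f) (isLong_deform_one f')

theorem longKnotHomotopy_smul (t : unitInterval) (h : SO m) (f : LongKnot (m + 1)) :
    longKnotHomotopy m (t, h • f) = h • longKnotHomotopy m (t, f) :=
  toLongKnot_smul (deform_smul (closure_smul h f) _) ((isLong_closure f).deform _)
    ((isLong_closure (h • f)).deform _)

theorem dirEmbHomotopy_smul (t : unitInterval) (h : SO m) (f f' : DirEmb m)
    (hf : f'.1 = stab m h • f.1) :
    (dirEmbHomotopy m (t, f')).1 = stab m h • (dirEmbHomotopy m (t, f)).1 :=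
  deform_smul hf _

theorem mem_range_of_smul_dirEmb {g : SO (m + 1)} {f f' : DirEmb m} (h : g • f.1 = f'.1) :
    g ∈ (stab m).range := by
  have h1 := congrArg (directionMap m) h
  have h2 : directionMap m (g • f.1) = g • directionMap m f.1 := direction_smul g f.1
  rw [h2, f.2, f'.2] at h1
  exact mem_range_stab h1

theorem isFibreHomotopyEquiv_thetaPt (hm : 1 ≤ m) {B : Type*} {p : SmallTotal m → B}
    {q : EmbPt (m + 1) → B} (hpq : ∀ a, q (thetaPt m a) = p a)
    (hq : ∀ (g : SO (m + 1)) (f f' : DirEmb m), q (g • f.1) = q (g • f'.1)) :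
    IsFibreHomotopyEquiv p q (thetaPt m) :=
  isFibreHomotopyEquiv_of_equivariant (i := (Subtype.val : DirEmb m → EmbPt (m + 1)))
    .subtypeVal (longKnotHomotopy m) (dirEmbHomotopy m) straighten_smul longKnotHomotopy_smul
    dirEmbHomotopy_smul (fun _ _ _ => mem_range_of_smul_dirEmb)
    (exists_local_slice (hasLocalSection_pole hm) continuous_direction direction_smul range_dirEmb)
    (fun _ _ => rfl) hpq hq

/-- Slices for `Emb_*(S¹, Sⁿ)` in `Emb(S¹, Sⁿ)` and for the pointed embeddings of fixed direction in
`Emb_*(S¹, Sⁿ)` combine. -/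
theorem exists_local_slice_emb (hm : 1 ≤ m) (e : Emb (m + 1)) :
    ∃ U ∈ 𝓝 e, ∃ γ : Emb (m + 1) → SO (m + 2), ContinuousOn γ U ∧
      ∀ e' ∈ U, ∃ f : DirEmb m, γ e' • f.1.1 = e' := by
  obtain ⟨U, hU, γ, hγ, h⟩ := exists_local_slice (hasLocalSection_pole (by omega)) continuous_ev
    ev_smul range_embPt e
  choose! y hy using h
  have hyc : ContinuousOn y U := by
    refine (Topology.IsInducing.subtypeVal
      (t := {f : Emb (m + 1) | f.1 1 = pole (m + 1)})).continuousOn_iff.2 ?_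
    exact (hγ.inv.smul continuousOn_id).congr fun e' he' => by
      change (y e').1 = (γ e')⁻¹ • e'
      rw [eq_inv_smul_iff, hy e' he']
  obtain ⟨U', hU', γ', hγ', h'⟩ :=
    exists_local_slice (hasLocalSection_pole hm) continuous_direction direction_smul range_dirEmb (y e)
  refine ⟨U ∩ y ⁻¹' U', inter_mem hU ((hyc.continuousAt hU).preimage_mem_nhds hU'),
    fun e' => γ e' * stab (m + 1) (γ' (y e')),
    (hγ.mono inter_subset_left).mul (continuous_stab.comp_continuousOn
      (hγ'.comp (hyc.mono inter_subset_left) fun _ h => h.2)), fun e' he' => ?_⟩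
  obtain ⟨f, hf⟩ := h' _ he'.2
  refine ⟨f, ?_⟩
  rw [mul_smul, ← coe_smul_embPt, hf, hy _ he'.1]

theorem isHomotopyEquiv_theta (hm : 1 ≤ m) : IsHomotopyEquiv (theta m) := by
  have hi : Topology.IsEmbedding fun f : DirEmb m => f.1.1 :=
    Topology.IsEmbedding.subtypeVal.comp Topology.IsEmbedding.subtypeVal
  have hpt : ∀ (h : SO m) (f f' : DirEmb m),
      f'.1.1 = ((stab (m + 1)).comp (stab m)) h • f.1.1 → f'.1 = stab m h • f.1 :=
    fun h f f' hf => Subtype.ext hf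
  refine IsFibreHomotopyEquiv.isHomotopyEquiv (p := fun _ => ()) (q := fun _ => ())
    (isFibreHomotopyEquiv_of_equivariant hi (longKnotHomotopy m) (dirEmbHomotopy m)
      (fun h f f' hf => straighten_smul h f f' (hpt h f f' hf)) longKnotHomotopy_smul
      (fun t h f f' hf => congrArg Subtype.val (dirEmbHomotopy_smul t h f f' (hpt h f f' hf)))
      (fun g f f' hf => ?_) (exists_local_slice_emb hm) (fun _ _ => rfl) (fun _ => rfl)
      fun _ _ _ => rfl)
  have h1 := congrArg (ev (m + 1)) hf
  change g • ev (m + 1) f.1.1 = ev (m + 1) f'.1.1 at h1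
  have h2 : ∀ f : DirEmb m, ev (m + 1) f.1.1 = pole (m + 1) := fun f => f.1.2
  rw [h2, h2] at h1
  obtain ⟨g', rfl⟩ := mem_range_stab h1
  obtain ⟨h', rfl⟩ := mem_range_of_smul_dirEmb (g := g') (f := f) (f' := f') (Subtype.ext hf)
  exact ⟨h', rfl⟩

end Knots

/-! ### The evaluation map in dimension three -/

section Quaternion

variable {n : ℕ}

/-- A global section of the orbit map `SO(n+1) → Sⁿ` splits the evaluation map. -/
def splitEv (s : Sph n → SO (n + 1)) (hs : Continuous s) (hsp : ∀ v, s v • pole n = v) :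
    Emb n ≃ₜ Sph n × EmbPt n where
  toFun f := (ev n f, ⟨(s (ev n f))⁻¹ • f, by
    rw [smul_emb_apply, inv_smul_eq_iff, hsp]
    rfl⟩)
  invFun q := s q.1 • q.2.1
  left_inv f := smul_inv_smul _ f
  right_inv q := by
    have h : ev n (s q.1 • q.2.1) = q.1 := by
      rw [ev_smul]
      exact (congrArg _ q.2.2).trans (hsp q.1)
    refine Prod.ext h (Subtype.ext ?_)
    change (s (ev n (s q.1 • q.2.1)))⁻¹ • s q.1 • q.2.1 = q.2.1
    rw [h, inv_smul_smul]
  continuous_toFun := continuous_ev.prodMk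
    (continuous_induced_rng.2 ((hs.comp continuous_ev).inv.smul continuous_id))
  continuous_invFun := (hs.comp continuous_fst).smul (continuous_subtype_val.comp continuous_snd)

/-- The matrix of left multiplication by the quaternion `v`. -/
def quatMatrix (v : E 4) : Matrix (Fin 4) (Fin 4) ℝ :=
  !![v 0, -v 1, -v 2, -v 3; v 1, v 0, -v 3, v 2; v 2, v 3, v 0, -v 1; v 3, -v 2, v 1, v 0]

theorem quatMatrix_mem {v : E 4} (hv : ‖v‖ = 1) :
    quatMatrix v ∈ Matrix.specialOrthogonalGroup (Fin 4) ℝ := by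
  have h : v 0 ^ 2 + v 1 ^ 2 + v 2 ^ 2 + v 3 ^ 2 = 1 := by
    rw [← Fin.sum_univ_four (f := fun i => v i ^ 2), ← EuclideanSpace.real_norm_sq_eq, hv, one_pow]
  rw [Matrix.mem_specialOrthogonalGroup_iff, Matrix.mem_unitaryGroup_iff]
  constructor
  · ext i j
    fin_cases i <;> fin_cases j <;>
      simp [quatMatrix, Matrix.mul_apply, Fin.sum_univ_four, Matrix.star_apply] <;>
      first | ring1 | linear_combination h
  · rw [Matrix.det_succ_row_zero]
    simp [quatMatrix, Fin.sum_univ_four, Matrix.det_fin_three, Fin.succAbove]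
    linear_combination (v 0 ^ 2 + v 1 ^ 2 + v 2 ^ 2 + v 3 ^ 2 + 1) * h

/-- Left multiplication by a unit quaternion as a rotation. -/
def quatRot (v : Sph 3) : SO 4 := ⟨quatMatrix v, quatMatrix_mem (norm_sph v)⟩

theorem continuous_quatRot : Continuous quatRot := by
  refine continuous_induced_rng.2 (continuous_matrix fun i j => ?_)
  have hv : ∀ k, Continuous fun v : Sph 3 => (v : E 4) k := fun k => by fun_prop
  fin_cases i <;> fin_cases j <;> first | exact hv _ | exact (hv _).neg

theorem quatRot_smul_pole (v : Sph 3) : quatRot v • pole 3 = v := by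
  refine Subtype.ext ?_
  ext i
  rw [coe_smul_sph, act_apply]
  fin_cases i <;> simp [quatRot, quatMatrix, pole]

theorem nonempty_emb_three_homeomorph : Nonempty (Emb 3 ≃ₜ Sph 3 × EmbPt 3) :=
  ⟨splitEv quatRot continuous_quatRot quatRot_smul_pole⟩

end Quaternion

/-! ### The frame bundle of the two-sphere over the hemispheres -/

section Discs

/-- The point of the upper hemisphere of `S²` over a point of the unit disc. -/
def hemi (w : ℂ) (hw : ‖w‖ ≤ 1) : Sph 2 :=
  ⟨consL (√(1 - ‖w‖ ^ 2), !₂[w.re, w.im]), by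
    have h1 : 0 ≤ 1 - ‖w‖ ^ 2 := by nlinarith [norm_nonneg w]
    have h2 : ‖w‖ ^ 2 = w.re ^ 2 + w.im ^ 2 := by
      rw [← Complex.normSq_eq_norm_sq, Complex.normSq_apply]; ring
    have h3 : ‖(!₂[w.re, w.im] : E 2)‖ ^ 2 = ‖w‖ ^ 2 := by
      rw [EuclideanSpace.real_norm_sq_eq, Fin.sum_univ_two, h2]; rfl
    rw [mem_sphere_zero_iff_norm, ← sq_eq_sq₀ (norm_nonneg _) zero_le_one, norm_sq_eq_tail,
      consL_zero, tail_consL, Real.sq_sqrt h1, h3]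
    ring⟩

theorem hemi_zero (w : ℂ) (hw : ‖w‖ ≤ 1) : (hemi w hw : E 3) 0 = √(1 - ‖w‖ ^ 2) := rfl

theorem hemi_one (w : ℂ) (hw : ‖w‖ ≤ 1) : (hemi w hw : E 3) 1 = w.re := rfl

theorem hemi_two (w : ℂ) (hw : ‖w‖ ≤ 1) : (hemi w hw : E 3) 2 = w.im := rfl

theorem hemi_ne (w : ℂ) (hw : ‖w‖ ≤ 1) : (hemi w hw : E 3) 0 ≠ -1 := by
  rw [hemi_zero]
  linarith [Real.sqrt_nonneg (1 - ‖w‖ ^ 2)]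

theorem continuous_rotTo_hemi {Y : Type*} [TopologicalSpace Y] {w : Y → ℂ} (hw : Continuous w)
    (h : ∀ y, ‖w y‖ ≤ 1) : Continuous fun y => rotTo (hemi (w y) (h y)) := by
  refine continuousOn_rotTo.comp_continuous (continuous_induced_rng.2 (consL.continuous.comp
    (Continuous.prodMk ?_ ?_))) fun y => hemi_ne _ _
  · exact (continuous_const.sub (hw.norm.pow 2)).sqrt
  · refine (PiLp.continuous_toLp 2 _).comp (continuous_pi fun i => ?_)
    fin_cases i
    exacts [Complex.continuous_re.comp hw, Complex.continuous_im.comp hw]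

/-- The half turn about the third axis. -/
def halfTurn : SO 3 := ⟨Matrix.diagonal ![-1, -1, 1], by
  rw [Matrix.mem_specialOrthogonalGroup_iff, Matrix.mem_unitaryGroup_iff]
  constructor
  · ext i j
    fin_cases i <;> fin_cases j <;> simp [Matrix.mul_apply, Fin.sum_univ_three, Matrix.star_apply]
  · simp [Matrix.det_diagonal, Fin.prod_univ_three]⟩

theorem norm_le_one (w : Disc) : ‖(w : ℂ)‖ ≤ 1 := mem_closedBall_zero_iff.1 w.2

theorem norm_conj_le_one (w : Disc) : ‖(starRingEnd ℂ) (w : ℂ)‖ ≤ 1 := by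
  rw [RCLike.norm_conj]; exact norm_le_one w

theorem norm_neg_le_one (w : Disc) : ‖-(w : ℂ)‖ ≤ 1 := by
  rw [norm_neg]; exact norm_le_one w

/-- A section of `SO(3) → S²` over the upper hemisphere. -/
def upper (w : Disc) : SO 3 := rotTo (hemi _ (norm_conj_le_one w))

/-- A section of `SO(3) → S²` over the lower hemisphere. -/
def lower (w : Disc) : SO 3 := halfTurn * rotTo (hemi _ (norm_neg_le_one w))

theorem continuous_upper : Continuous upper :=
  continuous_rotTo_hemi (Complex.continuous_conj.comp continuous_subtype_val) norm_conj_le_one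

theorem continuous_lower : Continuous lower :=
  continuous_const.mul (continuous_rotTo_hemi continuous_subtype_val.neg norm_neg_le_one)

/-- The vertical projection of the sphere to the disc. -/
def shadow (v : Sph 2) : Disc := ⟨⟨(v : E 3) 1, -(v : E 3) 2⟩, by
  have h := norm_sq_eq_tail (v : E 3)
  rw [norm_sph v, EuclideanSpace.real_norm_sq_eq, Fin.sum_univ_two] at h
  rw [mem_closedBall_zero_iff, ← sq_le_one_iff₀ (norm_nonneg _), ← Complex.normSq_eq_norm_sq,
    Complex.normSq_apply]
  simp only [tail_apply, Fin.succ_zero_eq_one, Fin.succ_one_eq_two] at h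
  nlinarith [sq_nonneg ((v : E 3) 0)]⟩

theorem continuous_shadow : Continuous shadow := by
  refine continuous_induced_rng.2 ?_
  have hv : ∀ k, Continuous fun v : Sph 2 => (v : E 3) k := fun k => by fun_prop
  exact Complex.equivRealProdCLM.symm.continuous.comp ((hv 1).prodMk (hv 2).neg)

theorem sq_zero_eq (v : Sph 2) : 1 - ‖(shadow v : ℂ)‖ ^ 2 = (v : E 3) 0 ^ 2 := by
  have h := norm_sq_eq_tail (v : E 3)
  rw [norm_sph v, EuclideanSpace.real_norm_sq_eq, Fin.sum_univ_two] at h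
  simp only [tail_apply, Fin.succ_zero_eq_one, Fin.succ_one_eq_two] at h
  rw [← Complex.normSq_eq_norm_sq, Complex.normSq_apply, shadow]
  linarith

theorem sph_two_ext {v w : Sph 2} (h0 : (v : E 3) 0 = (w : E 3) 0) (h1 : (v : E 3) 1 = (w : E 3) 1)
    (h2 : (v : E 3) 2 = (w : E 3) 2) : v = w := by
  refine Subtype.ext ?_
  ext i
  fin_cases i
  exacts [h0, h1, h2]

theorem upper_smul_pole (w : Disc) : upper w • pole 2 = hemi _ (norm_conj_le_one w) :=
  rotTo_smul_pole (hemi_ne _ _)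

theorem halfTurn_smul (v : Sph 2) (i : Fin 3) :
    ((halfTurn • v : Sph 2) : E 3) i = (![-1, -1, 1] : Fin 3 → ℝ) i * (v : E 3) i := by
  rw [coe_smul_sph, act_apply]
  fin_cases i <;> simp [halfTurn, Fin.sum_univ_three]

theorem lower_smul_pole (w : Disc) :
    lower w • pole 2 = halfTurn • hemi _ (norm_neg_le_one w) := by
  rw [lower, mul_smul, rotTo_smul_pole (hemi_ne _ _)]

theorem upper_shadow {v : Sph 2} (hv : 0 ≤ (v : E 3) 0) : upper (shadow v) • pole 2 = v := by
  rw [upper_smul_pole]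
  refine sph_two_ext ?_ rfl ?_
  · rw [hemi_zero, RCLike.norm_conj, sq_zero_eq, Real.sqrt_sq hv]
  · rw [hemi_two]
    simp [shadow]

theorem lower_shadow {v : Sph 2} (hv : (v : E 3) 0 ≤ 0) : lower (shadow v) • pole 2 = v := by
  rw [lower_smul_pole]
  refine sph_two_ext ?_ ?_ ?_ <;> rw [halfTurn_smul]
  · rw [hemi_zero, norm_neg, sq_zero_eq, Real.sqrt_sq_eq_abs, abs_of_nonpos hv]
    simp
  · rw [hemi_one]
    simp [shadow]
  · rw [hemi_two]
    simp [shadow]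

theorem shadow_upper (w : Disc) : shadow (upper w • pole 2) = w := by
  rw [upper_smul_pole]
  refine Subtype.ext (Complex.ext ?_ ?_)
  · change (hemi _ (norm_conj_le_one w) : E 3) 1 = _
    rw [hemi_one, Complex.conj_re]
  · change -(hemi _ (norm_conj_le_one w) : E 3) 2 = _
    rw [hemi_two, Complex.conj_im, neg_neg]

theorem shadow_lower (w : Disc) : shadow (lower w • pole 2) = w := by
  rw [lower_smul_pole]
  refine Subtype.ext (Complex.ext ?_ ?_)
  · change ((halfTurn • hemi _ (norm_neg_le_one w) : Sph 2) : E 3) 1 = _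
    rw [halfTurn_smul, hemi_one]
    simp
  · change -((halfTurn • hemi _ (norm_neg_le_one w) : Sph 2) : E 3) 2 = _
    rw [halfTurn_smul, hemi_two]
    simp

theorem upper_zero_nonneg (w : Disc) : 0 ≤ ((upper w • pole 2 : Sph 2) : E 3) 0 := by
  rw [upper_smul_pole]
  exact Real.sqrt_nonneg _

theorem lower_zero_nonpos (w : Disc) : ((lower w • pole 2 : Sph 2) : E 3) 0 ≤ 0 := by
  rw [lower_smul_pole, halfTurn_smul, hemi_zero]
  simp

theorem rotTo_equator {v : Sph 2} (h0 : (v : E 3) 0 = 0) : (rotTo v).1 =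
    !![0, -(v : E 3) 1, -(v : E 3) 2; (v : E 3) 1, 1 - (v : E 3) 1 ^ 2, -((v : E 3) 1 * (v : E 3) 2);
      (v : E 3) 2, -((v : E 3) 2 * (v : E 3) 1), 1 - (v : E 3) 2 ^ 2] := by
  have h : (v : E 3) 0 ≠ -1 := by rw [h0]; norm_num
  have hd : ∀ i j : Fin 2, (rotTo v).1 i.succ j.succ = (if i = j then 1 else 0) -
      (v : E 3) i.succ * (v : E 3) j.succ := fun i j => by
    rw [rotTo_succ_succ h, h0, add_zero, div_one]
  ext i j
  fin_cases i <;> fin_cases j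
  · exact (rotTo_zero_zero h).trans h0
  · exact rotTo_zero_succ h 0
  · exact rotTo_zero_succ h 1
  · exact rotTo_succ_zero h 0
  · exact (hd 0 0).trans (by simp [sq])
  · exact (hd 0 1).trans (by simp)
  · exact rotTo_succ_zero h 1
  · exact (hd 1 0).trans (by simp)
  · exact (hd 1 1).trans (by simp [sq])

/-- On the equator the two sections differ by the clutching function `z ↦ z²`. -/
theorem upper_bdry (z : Circle) :
    upper (bdry z) = lower (bdry z) * stab 2 (circleRot (z ^ 2)) := by
  have hz : (z : ℂ).re ^ 2 + (z : ℂ).im ^ 2 = 1 := by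
    have h := z.normSq_coe
    rw [Complex.normSq_apply] at h
    linarith
  have e1 : (hemi _ (norm_conj_le_one (bdry z)) : E 3) 0 = 0 := by
    rw [hemi_zero, RCLike.norm_conj, bdry, Circle.norm_coe]; norm_num
  have e2 : (hemi _ (norm_neg_le_one (bdry z)) : E 3) 0 = 0 := by
    rw [hemi_zero, norm_neg, bdry, Circle.norm_coe]; norm_num
  have hre : ((z ^ 2 : Circle) : ℂ).re = (z : ℂ).re ^ 2 - (z : ℂ).im ^ 2 := by
    simp [sq]
  have him : ((z ^ 2 : Circle) : ℂ).im = 2 * (z : ℂ).re * (z : ℂ).im := by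
    simp [sq]; ring
  have hrot : blockOne (circleRot (z ^ 2)).1 =
      !![1, 0, 0; 0, ((z ^ 2 : Circle) : ℂ).re, -((z ^ 2 : Circle) : ℂ).im;
        0, ((z ^ 2 : Circle) : ℂ).im, ((z ^ 2 : Circle) : ℂ).re] := by
    ext i j
    fin_cases i <;> fin_cases j <;> rfl
  refine Subtype.ext ?_
  change (rotTo _).1 = halfTurn.1 * (rotTo _).1 * blockOne (circleRot (z ^ 2)).1
  rw [rotTo_equator e1, rotTo_equator e2, hrot, hre, him, hemi_one, hemi_two, hemi_one, hemi_two]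
  simp only [bdry, Complex.conj_re, Complex.conj_im, Complex.neg_re, Complex.neg_im]
  set x := (z : ℂ).re
  set y := (z : ℂ).im
  ext i j
  fin_cases i <;> fin_cases j <;>
    simp [halfTurn, Matrix.mul_apply, Fin.sum_univ_three, Matrix.diagonal_apply] <;> grind

end Discs

/-! ### The clutching description of pointed knots in the three-sphere -/

section Clutching

attribute [local instance] continuousSMul_longKnot

open Classical in
/-- The `SO(2)`-component of a rotation relative to a section `s` of `SO(3) → S²`. -/
def fibreCoord (s : Disc → SO 3) (g : SO 3) : SO 2 :=
  if h : ∃ k, stab 2 k = (s (shadow (g • pole 2)))⁻¹ * g then h.choose else 1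

variable {s : Disc → SO 3} {g : SO 3}

theorem stab_fibreCoord (h : s (shadow (g • pole 2)) • pole 2 = g • pole 2) :
    stab 2 (fibreCoord s g) = (s (shadow (g • pole 2)))⁻¹ * g := by
  have h1 : ∃ k, stab 2 k = (s (shadow (g • pole 2)))⁻¹ * g :=
    mem_range_stab (by rw [mul_smul, inv_smul_eq_iff, h])
  rw [fibreCoord, dif_pos h1]
  exact h1.choose_spec

theorem mul_stab_smul_pole (g : SO 3) (k : SO 2) : (g * stab 2 k) • pole 2 = g • pole 2 := by
  rw [mul_smul, mem_range_stab_iff.1 ⟨k, rfl⟩]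

theorem fibreCoord_mul_stab (h : s (shadow (g • pole 2)) • pole 2 = g • pole 2) (k : SO 2) :
    fibreCoord s (g * stab 2 k) = fibreCoord s g * k := by
  refine isEmbedding_stab.injective ?_
  rw [stab_fibreCoord (by rwa [mul_stab_smul_pole]), map_mul, stab_fibreCoord h, mul_stab_smul_pole,
    mul_assoc]

theorem continuousOn_fibreCoord (hs : Continuous s) :
    ContinuousOn (fibreCoord s) {g | s (shadow (g • pole 2)) • pole 2 = g • pole 2} := by
  rw [isEmbedding_stab.isInducing.continuousOn_iff]
  refine ContinuousOn.congr (f := fun g => (s (shadow (g • pole 2)))⁻¹ * g) ?_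
    fun g hg => stab_fibreCoord hg
  exact ((hs.comp (continuous_shadow.comp (continuous_id.smul continuous_const))).inv.mul
    continuous_id).continuousOn

/-- The map from the two glued copies of `D² × K_{3,1}` to the balanced product which covers the
decomposition of `S²` into hemispheres. -/
def discsToTotal : TwoDiscs → SmallTotal 2 :=
  Quot.lift (Sum.elim (fun p => Balanced.mk (stab 2) (upper p.1) p.2)
    fun p => Balanced.mk (stab 2) (lower p.1) p.2) (by
      rintro _ _ ⟨z, f⟩
      change Balanced.mk (stab 2) (upper (bdry z)) f =
        Balanced.mk (stab 2) (lower (bdry z)) (circleRot (z ^ 2) • f)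
      rw [upper_bdry, Balanced.mk_mul])

theorem continuous_discsToTotal : Continuous discsToTotal :=
  continuous_quot_lift _ (continuous_sumElim.2
    ⟨(Balanced.continuous_mk _).comp ((continuous_upper.comp continuous_fst).prodMk continuous_snd),
      (Balanced.continuous_mk _).comp
        ((continuous_lower.comp continuous_fst).prodMk continuous_snd)⟩)

/-- The coordinates over the upper hemisphere. -/
def upperCoord (a : SO 3 × LongKnot 3) : TwoDiscs :=
  Quot.mk _ (Sum.inl (shadow (a.1 • pole 2), fibreCoord upper a.1 • a.2))

/-- The coordinates over the lower hemisphere. -/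
def lowerCoord (a : SO 3 × LongKnot 3) : TwoDiscs :=
  Quot.mk _ (Sum.inr (shadow (a.1 • pole 2), fibreCoord lower a.1 • a.2))

/-- The height of the direction of the long axis after a rotation. -/
def height (g : SO 3) : ℝ := ((g • pole 2 : Sph 2) : E 3) 0

theorem continuous_height : Continuous height := by
  have h : Continuous fun v : Sph 2 => (v : E 3) 0 := by fun_prop
  exact h.comp (continuous_id.smul continuous_const)

theorem upperCoord_eq_lowerCoord {a : SO 3 × LongKnot 3} (h : height a.1 = 0) :
    upperCoord a = lowerCoord a := by
  have hn : ‖(shadow (a.1 • pole 2) : ℂ)‖ = 1 := by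
    have h1 := sq_zero_eq (a.1 • pole 2)
    change _ = height a.1 ^ 2 at h1
    rw [h] at h1
    nlinarith [norm_nonneg (shadow (a.1 • pole 2) : ℂ)]
  let z : Circle := ⟨shadow (a.1 • pole 2), mem_sphere_zero_iff_norm.2 hn⟩
  have hz : shadow (a.1 • pole 2) = bdry z := rfl
  have h1 : fibreCoord lower a.1 = circleRot (z ^ 2) * fibreCoord upper a.1 := by
    refine isEmbedding_stab.injective ?_
    rw [map_mul, stab_fibreCoord (upper_shadow h.ge), stab_fibreCoord (lower_shadow h.le), hz,
      upper_bdry]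
    group
  rw [upperCoord, lowerCoord, h1, mul_smul, hz]
  exact Quot.sound (.glue z _)

theorem continuousOn_upperCoord : ContinuousOn upperCoord {a | 0 ≤ height a.1} :=
  continuous_quot_mk.comp_continuousOn (continuous_inl.comp_continuousOn
    ((continuous_shadow.comp (continuous_fst.smul continuous_const)).continuousOn.prodMk
      (((continuousOn_fibreCoord continuous_upper).comp continuousOn_fst
        fun _ h => upper_shadow h).smul continuousOn_snd)))

theorem continuousOn_lowerCoord : ContinuousOn lowerCoord {a | height a.1 ≤ 0} :=
  continuous_quot_mk.comp_continuousOn (continuous_inr.comp_continuousOn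
    ((continuous_shadow.comp (continuous_fst.smul continuous_const)).continuousOn.prodMk
      (((continuousOn_fibreCoord continuous_lower).comp continuousOn_fst
        fun _ h => lower_shadow h).smul continuousOn_snd)))

open Classical in
/-- The inverse of `discsToTotal` before passing to the quotient. -/
def totalCoord (a : SO 3 × LongKnot 3) : TwoDiscs :=
  if 0 ≤ height a.1 then upperCoord a else lowerCoord a

theorem totalCoord_of_nonneg {g : SO 3} {f : LongKnot 3} (h : 0 ≤ height g) :
    totalCoord (g, f) = upperCoord (g, f) := if_pos h

theorem totalCoord_of_nonpos {g : SO 3} {f : LongKnot 3} (h : height g ≤ 0) :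
    totalCoord (g, f) = lowerCoord (g, f) := by
  rcases h.eq_or_lt with h1 | h1
  · exact (totalCoord_of_nonneg h1.ge).trans (upperCoord_eq_lowerCoord (a := (g, f)) h1)
  · exact if_neg h1.not_ge

theorem continuous_totalCoord : Continuous totalCoord := by
  classical
  exact continuous_if_le continuous_const (continuous_height.comp continuous_fst)
    continuousOn_upperCoord continuousOn_lowerCoord fun _ h => upperCoord_eq_lowerCoord h.symm

theorem totalCoord_mul_stab (g : SO 3) (k : SO 2) (f : LongKnot 3) :
    totalCoord (g * stab 2 k, f) = totalCoord (g, k • f) := by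
  have h : height (g * stab 2 k) = height g := by rw [height, mul_stab_smul_pole, height]
  rcases le_total 0 (height g) with h0 | h0
  · have h1 : 0 ≤ height (g * stab 2 k) := by rwa [h]
    have h2 : upper (shadow (g • pole 2)) • pole 2 = g • pole 2 := upper_shadow h0
    rw [totalCoord_of_nonneg h1, totalCoord_of_nonneg h0, upperCoord, upperCoord,
      mul_stab_smul_pole, fibreCoord_mul_stab h2, mul_smul]
  · have h1 : height (g * stab 2 k) ≤ 0 := by rwa [h]
    have h2 : lower (shadow (g • pole 2)) • pole 2 = g • pole 2 := lower_shadow h0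
    rw [totalCoord_of_nonpos h1, totalCoord_of_nonpos h0, lowerCoord, lowerCoord,
      mul_stab_smul_pole, fibreCoord_mul_stab h2, mul_smul]

/-- The inverse of `discsToTotal`. -/
def totalToDiscs : SmallTotal 2 → TwoDiscs :=
  Quotient.lift totalCoord (by
    rintro ⟨g, f⟩ ⟨g', f'⟩ ⟨k, h1, h2⟩
    change g = g' * stab 2 k at h1
    change f' = k • f at h2
    rw [h1, h2, totalCoord_mul_stab])

theorem mk_fibreCoord (h : s (shadow (g • pole 2)) • pole 2 = g • pole 2) (f : LongKnot 3) :
    Balanced.mk (stab 2) (s (shadow (g • pole 2))) (fibreCoord s g • f) = Balanced.mk (stab 2) g f := by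
  rw [← Balanced.mk_mul, stab_fibreCoord h, mul_inv_cancel_left]

theorem fibreCoord_section {w : Disc} (h : shadow (s w • pole 2) = w) : fibreCoord s (s w) = 1 := by
  refine isEmbedding_stab.injective ?_
  rw [stab_fibreCoord (by rw [h]), h, inv_mul_cancel, map_one]

/-- The balanced product over `S²` is obtained from the trivial bundles over the hemispheres by
glueing along the equator. -/
def discsHomeomorph : TwoDiscs ≃ₜ SmallTotal 2 where
  toFun := discsToTotal
  invFun := totalToDiscs
  left_inv a := by
    obtain ⟨⟨w, f⟩ | ⟨w, f⟩, rfl⟩ := Quot.exists_rep a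
    · change totalCoord (upper w, f) = _
      rw [totalCoord_of_nonneg (upper_zero_nonneg w), upperCoord, shadow_upper,
        fibreCoord_section (shadow_upper w), one_smul]
    · change totalCoord (lower w, f) = _
      rw [totalCoord_of_nonpos (lower_zero_nonpos w), lowerCoord, shadow_lower,
        fibreCoord_section (shadow_lower w), one_smul]
  right_inv a := by
    obtain ⟨g, f, rfl⟩ := Balanced.exists_mk a
    change discsToTotal (totalCoord (g, f)) = _
    rcases le_total 0 (height g) with h | h
    · rw [totalCoord_of_nonneg h]
      exact mk_fibreCoord (upper_shadow h) f
    · rw [totalCoord_of_nonpos h]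
      exact mk_fibreCoord (lower_shadow h) f
  continuous_toFun := continuous_discsToTotal
  continuous_invFun := Balanced.continuous_iff.2 continuous_totalCoord

theorem nonempty_embPt_three_homotopyEquiv :
    Nonempty (ContinuousMap.HomotopyEquiv (EmbPt 3) TwoDiscs) := by
  obtain ⟨e, -⟩ := (isFibreHomotopyEquiv_thetaPt (m := 2) one_le_two (p := fun _ => ())
    (q := fun _ => ()) (fun _ => rfl) fun _ _ _ => rfl).isHomotopyEquiv
  exact ⟨e.symm.trans discsHomeomorph.symm.toHomotopyEquiv⟩

end Clutching
end KnotSpaces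
end

open KnotSpaces in
theorem mainTheorem5 :
    -- Here `n = m + 1` is an arbitrary integer `≥ 2`.
    (∀ m : ℕ, 1 ≤ m →
      -- `SO(n-1)` acts continuously on `K_{n,1}`
      ContinuousSMul (SO m) (LongKnot (m + 1)) ∧
      ∃ (ρ : (SO (m + 2) ⧸ (stab (m + 1)).range) ≃ₜ Sph (m + 1))
        (σ : (SO (m + 1) ⧸ (stab m).range) ≃ₜ Sph m)
        (Θ : C(BigTotal m, Emb (m + 1)))
        (Θpt : C(SmallTotal m, EmbPt (m + 1)))
        (D : C(EmbPt (m + 1), Sph m))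
        (κ : C(LongKnot (m + 1), {f : EmbPt (m + 1) // D f = pole m})),
        -- the maps are the standard ones
        (∀ A : SO (m + 2), (ρ (A : SO (m + 2) ⧸ (stab (m + 1)).range) : E (m + 2)) =
          act A (pole (m + 1))) ∧
        (∀ A : SO (m + 1), (σ (A : SO (m + 1) ⧸ (stab m).range) : E (m + 1)) =
          act A (pole m)) ∧
        (∀ (A : SO (m + 2)) (f : LongKnot (m + 1)) (z : Circle),
          ((Θ (Balanced.mk _ A f)).1 z : E (m + 2)) = act A (compactify f z)) ∧
        (∀ f : EmbPt (m + 1), (D f : E (m + 1)) = tangentDir f) ∧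
        -- the first morphism of fibre bundles, over `SO(n+1)/SO(n) = Sⁿ`
        IsFibreBundle (smallToBig m) (bigProj m)
          ((1 : SO (m + 2)) : SO (m + 2) ⧸ (stab (m + 1)).range) ∧
        IsFibreBundle (Subtype.val : EmbPt (m + 1) → Emb (m + 1)) (ev (m + 1)) (pole (m + 1)) ∧
        (∀ a : SmallTotal m, Θ (smallToBig m a) = (Θpt a).1) ∧
        (∀ a : BigTotal m, ev (m + 1) (Θ a) = ρ (bigProj m a)) ∧
        IsHomotopyEquiv Θ ∧
        IsHomotopyEquiv Θpt ∧
        -- the second morphism of fibre bundles, over `SO(n)/SO(n-1) = Sⁿ⁻¹`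
        IsFibreBundle (fun f : LongKnot (m + 1) => Balanced.mk (stab m) 1 f) (smallProj m)
          ((1 : SO (m + 1)) : SO (m + 1) ⧸ (stab m).range) ∧
        IsFibreBundle (Subtype.val : {f : EmbPt (m + 1) // D f = pole m} → EmbPt (m + 1)) D
          (pole m) ∧
        (∀ f : LongKnot (m + 1), Θpt (Balanced.mk (stab m) 1 f) = (κ f).1) ∧
        (∀ a : SmallTotal m, D (Θpt a) = σ (smallProj m a)) ∧
        IsHomotopyEquiv κ ∧
        -- the bundle `K_{n,1} → Emb_*(S¹, Sⁿ) → Sⁿ⁻¹` (up to fibre homotopy equivalence) is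
        -- induced from `SO(n-1) → SO(n) → Sⁿ⁻¹`; for `m = 2` this is `SO(2) → SO(3) → S²`
        IsFibreBundle (stab m)
          (fun A : SO (m + 1) => σ (A : SO (m + 1) ⧸ (stab m).range)) (pole m) ∧
        IsFibreHomotopyEquiv (fun a : SmallTotal m => σ (smallProj m a)) D Θpt ∧
        -- the bundle over `SO(n+1)/SO(n-1)` with fibre `K_{n,1}`
        IsFibreBundle
          (fun f : LongKnot (m + 1) => Balanced.mk ((stab (m + 1)).comp (stab m)) 1 f)
          (finerProj m)
          ((1 : SO (m + 2)) : SO (m + 2) ⧸ ((stab (m + 1)).comp (stab m)).range)) ∧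
    -- `Emb(S¹, S³)` is homeomorphic to `S³ × Emb_*(S¹, S³)`
    Nonempty (Emb 3 ≃ₜ Sph 3 × EmbPt 3) ∧
    -- `Emb_*(S¹, S³)` as a union of two copies of `D² × K_{3,1}`
    Nonempty (ContinuousMap.HomotopyEquiv (EmbPt 3) TwoDiscs) := by
  refine ⟨fun m hm => ⟨continuousSMul_longKnot, ?_⟩, nonempty_emb_three_homeomorph,
    nonempty_embPt_three_homotopyEquiv⟩
  obtain ⟨ρ, hρ⟩ := exists_sphere_homeomorph (n := m + 1) (by omega)
  obtain ⟨σ, hσ⟩ := exists_sphere_homeomorph hm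
  have hD : ∀ a, directionMap m (thetaPt m a) = σ (smallProj m a) := fun a => by
    obtain ⟨A, f, rfl⟩ := Balanced.exists_mk a
    exact (direction_smul A (closure f).1).trans
      ((congrArg (A • ·) (closure f).2).trans (hσ A).symm)
  have hfib : IsFibreHomotopyEquiv (fun a => σ (smallProj m a)) (directionMap m) (thetaPt m) :=
    isFibreHomotopyEquiv_thetaPt hm hD fun g f f' =>
      (direction_smul g f.1).trans ((congrArg (g • ·) (f.2.trans f'.2.symm)).trans
        (direction_smul g f'.1).symm)
  refine ⟨ρ, σ, theta m, thetaPt m, directionMap m, closureMap m, fun A => ?_, fun A => ?_,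
    fun A f z => ?_, fun f => rfl, isFibreBundle_smallToBig, isFibreBundle_ev, fun a => ?_,
    fun a => ?_, isHomotopyEquiv_theta hm, hfib.isHomotopyEquiv, isFibreBundle_smallProj,
    isFibreBundle_direction hm, fun f => one_smul _ _, hD, isHomotopyEquiv_closureMap, ?_, hfib,
    isFibreBundle_finerProj⟩
  · rw [hρ]; rfl
  · rw [hσ]; rfl
  · rw [← coe_closure]; rfl
  · obtain ⟨A, f, rfl⟩ := Balanced.exists_mk a
    rfl
  · obtain ⟨A, f, rfl⟩ := Balanced.exists_mk a
    exact ((congrArg (A • ·) (closure f).1.2).trans (hρ A).symm)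
  · simp only [hσ]
    exact isFibreBundle_stab hm
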